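/- There are a deterministic Turing machine $M$, with a read-only two-way input tape, finitely many work tapes over a finite alphabet and a write-only output tape, and a constant $C$, such that the following holds. Let $G$ be a finite simple graph whose vertices are natural numbers (in arbitrary, not necessarily consecutive, numbering), such that $G$ is bipartite and Pfaffian and every vertex of $G$ has degree at least three; let $H$ be a Hamiltonian cycle in $G$ and let $e=\{s,t\}\in E(H)$. Let $x$ be a word that encodes $G$ and $H$ by adjacency lists (for each vertex of the graph, in any order, the vertex followed by its neighbours, in any order), followed by the two ends of $e$, with vertices written in binary. Then $M$ halts on input $x$, visits during its run at most $C(\lfloor\log_2|x|\rfloor+1)$ cells of each work tape, and outputs a list of the edges (each listed exactly once, as the pair of its ends) of a Hamiltonian cycle $H'\neq H$ in $G$ with $e\in E(H')$. (In particular the space is $O(\log n)$ on $n$-vertex graphs whose vertices are $O(\log n)$-bit integers.) Here an orientation of $G$ replaces each edge $\{u,v\}$ by exactly one of the arcs $(u,v)$, $(v,u)$; a cycle $Z$ of $G$ is central if $G\setminus V(Z)$ has a perfect matching (the empty graph has one); an orientation of $G$ is Pfaffian if for every central cycle $Z$ of $G$ both consistent (cyclic) orientations of $Z$ have an odd number of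 arcs in common with it; and $G$ is Pfaffian if it admits a Pfaffian orientation. -/

import Mathlib

/-! ## Hamiltonian cycles and Pfaffian graphs -/

/-- `H`, a spanning subgraph of `G`, is a Hamiltonian cycle of `G`: its edges are exactly the edges
of some closed walk of `G` that is a Hamiltonian cycle. -/
def IsHamCycle {V : Type*} [DecidableEq V] (G H : SimpleGraph V) : Prop :=
  ∃ (a : V) (p : G.Walk a a), p.IsHamiltonianCycle ∧ ∀ e, e ∈ H.edgeSet ↔ e ∈ p.edges

/-- `D` is an orientation of `G`: it has exactly one of the arcs `(u, v)`, `(v, u)` for every edge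
`{u, v}` of `G`, and no further arcs. -/
def IsOrientation {V : Type*} (G : SimpleGraph V) (D : Digraph V) : Prop :=
  (∀ u v, D.Adj u v → G.Adj u v) ∧ ∀ u v, G.Adj u v → Xor (D.Adj u v) (D.Adj v u)

/-- The cycle traced by the closed walk `p` is central: `G` without the vertices of the cycle has a
perfect matching. -/
def IsCentral {V : Type*} (G : SimpleGraph V) {a : V} (p : G.Walk a a) : Prop :=
  ∃ M : (G.induce {v | v ∉ p.support}).Subgraph, M.IsPerfectMatching

open Classical in
/-- The number of arcs that the traversal of the walk `p` has in common with `D`. -/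
noncomputable def arcsInCommon {V : Type*} {G : SimpleGraph V} (D : Digraph V) {a : V}
    (p : G.Walk a a) : ℕ :=
  p.darts.countP fun d => decide (D.Adj d.fst d.snd)

/-- Pfaffian orientations. A closed walk that is a cycle is a cycle together with a consistent
orientation of it, and both consistent orientations occur (reverse the walk). -/
def IsPfaffianOrientation {V : Type*} (G : SimpleGraph V) (D : Digraph V) : Prop :=
  IsOrientation G D ∧
    ∀ (a : V) (p : G.Walk a a), p.IsCycle → IsCentral G p → Odd (arcsInCommon D p)

/-- A graph is Pfaffian if it admits a Pfaffian orientation. -/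
def IsPfaffian {V : Type*} (G : SimpleGraph V) : Prop :=
  ∃ D : Digraph V, IsPfaffianOrientation G D

/-! ## Deterministic Turing machines with read-only input and write-only output -/

/-- Head movements. -/
inductive Move
  | left
  | stay
  | right

/-- What the input head sees: an input symbol or one of the two end markers. -/
inductive InputSymbol (α : Type)
  | leftEnd
  | symbol (a : α)
  | rightEnd

/-- What a machine with states `Q`, work alphabet `Γ`, `k` work tapes and output alphabet `β` does
in one step: the next state, the movement of the input head, for every work tape the symbol written
and the movement of the head, and at most one symbol to append to the output. -/
structure StepAction (Q Γ : Type) (k : ℕ) (β : Type) where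
  next : Q
  inputMove : Move
  write : Fin k → Γ
  workMove : Fin k → Move
  output : Option β

/-- A deterministic Turing machine with a read-only two-way input tape over `α`, finitely many work
tapes over a finite alphabet, and a write-only one-way output tape over `β`. The transition function
sees the state, the scanned input symbol and the scanned work symbols; the value `none` means that
the machine halts. -/
structure TuringTransducer (α β : Type) where
  State : Type
  [finState : Finite State]
  Work : Type
  [finWork : Finite Work]
  tapes : ℕ
  start : State
  blank : Work
  trans : State → InputSymbol α → (Fin tapes → Work) → Option (StepAction State Work tapes β)

namespace TuringTransducer

variable {α β : Type}

/-- A configuration. The cells of an input `x` are `1, …, x.length`, between the end markers in the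
cells `0` and `x.length + 1`; the cells of a work tape are `0, 1, 2, …`. -/
structure Cfg (M : TuringTransducer α β) where
  state : M.State
  inputHead : ℕ
  work : Fin M.tapes → ℕ → M.Work
  workHead : Fin M.tapes → ℕ
  output : List β

/-- The content of a cell of the input tape. -/
def readInput (x : List α) : ℕ → InputSymbol α
  | 0 => .leftEnd
  | i + 1 => match x[i]? with
    | some a => .symbol a
    | none => .rightEnd

/-- Move the input head, which never leaves the cells from `0` to `n + 1` (`n` the input length). -/
def moveInput (n i : ℕ) : Move → ℕ
  | .left => i - 1
  | .stay => i
  | .right => min (i + 1) (n + 1)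

/-- Move a work head; at the left end of the tape a movement to the left has no effect. -/
def moveWork (i : ℕ) : Move → ℕ
  | .left => i - 1
  | .stay => i
  | .right => i + 1

/-- The initial configuration: empty work tapes, empty output, heads in cell `0`. -/
def init (M : TuringTransducer α β) : M.Cfg where
  state := M.start
  inputHead := 0
  work := fun _ _ => M.blank
  workHead := fun _ => 0
  output := []

/-- One step of `M` on input `x`; `none` if `M` halts. -/
def step (M : TuringTransducer α β) (x : List α) (c : M.Cfg) : Option M.Cfg :=
  (M.trans c.state (readInput x c.inputHead) fun j => c.work j (c.workHead j)).map fun a =>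
    { state := a.next
      inputHead := moveInput x.length c.inputHead a.inputMove
      work := fun j => Function.update (c.work j) (c.workHead j) (a.write j)
      workHead := fun j => moveWork (c.workHead j) (a.workMove j)
      output := c.output ++ a.output.toList }

/-- On input `x` the machine halts with output `y`, and in the whole run only the first `S` cells of
each work tape are visited. -/
def OutputsInSpace (M : TuringTransducer α β) (x : List α) (y : List β) (S : ℕ) : Prop :=
  (∃ c, StateTransition.Reaches (M.step x) M.init c ∧ M.step x c = none ∧ c.output = y) ∧
    ∀ c, StateTransition.Reaches (M.step x) M.init c → ∀ j, c.workHead j < S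

end TuringTransducer

/-! ## Instances and solutions as words

The vertices are natural numbers; they are written in binary. -/

/-- The alphabet: binary digits, a symbol that ends a number, a symbol that ends a list of numbers
and a symbol that ends a list of lists. -/
inductive Letter
  | bit (b : Bool)
  | endNumber
  | endList
  | endGraph
  deriving DecidableEq, Fintype

/-- A number, written in binary, least significant digit first (no digits for `0`). -/
def encodeNumber (n : ℕ) : List Letter :=
  (Computability.encodeNat n).map Letter.bit ++ [Letter.endNumber]

/-- A list of numbers. -/
def encodeNumbers (l : List ℕ) : List Letter :=
  l.flatMap encodeNumber ++ [Letter.endList]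

/-- `rows` is a representation of `G` by adjacency lists: for every vertex, in any order, there is
exactly one pair of the vertex and the list, in any order and without repetition, of its
neighbours. -/
def IsAdjacencyLists {V : Finset ℕ} (G : SimpleGraph V) (rows : List (V × List V)) : Prop :=
  (rows.map Prod.fst).Nodup ∧ (∀ v, v ∈ rows.map Prod.fst) ∧
    ∀ r ∈ rows, r.2.Nodup ∧ ∀ u, u ∈ r.2 ↔ G.Adj r.1 u

/-- Adjacency lists as a word: each list is preceded by the vertex to which it belongs. -/
def encodeGraph {V : Finset ℕ} (rows : List (V × List V)) : List Letter :=
  rows.flatMap (fun r => encodeNumbers ((r.1 :: r.2).map Subtype.val)) ++ [Letter.endGraph]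

/-- An instance: the adjacency lists of the graph, the adjacency lists of the Hamiltonian cycle, and
the two ends of the edge. -/
def encodeInstance {V : Finset ℕ} (rowsG rowsH : List (V × List V)) (s t : V) : List Letter :=
  encodeGraph rowsG ++ encodeGraph rowsH ++ encodeNumbers [s.val, t.val]

/-- `es` lists every edge of `H` exactly once, in any order, as a pair of its ends, in any order. -/
def IsEdgeList {V : Finset ℕ} (H : SimpleGraph V) (es : List (V × V)) : Prop :=
  (es.map fun e => s(e.1, e.2)).Nodup ∧ ∀ e, e ∈ (es.map fun e => s(e.1, e.2)) ↔ e ∈ H.edgeSet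

/-- A list of edges as a word. -/
def encodeEdges {V : Finset ℕ} (es : List (V × V)) : List Letter :=
  es.flatMap fun e => encodeNumbers [e.1.val, e.2.val]

/-! ## Program fragments -/

/-- The symbols on the work tapes: a mark in the first cell, then binary digits, then blanks. -/
inductive Cell
  | blank
  | mark
  | zero
  | one
  deriving DecidableEq

instance : Finite Cell :=
  Finite.of_surjective ![Cell.blank, .mark, .zero, .one] fun c => by
    cases c
    exacts [⟨0, rfl⟩, ⟨1, rfl⟩, ⟨2, rfl⟩, ⟨3, rfl⟩]

/-- A configuration without the state. -/
structure Tapes (k : ℕ) where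
  head : ℕ
  work : Fin k → ℕ → Cell
  workHead : Fin k → ℕ
  out : List Letter

/-- The effect of an action on the tapes, for an input of length `n`. -/
def Tapes.apply {k : ℕ} {Q : Type} (n : ℕ) (r : Tapes k) (a : StepAction Q Cell k Letter) :
    Tapes k where
  head := TuringTransducer.moveInput n r.head a.inputMove
  work := fun j => Function.update (r.work j) (r.workHead j) (a.write j)
  workHead := fun j => TuringTransducer.moveWork (r.workHead j) (a.workMove j)
  out := r.out ++ a.output.toList

/-- Change the next state of an action. -/
def StepAction.mapNext {Q Q' Γ : Type} {k : ℕ} {β : Type} (f : Q → Q') (a : StepAction Q Γ k β) :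
    StepAction Q' Γ k β :=
  ⟨f a.next, a.inputMove, a.write, a.workMove, a.output⟩

/-- A finite piece of a machine with `k` work tapes, which ends with an exit value in `E`. -/
structure Frag (k : ℕ) (E : Type) where
  Q : Type
  [fin : Finite Q]
  entry : Q
  tr : Q → InputSymbol Letter → (Fin k → Cell) → StepAction (Q ⊕ E) Cell k Letter

attribute [instance] Frag.fin

namespace Frag

variable {k : ℕ} {E E' : Type}

/-- The action that is carried out in the state `q`. -/
def act (F : Frag k E) (x : List Letter) (q : F.Q) (r : Tapes k) :
    StepAction (F.Q ⊕ E) Cell k Letter :=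
  F.tr q (TuringTransducer.readInput x r.head) fun j => r.work j (r.workHead j)

/-- Started in the state `q`, the fragment exits with value `e`, changes the tapes from `r` to `r'`,
and visits only the first `S` cells of the work tapes. -/
inductive Path (x : List Letter) (S : ℕ) (F : Frag k E) : F.Q → Tapes k → E → Tapes k → Prop
  | exit {q : F.Q} {r r' : Tapes k} {e : E} : (∀ j, r.workHead j < S) →
      (F.act x q r).next = .inr e → r' = r.apply x.length (F.act x q r) → Path x S F q r e r'
  | step {q q' : F.Q} {r r' r'' : Tapes k} {e : E} : (∀ j, r.workHead j < S) →
      (F.act x q r).next = .inl q' → r'' = r.apply x.length (F.act x q r) →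
      Path x S F q' r'' e r' → Path x S F q r e r'

/-- Run `F`, then the fragment given by its exit value. -/
def bind [Finite E] (F : Frag k E) (G : E → Frag k E') : Frag k E' where
  Q := F.Q ⊕ (Σ e, (G e).Q)
  entry := .inl F.entry
  tr q a w := match q with
    | .inl q => (F.tr q a w).mapNext
        (Sum.elim (fun q => .inl (.inl q)) fun e => .inl (.inr ⟨e, (G e).entry⟩))
    | .inr ⟨e, q⟩ => ((G e).tr q a w).mapNext (Sum.map (fun q => .inr ⟨e, q⟩) id)

/-- Run `F` as long as `T` says `true`. -/
def loop (T : Frag k Bool) (F : Frag k Unit) : Frag k Unit where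
  Q := T.Q ⊕ F.Q
  entry := .inl T.entry
  tr q a w := match q with
    | .inl q => (T.tr q a w).mapNext
        (Sum.elim (fun q => .inl (.inl q)) fun b => if b then .inl (.inr F.entry) else .inr ())
    | .inr q => (F.tr q a w).mapNext
        (Sum.elim (fun q => .inl (.inr q)) fun _ => .inl (.inl T.entry))

variable {x : List Letter} {S : ℕ}

theorem Path.bind_right [Finite E] {F : Frag k E} {G : E → Frag k E'} {e : E} {q : (G e).Q}
    {r r' : Tapes k} {e' : E'} (h : Path x S (G e) q r e' r') :
    Path x S (F.bind G) (.inr ⟨e, q⟩) r e' r' := by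
  induction h with
  | exit hs hn hr =>
    refine .exit hs ?_ hr
    simp only [act] at hn
    simp [act, Frag.bind, StepAction.mapNext, hn]
  | step hs hn hr _ ih =>
    refine .step hs ?_ hr ih
    simp only [act] at hn
    simp [act, Frag.bind, StepAction.mapNext, hn]

theorem Path.bind [Finite E] {F : Frag k E} {G : E → Frag k E'} {e : E} {q : F.Q}
    {r r' r'' : Tapes k} {e' : E'} (h : Path x S F q r e r')
    (h' : Path x S (G e) (G e).entry r' e' r'') :
    Path x S (F.bind G) (.inl q) r e' r'' := by
  induction h with
  | exit hs hn hr =>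
    refine .step hs ?_ hr h'.bind_right
    simp only [act] at hn
    simp [act, Frag.bind, StepAction.mapNext, hn]
  | step hs hn hr _ ih =>
    refine .step hs ?_ hr (ih h')
    simp only [act] at hn
    simp [act, Frag.bind, StepAction.mapNext, hn]

theorem Path.loop_false {T : Frag k Bool} {F : Frag k Unit} {q : T.Q} {e : Bool}
    {r r' : Tapes k} (h : Path x S T q r e r') (he : e = false) :
    Path x S (T.loop F) (.inl q) r () r' := by
  induction h with
  | exit hs hn hr =>
    refine .exit hs ?_ hr
    simp only [act] at hn
    simp [act, Frag.loop, StepAction.mapNext, hn, he]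
  | step hs hn hr _ ih =>
    refine .step hs ?_ hr (ih he)
    simp only [act] at hn
    simp [act, Frag.loop, StepAction.mapNext, hn]

theorem Path.loop_body {T : Frag k Bool} {F : Frag k Unit} {q : F.Q} {u : Unit}
    {r r' r'' : Tapes k} (h : Path x S F q r u r')
    (h' : Path x S (T.loop F) (.inl T.entry) r' () r'') :
    Path x S (T.loop F) (.inr q) r () r'' := by
  induction h with
  | exit hs hn hr =>
    refine .step hs ?_ hr h'
    simp only [act] at hn
    simp [act, Frag.loop, StepAction.mapNext, hn]
  | step hs hn hr _ ih =>
    refine .step hs ?_ hr (ih h')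
    simp only [act] at hn
    simp [act, Frag.loop, StepAction.mapNext, hn]

theorem Path.loop_true {T : Frag k Bool} {F : Frag k Unit} {q : T.Q} {e : Bool}
    {r r' r'' : Tapes k} (h : Path x S T q r e r') (he : e = true)
    (h' : Path x S (T.loop F) (.inr F.entry) r' () r'') :
    Path x S (T.loop F) (.inl q) r () r'' := by
  induction h with
  | exit hs hn hr =>
    refine .step hs ?_ hr h'
    simp only [act] at hn
    simp [act, Frag.loop, StepAction.mapNext, hn, he]
  | step hs hn hr _ ih =>
    refine .step hs ?_ hr (ih he h')
    simp only [act] at hn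
    simp [act, Frag.loop, StepAction.mapNext, hn]

/-! ### From fragments to machines -/

/-- The machine that runs a fragment and halts. -/
def toMachine (F : Frag k Unit) : TuringTransducer Letter Letter where
  State := Option F.Q
  Work := Cell
  tapes := k
  start := some F.entry
  blank := .blank
  trans q a w := q.map fun q => (F.tr q a w).mapNext (Sum.elim some fun _ => none)

/-- A state and tapes as a configuration of the machine. -/
def cfg (F : Frag k Unit) (q : Option F.Q) (r : Tapes k) : F.toMachine.Cfg :=
  ⟨q, r.head, r.work, r.workHead, r.out⟩

theorem step_cfg_none (F : Frag k Unit) (r : Tapes k) :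
    F.toMachine.step x (F.cfg none r) = none := rfl

theorem step_cfg_some (F : Frag k Unit) (q : F.Q) (r : Tapes k) :
    F.toMachine.step x (F.cfg (some q) r) =
      some (F.cfg (Sum.elim some (fun _ => none) (F.act x q r).next)
        (r.apply x.length (F.act x q r))) := rfl

theorem Path.reaches {F : Frag k Unit} {q : F.Q} {r r' : Tapes k} {e : Unit}
    (h : Path x S F q r e r') :
    StateTransition.Reaches (F.toMachine.step x) (F.cfg (some q) r) (F.cfg none r') := by
  induction h with
  | exit hs hn hr =>
    refine .single ?_
    rw [step_cfg_some, hn, hr]; rfl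
  | step hs hn hr _ ih =>
    refine .head ?_ ih
    rw [step_cfg_some, hn, hr]; rfl

theorem Path.safe {F : Frag k Unit} {q : F.Q} {r r' : Tapes k} {e : Unit}
    (h : Path x S F q r e r') (hr' : ∀ j, r'.workHead j < S) (c : F.toMachine.Cfg)
    (hc : StateTransition.Reaches (F.toMachine.step x) (F.cfg (some q) r) c) :
    ∀ j, c.workHead j < S := by
  have key : ∀ (q : Option F.Q) (r : Tapes k), (∀ j, r.workHead j < S) →
      (∀ c', F.toMachine.step x (F.cfg q r) = some c' →
        StateTransition.Reaches (F.toMachine.step x) c' c → ∀ j, c.workHead j < S) →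
      StateTransition.Reaches (F.toMachine.step x) (F.cfg q r) c → ∀ j, c.workHead j < S := by
    intro q r hs hstep hc
    rcases Relation.ReflTransGen.cases_head hc with rfl | ⟨c', h1, h2⟩
    · exact hs
    · exact hstep c' h1 h2
  induction h with
  | exit hs hn hr =>
    refine key _ _ hs (fun c' h1 h2 => ?_) hc
    rw [step_cfg_some, hn, ← hr] at h1
    obtain rfl := Option.some.inj h1
    exact key none _ hr' (fun c' h1 => nomatch h1) h2
  | step hs hn hr _ ih =>
    refine key _ _ hs (fun c' h1 h2 => ?_) hc
    rw [step_cfg_some, hn, ← hr] at h1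
    obtain rfl := Option.some.inj h1
    exact ih hr' h2

theorem outputsInSpace {F : Frag k Unit} {r' : Tapes k}
    (h : Path x S F F.entry ⟨0, fun _ _ => .blank, fun _ => 0, []⟩ () r')
    (hr' : ∀ j, r'.workHead j < S) : F.toMachine.OutputsInSpace x r'.out S :=
  ⟨⟨_, h.reaches, step_cfg_none F r', rfl⟩, h.safe hr'⟩

end Frag

/-! ### Binary counters -/

/-- The number with the given binary digits, least significant digit first. -/
def digitsVal : List Bool → ℕ
  | [] => 0
  | b :: l => b.toNat + 2 * digitsVal l

/-- Digits, followed by blanks. -/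
def digitCells : List Bool → ℕ → Cell
  | [], _ => .blank
  | true :: _, 0 => .one
  | false :: _, 0 => .zero
  | _ :: l, i + 1 => digitCells l i

/-- The tape of a counter. -/
def counterTape (l : List Bool) : ℕ → Cell
  | 0 => .mark
  | i + 1 => digitCells l i

theorem digitCells_ne_mark (l : List Bool) (i : ℕ) : digitCells l i ≠ .mark := by
  induction l generalizing i with
  | nil => simp [digitCells]
  | cons b l ih => cases b <;> cases i <;> simp [digitCells, ih]

theorem digits_succ (l : List Bool) : ∃ (m : ℕ) (l' : List Bool), m ≤ l.length ∧
    (∀ i < m, digitCells l i = .one) ∧ digitCells l m ≠ .one ∧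
    (∀ i, digitCells l' i = if i < m then .zero else if i = m then .one else digitCells l i) ∧
    digitsVal l' = digitsVal l + 1 ∧
    (l'.length = l.length ∨ l'.length = l.length + 1 ∧ digitsVal l + 1 = 2 ^ l.length) := by
  induction l with
  | nil =>
    refine ⟨0, [true], by simp, by simp, by simp [digitCells], fun i => ?_, by simp [digitsVal], by simp [digitsVal]⟩
    cases i <;> simp [digitCells]
  | cons b l ih =>
    cases b with
    | false =>
      refine ⟨0, true :: l, by simp, by simp, by simp [digitCells], fun i => ?_, by simp [digitsVal]; omega, by simp⟩
      cases i <;> simp [digitCells]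
    | true =>
      obtain ⟨m, l', h1, h2, h3, h4, h5, h6⟩ := ih
      refine ⟨m + 1, false :: l', by simpa, fun i hi => ?_, by simpa [digitCells], fun i => ?_, ?_, ?_⟩
      · cases i with
        | zero => simp [digitCells]
        | succ i => exact h2 i (by omega)
      · cases i with
        | zero => simp [digitCells]
        | succ i => simp [digitCells, h4]
      · simp [digitsVal, h5]; omega
      · simp [digitsVal, pow_succ]; omega

theorem digits_pred (l : List Bool) (hl : digitsVal l ≠ 0) : ∃ (m : ℕ) (l' : List Bool), m < l.length ∧
    (∀ i < m, digitCells l i = .zero) ∧ digitCells l m = .one ∧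
    (∀ i, digitCells l' i = if i < m then .one else if i = m then .zero else digitCells l i) ∧
    digitsVal l' = digitsVal l - 1 ∧ l'.length = l.length := by
  induction l with
  | nil => simp [digitsVal] at hl
  | cons b l ih =>
    cases b with
    | true =>
      refine ⟨0, false :: l, by simp, by simp, by simp [digitCells], fun i => ?_, by simp [digitsVal], by simp⟩
      cases i <;> simp [digitCells]
    | false =>
      obtain ⟨m, l', h1, h2, h3, h4, h5, h6⟩ := ih (by simpa [digitsVal] using hl)
      have : digitsVal l ≠ 0 := by simpa [digitsVal] using hl
      refine ⟨m + 1, true :: l', by simpa, fun i hi => ?_, by simpa [digitCells], fun i => ?_, ?_, ?_⟩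
      · cases i with
        | zero => simp [digitCells]
        | succ i => exact h2 i (by omega)
      · cases i with
        | zero => simp [digitCells]
        | succ i => simp [digitCells, h4]
      · simp [digitsVal, h5]; omega
      · simp [h6]

theorem digits_isZero (l : List Bool) : ∃ m ≤ l.length, (∀ i < m, digitCells l i = .zero) ∧
    digitCells l m = if digitsVal l = 0 then .blank else .one := by
  induction l with
  | nil => exact ⟨0, by simp, by simp, by simp [digitsVal, digitCells]⟩
  | cons b l ih =>
    cases b with
    | true => exact ⟨0, by simp, by simp, by simp [digitsVal, digitCells]⟩
    | false =>
      obtain ⟨m, h1, h2, h3⟩ := ih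
      refine ⟨m + 1, by simpa, fun i hi => ?_, by simpa [digitCells, digitsVal] using h3⟩
      cases i with
      | zero => simp [digitCells]
      | succ i => exact h2 i (by omega)

/-- A machine state seen as an input head, counters and an output. -/
@[ext]
structure Regs (k : ℕ) where
  head : ℕ
  reg : Fin k → ℕ
  out : List Letter

/-- The tapes hold the counters, each with at most `L` digits. -/
def Holds {k : ℕ} (L : ℕ) (r : Tapes k) (σ : Regs k) : Prop :=
  r.head = σ.head ∧ r.out = σ.out ∧ ∀ j, r.workHead j = 0 ∧
    ∃ l : List Bool, l.length ≤ L ∧ digitsVal l = σ.reg j ∧ r.work j = counterTape l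

namespace Frag

variable {k : ℕ} {E E' : Type} {x : List Letter} {L : ℕ}

/-- The fragment changes the abstract state from `σ` to `σ'` and exits with `e`, within counters of
`L` digits. -/
def Runs (x : List Letter) (L : ℕ) (F : Frag k E) (σ : Regs k) (e : E) (σ' : Regs k) : Prop :=
  ∀ r, Holds L r σ → ∃ r', Holds L r' σ' ∧ F.Path x (L + 2) F.entry r e r'

theorem Runs.bind [Finite E] {F : Frag k E} {G : E → Frag k E'} {e : E} {e' : E'}
    {σ σ' σ'' : Regs k} (h : Runs x L F σ e σ') (h' : Runs x L (G e) σ' e' σ'') :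
    Runs x L (F.bind G) σ e' σ'' := by
  intro r hr
  obtain ⟨r', hr', hp⟩ := h r hr
  obtain ⟨r'', hr'', hp'⟩ := h' r' hr'
  exact ⟨r'', hr'', hp.bind hp'⟩

theorem Runs.loop_false {T : Frag k Bool} {F : Frag k Unit} {σ σ' : Regs k}
    (h : Runs x L T σ false σ') : Runs x L (T.loop F) σ () σ' := by
  intro r hr
  obtain ⟨r', hr', hp⟩ := h r hr
  exact ⟨r', hr', hp.loop_false rfl⟩

theorem Runs.loop_true {T : Frag k Bool} {F : Frag k Unit} {σ σ₁ σ₂ σ' : Regs k}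
    (h : Runs x L T σ true σ₁) (h₁ : Runs x L F σ₁ () σ₂) (h₂ : Runs x L (T.loop F) σ₂ () σ') :
    Runs x L (T.loop F) σ () σ' := by
  intro r hr
  obtain ⟨r₁, hr₁, hp⟩ := h r hr
  obtain ⟨r₂, hr₂, hp₁⟩ := h₁ r₁ hr₁
  obtain ⟨r', hr', hp₂⟩ := h₂ r₂ hr₂
  exact ⟨r', hr', hp.loop_true rfl (hp₁.loop_body hp₂)⟩

/-- A loop that goes through the states `s 0`, `s 1`, …, `s n`. -/
theorem Runs.loop_seq {T : Frag k Bool} {F : Frag k Unit} (s : ℕ → Regs k) (n : ℕ)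
    (hT : ∀ i < n, Runs x L T (s i) true (s i)) (hF : ∀ i < n, Runs x L F (s i) () (s (i + 1)))
    (hn : Runs x L T (s n) false (s n)) : Runs x L (T.loop F) (s 0) () (s n) := by
  have : ∀ d ≤ n, Runs x L (T.loop F) (s (n - d)) () (s n) := by
    intro d
    induction d with
    | zero => exact fun _ => hn.loop_false
    | succ d ih =>
      intro hd
      have e : n - (d + 1) + 1 = n - d := by omega
      exact .loop_true (hT _ (by omega)) (hF _ (by omega)) (e ▸ ih (by omega))
  simpa using this n le_rfl

/-- The program that moves the input head, writes and exits depending on the scanned symbol. -/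
def prim (f : InputSymbol Letter → Move × Option Letter × E) : Frag k E where
  Q := Unit
  entry := ()
  tr _ a w := ⟨.inr (f a).2.2, (f a).1, w, fun _ => .stay, (f a).2.1⟩

theorem runs_prim (f : InputSymbol Letter → Move × Option Letter × E) (σ : Regs k) :
    Runs x L (prim f) σ (f (TuringTransducer.readInput x σ.head)).2.2
      ⟨TuringTransducer.moveInput x.length σ.head (f (TuringTransducer.readInput x σ.head)).1,
        σ.reg, σ.out ++ (f (TuringTransducer.readInput x σ.head)).2.1.toList⟩ := by
  rintro r ⟨h1, h2, h3⟩
  refine ⟨_, ⟨?_, ?_, fun j => ?_⟩, .exit (fun j => by rw [(h3 j).1]; omega) ?_ rfl⟩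
  · simp [Tapes.apply, act, prim, h1]
  · simp [Tapes.apply, act, prim, h1, h2]
  · simpa [Tapes.apply, act, prim, TuringTransducer.moveWork] using h3 j
  · simp [act, prim, h1]

/-- Write the marks into the empty tapes. -/
def markTapes : Frag k Unit where
  Q := Unit
  entry := ()
  tr _ _ _ := ⟨.inr (), .stay, fun _ => .mark, fun _ => .stay, none⟩

theorem path_markTapes : ∃ r', Holds L r' (⟨0, fun _ => 0, []⟩ : Regs k) ∧
    (markTapes : Frag k Unit).Path x (L + 2) () ⟨0, fun _ _ => .blank, fun _ => 0, []⟩ () r' := by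
  refine ⟨_, ⟨?_, ?_, fun j => ⟨?_, [], ?_, ?_, ?_⟩⟩, .exit (fun j => by simp) rfl rfl⟩
  · rfl
  · rfl
  · rfl
  · simp
  · rfl
  · funext i
    cases i <;> simp [Tapes.apply, act, markTapes, counterTape, digitCells]

/-- Sweep over the counter `j`: `g` rewrites the digits until it gives an exit value. -/
def sweep (j : Fin k) (g : Cell → Cell × Option E) [Finite E] : Frag k E where
  Q := Option (Option E)
  entry := none
  tr q _ w := match q with
    | none => ⟨.inl (some none), .stay, w, fun i => if i = j then .right else .stay, none⟩
    | some none => match (g (w j)).2 with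
      | none => ⟨.inl (some none), .stay, Function.update w j (g (w j)).1,
          fun i => if i = j then .right else .stay, none⟩
      | some e => ⟨.inl (some (some e)), .stay, Function.update w j (g (w j)).1,
          fun i => if i = j then .left else .stay, none⟩
    | some (some e) => if w j = .mark then ⟨.inr e, .stay, w, fun _ => .stay, none⟩
        else ⟨.inl (some (some e)), .stay, w, fun i => if i = j then .left else .stay, none⟩

/-- The tapes with a new content and head position of tape `j`. -/
def _root_.Tapes.setTape (r : Tapes k) (j : Fin k) (τ : ℕ → Cell) (i : ℕ) : Tapes k :=
  ⟨r.head, Function.update r.work j τ, Function.update r.workHead j i, r.out⟩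

theorem path_sweep_back [Finite E] {S : ℕ} (j : Fin k) (g : Cell → Cell × Option E) (r : Tapes k)
    (hr : ∀ j, r.workHead j = 0) (τ : ℕ → Cell) (h0 : τ 0 = .mark) (h1 : ∀ i, τ (i + 1) ≠ .mark)
    (e : E) (i : ℕ) (hi : i < S) :
    (sweep j g).Path x S (some (some e)) (r.setTape j τ i) e (r.setTape j τ 0) := by
  have hs : ∀ i < S, ∀ j', (r.setTape j τ i).workHead j' < S := by
    intro i hi j'
    by_cases h : j' = j
    · subst h; simpa [Tapes.setTape] using hi
    · simp [Tapes.setTape, h, hr]; omega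
  induction i with
  | zero =>
    refine .exit (hs _ hi) ?_ ?_
    · simp [act, sweep, Tapes.setTape, h0]
    · simp [act, sweep, Tapes.setTape, h0, Tapes.apply, TuringTransducer.moveInput,
        TuringTransducer.moveWork]
  | succ i ih =>
    refine .step (hs _ hi) (q' := some (some e)) ?_ ?_ (ih (by omega))
    · simp [act, sweep, Tapes.setTape, h1]
    · simp only [act, sweep, Tapes.setTape, Function.update_self, h1, if_false, Tapes.apply,
        TuringTransducer.moveInput, Option.toList_none, List.append_nil, Function.update_eq_self]
      congr 1
      funext j'
      by_cases h : j' = j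
      · subst h; simp [TuringTransducer.moveWork]
      · simp [h, TuringTransducer.moveWork]

theorem path_sweep [Finite E] {S : ℕ} (j : Fin k) (g : Cell → Cell × Option E) (r : Tapes k)
    (hr : ∀ j, r.workHead j = 0) (τ : ℕ → Cell) (hτ : r.work j = τ) (h0 : τ 0 = .mark)
    (h1 : ∀ i, τ (i + 1) ≠ .mark) (hg : ∀ c, c ≠ .mark → (g c).1 ≠ .mark)
    (m : ℕ) (hm : m + 1 < S) (e : E) (hgo : ∀ i < m, (g (τ (i + 1))).2 = none)
    (hlast : (g (τ (m + 1))).2 = some e) :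
    (sweep j g).Path x S none r e
      (r.setTape j (fun i => if i = 0 ∨ m + 1 < i then τ i else (g (τ i)).1) 0) := by
  let τ' : ℕ → ℕ → Cell := fun d i => if i = 0 ∨ d < i then τ i else (g (τ i)).1
  have hs : ∀ τ, ∀ i < S, ∀ j', (r.setTape j τ i).workHead j' < S := by
    intro τ i hi j'
    by_cases h : j' = j
    · subst h; simpa [Tapes.setTape] using hi
    · simp [Tapes.setTape, h, hr]; omega
  have hupd : ∀ d, Function.update (τ' d) (d + 1) (g (τ (d + 1))).1 = τ' (d + 1) := by
    intro d
    funext i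
    by_cases h : i = d + 1
    · subst h; simp [τ']
    · simp only [Function.update_of_ne h, τ']
      congr 1
      simp only [eq_iff_iff]; omega
  have hrd : ∀ d, τ' d (d + 1) = τ (d + 1) := fun d => by simp [τ']
  have main : ∀ d ≤ m, (sweep j g).Path x S (some none) (r.setTape j (τ' (m - d)) (m - d + 1)) e
      (r.setTape j (τ' (m + 1)) 0) := by
    intro d
    induction d with
    | zero =>
      intro _
      rw [Nat.sub_zero]
      refine .step (hs _ _ hm) (q' := some (some e)) ?_ rfl ?_
      · simp [act, sweep, Tapes.setTape, hrd, hlast]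
      · have : (r.setTape j (τ' m) (m + 1)).apply x.length
            ((sweep j g).act x (some none) (r.setTape j (τ' m) (m + 1))) =
            r.setTape j (τ' (m + 1)) m := by
          simp only [act, sweep, Tapes.setTape, Function.update_self, hrd, hlast, Tapes.apply,
            TuringTransducer.moveInput, Option.toList_none, List.append_nil]
          congr 1
          · funext j'
            by_cases h : j' = j
            · subst h; simp [hupd]
            · simp [h]
          · funext j'
            by_cases h : j' = j
            · subst h; simp [TuringTransducer.moveWork]
            · simp [h, TuringTransducer.moveWork]
        rw [this]
        refine path_sweep_back j g r hr _ (by simp [τ', h0]) (fun i => ?_) e m (by omega)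
        by_cases hi : m + 1 < i + 1
        · simpa [τ', hi] using h1 i
        · simpa [τ', hi] using hg _ (h1 i)
    | succ d ih =>
      intro hd
      have e1 : m - d = m - (d + 1) + 1 := by omega
      have hlt : m - (d + 1) < m := by omega
      generalize m - (d + 1) = c at e1 hlt
      rw [e1] at ih
      refine .step (hs _ _ (by omega)) (q' := some none) ?_ ?_ (ih (by omega))
      · simp [act, sweep, Tapes.setTape, hrd, hgo c hlt]
      · simp only [act, sweep, Tapes.setTape, Function.update_self, hrd, hgo c hlt, Tapes.apply,
          TuringTransducer.moveInput, Option.toList_none, List.append_nil]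
        congr 1
        · funext j'
          by_cases h : j' = j
          · subst h; simp [hupd]
          · simp [h]
        · funext j'
          by_cases h : j' = j
          · subst h; simp [TuringTransducer.moveWork]
          · simp [h, TuringTransducer.moveWork]
  refine .step (q' := some none) (fun j => by rw [hr]; omega) rfl ?_ (main m le_rfl)
  have h00 : τ' 0 = r.work j := by
    rw [hτ]; funext i; simp only [τ']; split_ifs <;> first | rfl | omega
  simp only [Nat.sub_self, h00, act, sweep, Tapes.setTape, Tapes.apply,
    TuringTransducer.moveInput, Option.toList_none, List.append_nil, Function.update_eq_self]
  congr 1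
  funext j'
  by_cases h : j' = j
  · subst h; simp [TuringTransducer.moveWork, hr]
  · simp [h, TuringTransducer.moveWork]

/-- Set a counter. -/
def _root_.Regs.set (σ : Regs k) (j : Fin k) (n : ℕ) : Regs k :=
  ⟨σ.head, Function.update σ.reg j n, σ.out⟩

theorem runs_sweep [Finite E] (j : Fin k) (g : Cell → Cell × Option E)
    (hg : ∀ c, c ≠ .mark → (g c).1 ≠ .mark) (σ : Regs k) (n : ℕ) (e : E)
    (h : ∀ l : List Bool, l.length ≤ L → digitsVal l = σ.reg j → ∃ m l', m ≤ L ∧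
      (∀ i < m, (g (digitCells l i)).2 = none) ∧ (g (digitCells l m)).2 = some e ∧
      l'.length ≤ L ∧ digitsVal l' = n ∧
      ∀ i, digitCells l' i = if i ≤ m then (g (digitCells l i)).1 else digitCells l i) :
    Runs x L (sweep j g) σ e (σ.set j n) := by
  rintro r ⟨h1, h2, h3⟩
  obtain ⟨l, hl, hv, hw⟩ := (h3 j).2
  obtain ⟨m, l', hm, hgo, hlast, hl', hv', hc⟩ := h l hl hv
  refine ⟨_, ?_, path_sweep j g r (fun j => (h3 j).1) (counterTape l) hw rfl
    (fun i => digitCells_ne_mark l i) hg m (by omega) e hgo hlast⟩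
  refine ⟨h1, h2, fun j' => ?_⟩
  by_cases hj : j' = j
  · subst hj
    refine ⟨by simp [Tapes.setTape], l', hl', by simpa [Regs.set] using hv', ?_⟩
    simp only [Tapes.setTape, Function.update_self]
    funext i
    cases i with
    | zero => simp [counterTape]
    | succ i =>
      simp only [counterTape, hc]
      by_cases hi : i ≤ m
      · rw [if_neg (by omega), if_pos hi]
      · rw [if_pos (by omega), if_neg hi]
  · simpa [Tapes.setTape, Regs.set, hj] using h3 j'

/-- Add one to a counter. -/
def inc (j : Fin k) : Frag k Unit :=
  sweep j fun c => if c = .one then (.zero, none) else (.one, some ())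

/-- Subtract one from a counter. -/
def dec (j : Fin k) : Frag k Unit :=
  sweep j fun c => if c = .zero then (.one, none) else (.zero, some ())

/-- Is the counter positive? -/
def pos (j : Fin k) : Frag k Bool :=
  sweep j fun c => if c = .zero then (.zero, none) else (c, some (decide (c = .one)))

theorem runs_inc (j : Fin k) (σ : Regs k) (h : σ.reg j + 1 < 2 ^ L) :
    Runs x L (inc j) σ () (σ.set j (σ.reg j + 1)) := by
  refine runs_sweep j _ (fun c hc => by split_ifs <;> simp) σ _ () fun l hl hv => ?_
  obtain ⟨m, l', hm, h1, h2, h3, h4, h5⟩ := digits_succ l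
  refine ⟨m, l', by omega, fun i hi => by simp [h1 i hi], by simp [h2], ?_, by rw [h4, hv],
    fun i => ?_⟩
  · rcases h5 with h5 | ⟨h5, h6⟩
    · omega
    · rw [hv] at h6
      rw [h6, Nat.pow_lt_pow_iff_right (by omega)] at h
      omega
  · rw [h3]
    rcases lt_trichotomy i m with hi | hi | hi
    · simp [hi, hi.le, h1 i hi]
    · subst hi; simp [h2]
    · simp [hi.not_ge, hi.not_gt, hi.ne']

theorem runs_dec (j : Fin k) (σ : Regs k) (h : σ.reg j ≠ 0) :
    Runs x L (dec j) σ () (σ.set j (σ.reg j - 1)) := by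
  refine runs_sweep j _ (fun c hc => by split_ifs <;> simp) σ _ () fun l hl hv => ?_
  obtain ⟨m, l', hm, h1, h2, h3, h4, h5⟩ := digits_pred l (hv ▸ h)
  refine ⟨m, l', by omega, fun i hi => by simp [h1 i hi], by simp [h2], by omega, by rw [h4, hv],
    fun i => ?_⟩
  rw [h3]
  rcases lt_trichotomy i m with hi | hi | hi
  · simp [hi, hi.le, h1 i hi]
  · subst hi; simp [h2]
  · simp [hi.not_ge, hi.not_gt, hi.ne']

theorem runs_pos (j : Fin k) (σ : Regs k) :
    Runs x L (pos j) σ (decide (σ.reg j ≠ 0)) σ := by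
  have hσ : σ.set j (σ.reg j) = σ := by simp [Regs.set]
  have key : Runs x L (pos j) σ (decide (σ.reg j ≠ 0)) (σ.set j (σ.reg j)) := by
    refine runs_sweep j _ (fun c hc => ?_) σ _ _ fun l hl hv => ?_
    · by_cases h : c = .zero
      · simp [h]
      · simpa [h] using hc
    obtain ⟨m, hm, h1, h2⟩ := digits_isZero l
    refine ⟨m, l, by omega, fun i hi => by simp [h1 i hi], ?_, hl, hv, fun i => ?_⟩
    · by_cases h : digitsVal l = 0
      · rw [h2, ← hv, if_pos h, h]; rfl
      · rw [h2, ← hv, if_neg h, decide_eq_true h]; rfl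
    · by_cases h : digitCells l i = .zero <;> simp [h]
  rwa [hσ] at key

end Frag

namespace Frag

variable {k : ℕ} {E E' : Type} {x : List Letter} {L : ℕ}

/-! ### Composite programs -/

/-- Do nothing. -/
def ret (e : E) : Frag k E := prim fun _ => (.stay, none, e)

/-- Run one program after the other. -/
def seq (F : Frag k Unit) (G : Frag k E) : Frag k E := F.bind fun _ => G

theorem runs_ret (e : E) (σ : Regs k) : Runs x L (ret e) σ e σ := by
  have := runs_prim (x := x) (L := L) (fun _ => (.stay, none, e)) σ
  simp only [TuringTransducer.moveInput, Option.toList_none, List.append_nil] at this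
  exact this

theorem runs_ret_of_eq {e e' : E} {σ σ' : Regs k} (h : e = e') (h' : σ = σ') :
    Runs x L (ret e) σ e' σ' := by
  subst h h'; exact runs_ret e σ

theorem Runs.seq {F : Frag k Unit} {G : Frag k E} {σ σ' σ'' : Regs k} {e : E}
    (h : Runs x L F σ () σ') (h' : Runs x L G σ' e σ'') : Runs x L (F.seq G) σ e σ'' :=
  h.bind h'

/-- Set a counter to zero. -/
def clear (r : Fin k) : Frag k Unit := loop (pos r) (dec r)

/-- Copy the counter `a` to the counter `b`, with the help of the counter `t`. -/
def copy (t a b : Fin k) : Frag k Unit :=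
  (clear b).seq ((loop (pos a) ((dec a).seq (inc t))).seq
    (loop (pos t) ((dec t).seq ((inc a).seq (inc b)))))

end Frag

namespace Regs

variable {k : ℕ}

@[simp] theorem set_head (σ : Regs k) (j : Fin k) (n : ℕ) : (σ.set j n).head = σ.head := rfl

@[simp] theorem set_out (σ : Regs k) (j : Fin k) (n : ℕ) : (σ.set j n).out = σ.out := rfl

theorem set_reg (σ : Regs k) (j i : Fin k) (n : ℕ) :
    (σ.set j n).reg i = if i = j then n else σ.reg i := by
  simp [Regs.set, Function.update_apply]

@[simp] theorem set_reg_self (σ : Regs k) (j : Fin k) (n : ℕ) : (σ.set j n).reg j = n := by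
  simp [set_reg]

theorem set_reg_of_ne (σ : Regs k) {j i : Fin k} (h : i ≠ j) (n : ℕ) :
    (σ.set j n).reg i = σ.reg i := by
  simp [set_reg, h]

theorem ext_reg {σ σ' : Regs k} (h₁ : σ.head = σ'.head) (h₂ : ∀ i, σ.reg i = σ'.reg i)
    (h₃ : σ.out = σ'.out) : σ = σ' :=
  Regs.ext h₁ (funext h₂) h₃

@[simp] theorem set_set (σ : Regs k) (j : Fin k) (n m : ℕ) : (σ.set j n).set j m = σ.set j m := by
  simp [Regs.set]

theorem set_comm (σ : Regs k) {i j : Fin k} (h : i ≠ j) (n m : ℕ) :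
    (σ.set i n).set j m = (σ.set j m).set i n := by
  simp [Regs.set, Function.update_comm h]

theorem set_eq_self {σ : Regs k} {j : Fin k} {n : ℕ} (h : σ.reg j = n) : σ.set j n = σ := by
  subst h; simp [Regs.set]

/-- Move the input head. -/
def setHead (σ : Regs k) (h : ℕ) : Regs k := ⟨h, σ.reg, σ.out⟩

@[simp] theorem setHead_head (σ : Regs k) (h : ℕ) : (σ.setHead h).head = h := rfl
@[simp] theorem setHead_reg (σ : Regs k) (h : ℕ) : (σ.setHead h).reg = σ.reg := rfl
@[simp] theorem setHead_out (σ : Regs k) (h : ℕ) : (σ.setHead h).out = σ.out := rfl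
@[simp] theorem setHead_setHead (σ : Regs k) (h h' : ℕ) :
    (σ.setHead h).setHead h' = σ.setHead h' := rfl

theorem setHead_self {σ : Regs k} {h : ℕ} (e : σ.head = h) : σ.setHead h = σ := by
  subst e; rfl

/-- Append to the output. -/
def write (σ : Regs k) (w : List Letter) : Regs k := ⟨σ.head, σ.reg, σ.out ++ w⟩

@[simp] theorem write_head (σ : Regs k) (w : List Letter) : (σ.write w).head = σ.head := rfl
@[simp] theorem write_reg (σ : Regs k) (w : List Letter) : (σ.write w).reg = σ.reg := rfl
@[simp] theorem write_out (σ : Regs k) (w : List Letter) : (σ.write w).out = σ.out ++ w := rfl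
@[simp] theorem write_write (σ : Regs k) (w w' : List Letter) :
    (σ.write w).write w' = σ.write (w ++ w') := by simp [write]
theorem write_set (σ : Regs k) (w : List Letter) (j : Fin k) (n : ℕ) :
    (σ.write w).set j n = (σ.set j n).write w := rfl
@[simp] theorem write_nil (σ : Regs k) : σ.write [] = σ := by simp [write]

end Regs

namespace Frag

open TuringTransducer

variable {k : ℕ} {E E' : Type} {x : List Letter} {L : ℕ}

theorem runs_pos_of_eq {j : Fin k} {σ : Regs k} {b : Bool} (h : decide (σ.reg j ≠ 0) = b) :
    Runs x L (pos j) σ b σ := h ▸ runs_pos j σ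

theorem runs_inc_of_eq {j : Fin k} {σ σ' : Regs k} (h : σ.reg j + 1 < 2 ^ L)
    (h' : σ' = σ.set j (σ.reg j + 1)) : Runs x L (inc j) σ () σ' := h' ▸ runs_inc j σ h

theorem runs_dec_of_eq {j : Fin k} {σ σ' : Regs k} (h : σ.reg j ≠ 0)
    (h' : σ' = σ.set j (σ.reg j - 1)) : Runs x L (dec j) σ () σ' := h' ▸ runs_dec j σ h

theorem runs_clear (r : Fin k) (σ : Regs k) : Runs x L (clear r) σ () (σ.set r 0) := by
  have := Runs.loop_seq (x := x) (L := L) (T := pos r) (F := dec r)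
    (fun i => σ.set r (σ.reg r - i)) (σ.reg r)
    (fun i hi => runs_pos_of_eq (by simp; omega))
    (fun i hi => runs_dec_of_eq (by simp; omega) (by simp; congr 1))
    (runs_pos_of_eq (by simp))
  simpa [clear, Regs.set_eq_self] using this

theorem runs_copy {t a b : Fin k} (hta : t ≠ a) (htb : t ≠ b) (hab : a ≠ b) {σ : Regs k}
    (ht : σ.reg t = 0) (ha : σ.reg a < 2 ^ L) :
    Runs x L (copy t a b) σ () (σ.set b (σ.reg a)) := by
  set v := σ.reg a with hv
  have h1 := Runs.loop_seq (x := x) (L := L) (T := pos a) (F := (dec a).seq (inc t))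
    (fun i => ((σ.set b 0).set a (v - i)).set t i) v
    (fun i hi => runs_pos_of_eq (by simp [Regs.set_reg, hta.symm]; omega))
    (fun i hi => (runs_dec _ _ (by simp [Regs.set_reg, hta.symm]; omega)).seq
      (runs_inc_of_eq (by simp [Regs.set_reg, hta]; omega)
        (Regs.ext_reg rfl (fun j => by simp only [Regs.set_reg]; grind) rfl)))
    (runs_pos_of_eq (by simp [Regs.set_reg, hta.symm]))
  have h2 := Runs.loop_seq (x := x) (L := L) (T := pos t) (F := (dec t).seq ((inc a).seq (inc b)))
    (fun i => ((σ.set b i).set a i).set t (v - i)) v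
    (fun i hi => runs_pos_of_eq (by simp; omega))
    (fun i hi => (runs_dec _ _ (by simp; omega)).seq ((runs_inc _ _
        (by simp only [Regs.set_reg]; grind)).seq
      (runs_inc_of_eq (by simp only [Regs.set_reg]; grind)
        (Regs.ext_reg rfl (fun j => by simp only [Regs.set_reg]; grind) rfl))))
    (runs_pos_of_eq (by simp))
  refine (runs_clear b σ).seq (Runs.seq (σ' := ((σ.set b 0).set a 0).set t v) ?_ ?_)
  · convert h1 using 1
    · exact Regs.ext_reg rfl (fun j => by simp only [Regs.set_reg]; grind) rfl
    · simp
  · convert h2 using 1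
    · simp
    · exact Regs.ext_reg rfl (fun j => by simp only [Regs.set_reg]; grind) rfl

/-! ### Moving the input head -/

/-- Move the input head. -/
def go (m : Move) : Frag k Unit := prim fun _ => (m, none, ())

/-- The scanned letter. -/
def scan : Frag k (Option Letter) :=
  prim fun a => (.stay, none, match a with | .symbol a => some a | _ => none)

/-- Is the input head at the left end? -/
def notAtLeft : Frag k Bool :=
  prim fun a => (.stay, none, match a with | .leftEnd => false | _ => true)

/-- Move the input head to the left end. -/
def rewind : Frag k Unit := loop notAtLeft (go .left)

/-- Write a letter. -/
def emit (a : Letter) : Frag k Unit := prim fun _ => (.stay, some a, ())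

theorem runs_go (m : Move) (σ : Regs k) :
    Runs x L (go m) σ () (σ.setHead (moveInput x.length σ.head m)) := by
  have := runs_prim (x := x) (L := L) (fun _ => (m, none, ())) σ
  simp only [Option.toList_none, List.append_nil] at this
  exact this

theorem runs_go_left_of_eq {σ σ' : Regs k} (h : σ' = σ.setHead (σ.head - 1)) :
    Runs x L (go .left) σ () σ' := h ▸ runs_go .left σ

theorem runs_go_right {σ : Regs k} (h : σ.head ≤ x.length) :
    Runs x L (go .right) σ () (σ.setHead (σ.head + 1)) := by
  simpa [moveInput, h] using runs_go (x := x) (L := L) .right σ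

theorem runs_go_right_of_eq {σ σ' : Regs k} (h : σ.head ≤ x.length)
    (h' : σ' = σ.setHead (σ.head + 1)) : Runs x L (go .right) σ () σ' := h' ▸ runs_go_right h

theorem runs_emit (a : Letter) (σ : Regs k) : Runs x L (emit a) σ () (σ.write [a]) :=
  runs_prim (x := x) (L := L) (fun _ => (.stay, some a, ())) σ

theorem runs_scan {σ : Regs k} {i : ℕ} (h : σ.head = i + 1) : Runs x L scan σ x[i]? σ := by
  have := runs_prim (x := x) (L := L) (E := Option Letter) (fun a => (.stay, none,
    match a with | .symbol a => some a | _ => none)) σ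
  simp only [Option.toList_none, List.append_nil] at this
  have e : (match readInput x σ.head with | .symbol a => some a | _ => none) = x[i]? := by
    rw [h]; simp only [readInput]; cases x[i]? <;> rfl
  rw [e] at this
  exact this

theorem runs_notAtLeft (σ : Regs k) : Runs x L notAtLeft σ (decide (σ.head ≠ 0)) σ := by
  have := runs_prim (x := x) (L := L) (E := Bool) (fun a => (.stay, none,
    match a with | .leftEnd => false | _ => true)) σ
  simp only [Option.toList_none, List.append_nil] at this
  have e : (match readInput x σ.head with | .leftEnd => false | _ => true) =
      decide (σ.head ≠ 0) := by
    cases h : σ.head with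
    | zero => rfl
    | succ i => simp only [readInput]; cases x[i]? <;> rfl
  rw [e] at this
  exact this

theorem runs_notAtLeft_of_eq {σ : Regs k} {b : Bool} (h : decide (σ.head ≠ 0) = b) :
    Runs x L notAtLeft σ b σ := h ▸ runs_notAtLeft σ

theorem runs_rewind (σ : Regs k) : Runs x L rewind σ () (σ.setHead 0) := by
  have := Runs.loop_seq (x := x) (L := L) (T := notAtLeft) (F := go .left)
    (fun i => σ.setHead (σ.head - i)) σ.head
    (fun i hi => runs_notAtLeft_of_eq (decide_eq_true (by
      simp only [Regs.setHead_head]; omega)))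
    (fun i hi => runs_go_left_of_eq (by rw [Regs.setHead_setHead, Regs.setHead_head]; congr 1))
    (runs_notAtLeft_of_eq (by simp))
  simpa [rewind, Regs.setHead_self] using this

/-- The program only moves the input head, from `h` to `h'`. -/
def Moves (k : ℕ) (x : List Letter) (L : ℕ) (F : Frag k Unit) (h h' : ℕ) : Prop :=
  ∀ σ : Regs k, σ.head = h → Runs x L F σ () (σ.setHead h')

/-- Move behind the next occurrence of the letter `a`. -/
def skipPast (a : Letter) : Frag k Unit :=
  (loop (scan.bind fun b => ret (decide (b ≠ some a))) (go .right)).seq (go .right)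

theorem moves_skipPast {a : Letter} {pre w suf : List Letter} (hw : a ∉ w)
    (hx : x = pre ++ (w ++ [a]) ++ suf) :
    Moves k x L (skipPast a) (pre.length + 1) ((pre ++ (w ++ [a])).length + 1) := by
  intro σ hσ
  have hlen : x.length = pre.length + w.length + 1 + suf.length := by simp [hx]; omega
  have hget : ∀ i < w.length, x[pre.length + i]? = w[i]? := by
    intro i hi
    simp [hx, List.getElem?_append, hi]
  have hget' : x[pre.length + w.length]? = some a := by
    simp [hx]
  have h1 := Runs.loop_seq (x := x) (L := L)
    (T := scan.bind fun b => ret (decide (b ≠ some a))) (F := go .right)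
    (fun i => σ.setHead (pre.length + i + 1)) w.length
    (fun i hi => by
      refine (runs_scan (i := pre.length + i) rfl).bind (runs_ret_of_eq ?_ rfl)
      rw [hget i hi]
      have : w[i]? ≠ some a := fun h => hw (List.mem_of_getElem? h)
      simp [this])
    (fun i hi => runs_go_right_of_eq (by simp; omega) (by simp; congr 1))
    ((runs_scan (i := pre.length + w.length) rfl).bind (runs_ret_of_eq (by simp [hget']) rfl))
  refine Runs.seq (σ' := σ.setHead (pre.length + w.length + 1)) ?_ ?_
  · convert h1 using 1
    simp [Regs.setHead_self hσ]
  · exact runs_go_right_of_eq (by simp; omega) (by simp; congr 1)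

/-- Run `F` as often as the counter `r` says, with the help of `t` and `c`. -/
def forReg (t c r : Fin k) (F : Frag k Unit) : Frag k Unit :=
  (copy t r c).seq (loop (pos c) ((dec c).seq F))

theorem runs_forReg {t c r : Fin k} (htr : t ≠ r) (htc : t ≠ c) (hrc : r ≠ c) {F : Frag k Unit}
    {σ : Regs k} (ht : σ.reg t = 0) (hc : σ.reg c = 0) (hr : σ.reg r < 2 ^ L) (h : ℕ → ℕ)
    (h0 : σ.head = h 0) (hF : ∀ i < σ.reg r, Moves k x L F (h i) (h (i + 1))) :
    Runs x L (forReg t c r F) σ () (σ.setHead (h (σ.reg r))) := by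
  set n := σ.reg r with hn
  have h1 := Runs.loop_seq (x := x) (L := L) (T := pos c) (F := (dec c).seq F)
    (fun i => (σ.setHead (h i)).set c (n - i)) n
    (fun i hi => runs_pos_of_eq (by simp; omega))
    (fun i hi => (runs_dec _ _ (by simp; omega)).seq (by
      convert hF i hi _ _ using 1
      · exact Regs.ext_reg rfl (fun j => by simp only [Regs.set_reg, Regs.setHead_reg]; grind) rfl
      · rfl))
    (runs_pos_of_eq (by simp))
  refine (runs_copy htr htc hrc ht hr).seq ?_
  convert h1 using 1
  · exact Regs.ext_reg h0 (fun j => by simp only [Regs.set_reg, Regs.setHead_reg]; grind) rfl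
  · exact Regs.ext_reg rfl (fun j => by simp only [Regs.set_reg, Regs.setHead_reg]; grind) rfl

theorem runs_forReg_skipPast {α : Type*} {t c r : Fin k} (htr : t ≠ r) (htc : t ≠ c) (hrc : r ≠ c)
    {σ : Regs k} (ht : σ.reg t = 0) (hc : σ.reg c = 0) (hr : σ.reg r < 2 ^ L) {a : Letter}
    (f : α → List Letter) (hf : ∀ y, a ∉ f y) (l : List α) {pre suf : List Letter}
    (hx : x = pre ++ l.flatMap (fun y => f y ++ [a]) ++ suf) (hl : σ.reg r = l.length)
    (hh : σ.head = pre.length + 1) :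
    Runs x L (forReg t c r (skipPast a)) σ ()
      (σ.setHead ((pre ++ l.flatMap fun y => f y ++ [a]).length + 1)) := by
  have := runs_forReg (x := x) (F := skipPast a) htr htc hrc ht hc hr
    (fun i => (pre ++ (l.take i).flatMap fun y => f y ++ [a]).length + 1) (by simpa using hh)
    (fun i hi => by
      rw [hl] at hi
      convert moves_skipPast (k := k) (L := L) (x := x) (a := a)
        (pre := pre ++ (l.take i).flatMap fun y => f y ++ [a]) (w := f l[i])
        (suf := (l.drop (i + 1)).flatMap (fun y => f y ++ [a]) ++ suf) (hf _) ?_ using 1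
      · rw [List.take_add_one]; simp [hi]
      · have e : l = l.take i ++ l[i] :: l.drop (i + 1) := by
          rw [← List.drop_eq_getElem_cons hi, List.take_append_drop]
        rw [hx]
        conv_lhs => rw [e]
        simp only [List.flatMap_append, List.flatMap_cons, List.append_assoc])
  rw [hl] at this
  simpa using this

end Frag

/-! ### Numbers in the input -/

/-- The number `m` stands in column `j` of row `i` of table `g` of the word `x`. -/
def TokenAt (x : List Letter) (g i j m : ℕ) : Prop :=
  ∃ (gs : List (List (List ℕ))) (rows : List (List ℕ)) (nums : List ℕ) (suf : List Letter),
    gs.length = g ∧ rows.length = i ∧ nums.length = j ∧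
    x = gs.flatMap (fun T => T.flatMap encodeNumbers ++ [.endGraph]) ++
      rows.flatMap encodeNumbers ++ nums.flatMap encodeNumber ++ (encodeNumber m ++ suf)

theorem length_le_length_flatMap {α β : Type*} (f : α → List β) (hf : ∀ a, f a ≠ [])
    (l : List α) : l.length ≤ (l.flatMap f).length := by
  induction l with
  | nil => simp
  | cons a l ih =>
    have := List.length_pos_iff.mpr (hf a)
    simp only [List.flatMap_cons, List.length_append, List.length_cons]; omega

theorem encodeNumbers_ne_nil (l : List ℕ) : encodeNumbers l ≠ [] := by simp [encodeNumbers]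

theorem encodeNumber_ne_nil (n : ℕ) : encodeNumber n ≠ [] := by simp [encodeNumber]

theorem TokenAt.row_le {x : List Letter} {g i j m : ℕ} (h : TokenAt x g i j m) :
    i ≤ x.length := by
  obtain ⟨gs, rows, nums, suf, rfl, rfl, rfl, rfl⟩ := h
  have := length_le_length_flatMap encodeNumbers encodeNumbers_ne_nil rows
  simp only [List.length_append]; omega

theorem TokenAt.col_le {x : List Letter} {g i j m : ℕ} (h : TokenAt x g i j m) :
    j ≤ x.length := by
  obtain ⟨gs, rows, nums, suf, rfl, rfl, rfl, rfl⟩ := h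
  have := length_le_length_flatMap encodeNumber encodeNumber_ne_nil nums
  simp only [List.length_append]; omega

theorem encodeNumber_compare (m m' : ℕ) : ∃ o, o < (encodeNumber m).length ∧
    o < (encodeNumber m').length ∧
    (∀ i < o, (encodeNumber m)[i]? = (encodeNumber m')[i]? ∧
      (encodeNumber m)[i]? ≠ some .endNumber) ∧
    ((encodeNumber m)[o]? = (encodeNumber m')[o]? → (encodeNumber m)[o]? = some .endNumber) ∧
    ((encodeNumber m)[o]? = (encodeNumber m')[o]? ↔ m = m') := by
  have key : ∀ l l' : List Bool, ∃ o,
      o < (l.map Letter.bit ++ [Letter.endNumber]).length ∧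
      o < (l'.map Letter.bit ++ [Letter.endNumber]).length ∧
      (∀ i < o, (l.map Letter.bit ++ [Letter.endNumber])[i]? = (l'.map Letter.bit ++ [Letter.endNumber])[i]? ∧
        (l.map Letter.bit ++ [Letter.endNumber])[i]? ≠ some .endNumber) ∧
      ((l.map Letter.bit ++ [Letter.endNumber])[o]? = (l'.map Letter.bit ++ [Letter.endNumber])[o]? →
        (l.map Letter.bit ++ [Letter.endNumber])[o]? = some .endNumber) ∧
      ((l.map Letter.bit ++ [Letter.endNumber])[o]? = (l'.map Letter.bit ++ [Letter.endNumber])[o]? ↔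
        l = l') := by
    intro l
    induction l with
    | nil =>
      intro l'
      refine ⟨0, by simp, by simp, by simp, by simp, ?_⟩
      cases l' <;> simp
    | cons a l ih =>
      intro l'
      cases l' with
      | nil => exact ⟨0, by simp, by simp, by simp, by simp, by simp⟩
      | cons b l' =>
        by_cases hab : a = b
        · subst hab
          obtain ⟨o, h1, h2, h3, h4, h5⟩ := ih l'
          refine ⟨o + 1, by simpa using h1, by simpa using h2, fun i hi => ?_, by simpa using h4,
            by simpa using h5⟩
          cases i with
          | zero => simp
          | succ i => simpa using h3 i (by omega)
        · exact ⟨0, by simp, by simp, by simp, by simp [hab], by simp [hab]⟩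
  obtain ⟨o, h1, h2, h3, h4, h5⟩ := key (Computability.encodeNat m) (Computability.encodeNat m')
  refine ⟨o, h1, h2, h3, h4, h5.trans ⟨fun h => ?_, fun h => h ▸ rfl⟩⟩
  rw [← Computability.decode_encodeNat m, h, Computability.decode_encodeNat]

/-! ### Addressing numbers -/

/-- The counters of our programs: the first ones are scratch, the last ones hold `0`, `1`, `2`. -/
abbrev Reg := Fin 20

/-- The state between two routines: the head is at the left end, the scratch counters below `l` are
zero, the constants are in place, and all counters are small. -/
structure Ok (x : List Letter) (l : ℕ) (σ : Regs 20) : Prop where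
  head : σ.head = 0
  scratch : ∀ j : Reg, j.val < l → σ.reg j = 0
  c0 : σ.reg 17 = 0
  c1 : σ.reg 18 = 1
  c2 : σ.reg 19 = 2
  le : ∀ j, σ.reg j ≤ x.length + 1

theorem Ok.mono {x : List Letter} {l l' : ℕ} {σ : Regs 20} (h : Ok x l σ) (hl : l' ≤ l) :
    Ok x l' σ :=
  ⟨h.head, fun j hj => h.scratch j (by omega), h.c0, h.c1, h.c2, h.le⟩

theorem Ok.set {x : List Letter} {l : ℕ} {σ : Regs 20} (h : Ok x l σ) {j : Reg} {n : ℕ}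
    (hj : l ≤ j.val) (hj' : j.val < 17) (hn : n ≤ x.length + 1) : Ok x l (σ.set j n) := by
  refine ⟨h.head, fun i hi => ?_, ?_, ?_, ?_, fun i => ?_⟩
  · rw [Regs.set_reg_of_ne _ (by grind), h.scratch i hi]
  · rw [Regs.set_reg_of_ne _ (by grind), h.c0]
  · rw [Regs.set_reg_of_ne _ (by grind), h.c1]
  · rw [Regs.set_reg_of_ne _ (by grind), h.c2]
  · rw [Regs.set_reg]; split_ifs
    exacts [hn, h.le i]

theorem Ok.write {x : List Letter} {l : ℕ} {σ : Regs 20} (h : Ok x l σ) (w : List Letter) :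
    Ok x l (σ.write w) :=
  ⟨h.head, h.scratch, h.c0, h.c1, h.c2, h.le⟩

namespace Frag

variable {E : Type} {x : List Letter} {L : ℕ}

/-- Move to the number in column `j` of row `i` of table `g`. -/
def seek (g i j : Reg) : Frag 20 Unit :=
  (go .right).seq ((forReg 0 1 g (skipPast .endGraph)).seq
    ((forReg 0 1 i (skipPast .endList)).seq (forReg 0 1 j (skipPast .endNumber))))

theorem notMem_bits (a : Letter) (ha : ∀ b, a ≠ .bit b) (m : ℕ) :
    a ∉ (Computability.encodeNat m).map Letter.bit := by
  simp only [List.mem_map, not_exists, not_and]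
  exact fun b _ h => ha b h.symm

theorem notMem_numbers (a : Letter) (ha : ∀ b, a ≠ .bit b) (ha' : a ≠ .endNumber) (l : List ℕ) :
    a ∉ l.flatMap encodeNumber := by
  simp only [List.mem_flatMap, not_exists, not_and, encodeNumber, List.mem_append,
    List.mem_singleton, not_or]
  exact fun m _ => ⟨notMem_bits a ha m, ha'⟩

theorem runs_seek (hL : x.length + 1 < 2 ^ L) {g i j : Reg} (hg : 2 ≤ g.val) (hi : 2 ≤ i.val)
    (hj : 2 ≤ j.val) {σ : Regs 20} (h : Ok x 2 σ) {gs : List (List (List ℕ))}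
    {rows : List (List ℕ)} {nums : List ℕ} {suf : List Letter}
    (h1 : gs.length = σ.reg g) (h2 : rows.length = σ.reg i) (h3 : nums.length = σ.reg j)
    {pre : List Letter}
    (hpre : pre = gs.flatMap (fun T => T.flatMap encodeNumbers ++ [.endGraph]) ++
      rows.flatMap encodeNumbers ++ nums.flatMap encodeNumber)
    (hx : x = pre ++ suf) :
    Runs x L (seek g i j) σ () (σ.setHead (pre.length + 1)) := by
  have t0 : σ.reg 0 = 0 := h.scratch 0 (by simp)
  have t1 : σ.reg 1 = 0 := h.scratch 1 (by simp)
  have hb : ∀ r, σ.reg r < 2 ^ L := fun r => (h.le r).trans_lt hL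
  have n01 : (0 : Reg) ≠ 1 := by decide
  have eR : rows.flatMap encodeNumbers =
    rows.flatMap fun l => l.flatMap encodeNumber ++ [Letter.endList] := rfl
  have eN : nums.flatMap encodeNumber = nums.flatMap fun m =>
    (Computability.encodeNat m).map Letter.bit ++ [Letter.endNumber] := rfl
  have hne : ∀ r : Reg, 2 ≤ r.val → (0 : Reg) ≠ r ∧ r ≠ (1 : Reg) := by
    intro r hr
    constructor <;> rintro rfl <;> simp at hr
  have r1 := runs_go_right (x := x) (L := L) (σ := σ) (by simp [h.head])
  rw [h.head] at r1
  refine r1.seq ?_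
  have r2 := runs_forReg_skipPast (x := x) (L := L) (a := .endGraph) (hne g hg).1 n01 (hne g hg).2
    (σ := σ.setHead (0 + 1)) t0 t1 (hb _) (fun T : List (List ℕ) => T.flatMap encodeNumbers)
    (fun T => by
      simp only [List.mem_flatMap, not_exists, not_and, encodeNumbers, List.mem_append,
        List.mem_singleton, not_or]
      exact fun l _ => ⟨by simpa using notMem_numbers .endGraph (by simp) (by simp) l, by simp⟩) gs
    (pre := []) (suf := rows.flatMap encodeNumbers ++ nums.flatMap encodeNumber ++ suf)
    (by rw [hx, hpre]; simp) (by simpa using h1.symm) (by simp)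
  refine r2.seq ?_
  have r3 := runs_forReg_skipPast (x := x) (L := L) (a := .endList) (hne i hi).1 n01 (hne i hi).2
    (σ := (σ.setHead (0 + 1)).setHead (([] ++ gs.flatMap (fun T : List (List ℕ) =>
      T.flatMap encodeNumbers ++ [Letter.endGraph])).length + 1)) t0 t1 (hb _) (fun l : List ℕ => l.flatMap encodeNumber)
    (fun l => notMem_numbers _ (by simp) (by simp) l) rows
    (pre := [] ++ gs.flatMap (fun T => T.flatMap encodeNumbers ++ [.endGraph]))
    (suf := nums.flatMap encodeNumber ++ suf)
    (by rw [hx, hpre, eR]; simp) (by simpa using h2.symm) rfl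
  refine r3.seq ?_
  have r4 := runs_forReg_skipPast (x := x) (L := L) (a := .endNumber) (hne j hj).1 n01 (hne j hj).2
    (σ := σ.setHead ((([] ++ gs.flatMap (fun T : List (List ℕ) => T.flatMap encodeNumbers ++
      [Letter.endGraph])) ++ rows.flatMap fun l : List ℕ => l.flatMap encodeNumber ++ [Letter.endList]).length + 1)) t0 t1 (hb _)
    (fun m : ℕ => (Computability.encodeNat m).map Letter.bit)
    (fun m => notMem_bits _ (by simp) m) nums
    (pre := ([] ++ gs.flatMap (fun T => T.flatMap encodeNumbers ++ [.endGraph])) ++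
      rows.flatMap fun l => l.flatMap encodeNumber ++ [.endList])
    (suf := suf)
    (by rw [hx, hpre, eR, eN]; simp) (by simpa using h3.symm) rfl
  convert r4 using 1
  · simp only [Regs.setHead_setHead]
  · rw [hpre, eR, eN]
    simp

/-- Letter number `o` of the number in column `j` of row `i` of table `g`. -/
def readAt (g i j o : Reg) : Frag 20 (Option Letter) :=
  (seek g i j).seq ((forReg 0 1 o (go .right)).seq
    (scan.bind fun a => rewind.seq (ret a)))

theorem runs_readAt (hL : x.length + 1 < 2 ^ L) {g i j o : Reg} (hg : 2 ≤ g.val) (hi : 2 ≤ i.val)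
    (hj : 2 ≤ j.val) (ho : 2 ≤ o.val) {σ : Regs 20} (h : Ok x 2 σ) {m : ℕ}
    (hm : TokenAt x (σ.reg g) (σ.reg i) (σ.reg j) m)
    (hlt : σ.reg o < (encodeNumber m).length) :
    Runs x L (readAt g i j o) σ (encodeNumber m)[σ.reg o]? σ := by
  obtain ⟨gs, rows, nums, suf, h1, h2, h3, hx⟩ := hm
  refine (runs_seek hL hg hi hj h h1 h2 h3 rfl hx).seq ?_
  set pre := gs.flatMap (fun T => T.flatMap encodeNumbers ++ [.endGraph]) ++
      rows.flatMap encodeNumbers ++ nums.flatMap encodeNumber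
  have hlen : x.length = pre.length + (encodeNumber m).length + suf.length := by
    conv_lhs => rw [hx]
    simp; omega
  have r1 := runs_forReg (x := x) (L := L) (t := 0) (c := 1) (r := o) (F := go .right)
    (σ := σ.setHead (pre.length + 1)) (by rintro rfl; simp at ho) (by decide)
    (by rintro rfl; simp at ho) (h.scratch 0 (by simp)) (h.scratch 1 (by simp))
    ((h.le _).trans_lt hL) (fun i => pre.length + i + 1) rfl
    (fun i hi τ hτ => by
      simp only [Regs.setHead_reg] at hi
      exact runs_go_right_of_eq (by omega) (by rw [hτ]; congr 1))
  refine r1.seq ?_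
  refine (runs_scan (i := pre.length + σ.reg o) rfl).bind ?_
  refine (runs_rewind _).seq ?_
  have e1 : x[pre.length + σ.reg o]? = (encodeNumber m)[σ.reg o]? := by
    conv_lhs => rw [hx]
    rw [List.getElem?_append_right (by omega), List.getElem?_append_left (by omega)]
    simp
  rw [e1]
  exact runs_ret_of_eq rfl (by simp [Regs.setHead_self h.head])

/-- Are two numbers in the input equal? -/
def eqTok (g i j g' i' j' : Reg) : Frag 20 Bool :=
  (loop ((readAt g i j 2).bind fun a => (readAt g' i' j' 2).bind fun b =>
    ret (decide (a = b ∧ a ≠ some .endNumber))) (inc 2)).seq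
  ((readAt g i j 2).bind fun a => (readAt g' i' j' 2).bind fun b =>
    (clear 2).seq (ret (decide (a = b))))

theorem runs_eqTok (hL : x.length + 2 < 2 ^ L) {g i j g' i' j' : Reg} (hg : 3 ≤ g.val)
    (hi : 3 ≤ i.val) (hj : 3 ≤ j.val) (hg' : 3 ≤ g'.val) (hi' : 3 ≤ i'.val) (hj' : 3 ≤ j'.val)
    {σ : Regs 20} (h : Ok x 3 σ) {m m' : ℕ}
    (hm : TokenAt x (σ.reg g) (σ.reg i) (σ.reg j) m)
    (hm' : TokenAt x (σ.reg g') (σ.reg i') (σ.reg j') m') :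
    Runs x L (eqTok g i j g' i' j') σ (decide (m = m')) σ := by
  obtain ⟨o, h1, h2, h3, h4, h5⟩ := encodeNumber_compare m m'
  have hlen : (encodeNumber m).length ≤ x.length := by
    obtain ⟨gs, rows, nums, suf, -, -, -, hx⟩ := hm
    rw [hx]; simp; omega
  have hne : ∀ r : Reg, 3 ≤ r.val → ∀ i, (σ.set 2 i).reg r = σ.reg r := by
    intro r hr i
    exact Regs.set_reg_of_ne _ (by rintro rfl; simp at hr) i
  have hok : ∀ i ≤ o, Ok x 2 (σ.set 2 i) := fun i hi =>
    (h.mono (by omega)).set (by simp) (by simp) (by omega)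
  have rd : ∀ n ≤ o, Runs x L (readAt g i j 2) (σ.set 2 n) (encodeNumber m)[n]? (σ.set 2 n) := by
    intro n hn
    have := runs_readAt (L := L) (g := g) (i := i) (j := j) (o := 2) (by omega) (by omega) (by omega) (by omega)
      (by simp) (hok n hn) (m := m) (by rwa [hne g hg, hne i hi, hne j hj]) (by simp; omega)
    simpa using this
  have rd' : ∀ n ≤ o, Runs x L (readAt g' i' j' 2) (σ.set 2 n) (encodeNumber m')[n]?
      (σ.set 2 n) := by
    intro n hn
    have := runs_readAt (L := L) (g := g') (i := i') (j := j') (o := 2) (by omega) (by omega) (by omega) (by omega)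
      (by simp) (hok n hn) (m := m') (by rwa [hne g' hg', hne i' hi', hne j' hj']) (by simp; omega)
    simpa using this
  have r1 := Runs.loop_seq (x := x) (L := L) (T := (readAt g i j 2).bind fun a =>
      (readAt g' i' j' 2).bind fun b => ret (decide (a = b ∧ a ≠ some .endNumber))) (F := inc 2)
    (fun i => σ.set 2 i) o
    (fun i hi => (rd i hi.le).bind ((rd' i hi.le).bind
      (runs_ret_of_eq (decide_eq_true (h3 i hi)) rfl)))
    (fun i hi => runs_inc_of_eq (by simp; omega) (by simp))
    ((rd o le_rfl).bind ((rd' o le_rfl).bind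
      (runs_ret_of_eq (decide_eq_false fun h => h.2 (h4 h.1)) rfl)))
  have e0 : σ.set 2 0 = σ := Regs.set_eq_self (h.scratch 2 (by simp))
  rw [e0] at r1
  refine r1.seq ((rd o le_rfl).bind ((rd' o le_rfl).bind ((runs_clear _ _).seq ?_)))
  rw [Regs.set_set, e0]
  exact runs_ret_of_eq (by simp only [h5]) rfl

/-- Count in `r` from zero, as long as `T` says `true`. -/
def search (T : Frag 20 Bool) (r : Reg) : Frag 20 Unit := (clear r).seq (loop T (inc r))

theorem runs_search (hL : x.length + 2 < 2 ^ L) {T : Frag 20 Bool} {r : Reg} {σ : Regs 20} {n : ℕ}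
    (hn : n ≤ x.length + 1) (h : ∀ i < n, Runs x L T (σ.set r i) true (σ.set r i))
    (h' : Runs x L T (σ.set r n) false (σ.set r n)) :
    Runs x L (search T r) σ () (σ.set r n) :=
  (runs_clear r σ).seq <| Runs.loop_seq (fun i => σ.set r i) n h
    (fun i hi => runs_inc_of_eq (by simp; omega) (by simp)) h'

/-- Negation of the exit value. -/
def negate (T : Frag 20 Bool) : Frag 20 Bool := T.bind fun b => ret !b

theorem Runs.negate {T : Frag 20 Bool} {σ σ' : Regs 20} {b : Bool} (h : Runs x L T σ b σ') :
    Runs x L (negate T) σ (!b) σ' :=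
  h.bind (runs_ret _ _)

/-- The first row of table `g₀` that starts with the number in column `j` of row `i` of table `g`.
-/
def find (g₀ g i j r : Reg) : Frag 20 Unit := search (negate (eqTok g₀ r 17 g i j)) r

theorem runs_find (hL : x.length + 2 < 2 ^ L) {g₀ g i j r : Reg} (hg₀ : 3 ≤ g₀.val) (hg : 3 ≤ g.val)
    (hi : 3 ≤ i.val) (hj : 3 ≤ j.val) (hr : 3 ≤ r.val) (hr' : r.val < 17) (hgr₀ : g₀ ≠ r)
    (hgr : g ≠ r) (hir : i ≠ r) (hjr : j ≠ r) {σ : Regs 20} (h : Ok x 3 σ) {m n : ℕ}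
    (hm : TokenAt x (σ.reg g) (σ.reg i) (σ.reg j) m) (hn : TokenAt x (σ.reg g₀) n 0 m)
    (hlt : ∀ i < n, ∃ m', TokenAt x (σ.reg g₀) i 0 m' ∧ m' ≠ m) :
    Runs x L (find g₀ g i j r) σ () (σ.set r n) := by
  have hr17 : (17 : Reg) ≠ r := by rintro rfl; simp at hr'
  have key : ∀ i' ≤ n, ∀ m', TokenAt x (σ.reg g₀) i' 0 m' →
      Runs x L (negate (eqTok g₀ r 17 g i j)) (σ.set r i') (!decide (m' = m)) (σ.set r i') := by
    intro i' hi' m' hm'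
    refine (runs_eqTok hL hg₀ hr (by simp) hg hi hj
      (h.set hr hr' (by have := hn.row_le; omega)) ?_ ?_).negate
    · simpa [Regs.set_reg_of_ne, hgr₀, hr17, h.c0] using hm'
    · simpa [Regs.set_reg_of_ne, hgr, hir, hjr] using hm
  refine runs_search hL (by have := hn.row_le; omega) (fun i hi => ?_) ?_
  · obtain ⟨m', h1, h2⟩ := hlt i hi
    simpa [h2] using key i hi.le m' h1
  · simpa using key n le_rfl m hn

end Frag

/-! ## Orientations and Hamiltonian cycles -/

namespace SimpleGraph.Walk

variable {V : Type*} {G : SimpleGraph V}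

/-- The sum of a function over the arcs of a walk. -/
def arcSum (f : V → V → ZMod 2) {u w : V} (p : G.Walk u w) : ZMod 2 :=
  (p.darts.map fun d => f d.fst d.snd).sum

@[simp] theorem arcSum_nil (f : V → V → ZMod 2) (u : V) : (nil : G.Walk u u).arcSum f = 0 := rfl

@[simp] theorem arcSum_cons (f : V → V → ZMod 2) {u v w : V} (h : G.Adj u v) (p : G.Walk v w) :
    (cons h p).arcSum f = f u v + p.arcSum f := by simp [arcSum]

theorem arcSum_append (f : V → V → ZMod 2) {u v w : V} (p : G.Walk u v) (q : G.Walk v w) :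
    (p.append q).arcSum f = p.arcSum f + q.arcSum f := by simp [arcSum]

theorem arcSum_mapLe (f : V → V → ZMod 2) {G' : SimpleGraph V} (hle : G ≤ G') {u w : V}
    (p : G.Walk u w) : (p.mapLe hle).arcSum f = p.arcSum f := by
  induction p with
  | nil => rfl
  | cons h p ih =>
    rw [arcSum_cons, ← ih]
    exact arcSum_cons f (hle h) (p.mapLe hle)

/-- A switching changes the sum over a walk only at its ends. -/
theorem arcSum_switch (f g : V → V → ZMod 2) (h : V → ZMod 2)
    (hfg : ∀ u w, G.Adj u w → g u w = f u w + h u + h w) {u w : V} (p : G.Walk u w) :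
    p.arcSum g = p.arcSum f + h u + h w := by
  induction p with
  | nil => simp [CharTwo.add_self_eq_zero]
  | @cons u v w hadj p ih =>
    rw [arcSum_cons, arcSum_cons, ih, hfg _ _ hadj]
    linear_combination CharTwo.add_self_eq_zero (h v)

open Classical in
theorem arcSum_eq_arcsInCommon (D : Digraph V) {a : V} (p : G.Walk a a) :
    p.arcSum (fun u w => if D.Adj u w then 1 else 0) = arcsInCommon D p := by
  have : ∀ l : List G.Dart, (l.map fun d => if D.Adj d.fst d.snd then (1 : ZMod 2) else 0).sum =
      ((l.countP fun d => decide (D.Adj d.fst d.snd) : ℕ) : ZMod 2) := by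
    intro l
    induction l with
    | nil => simp
    | cons d l ih =>
      rw [List.map_cons, List.sum_cons, ih, List.countP_cons]
      by_cases h : D.Adj d.fst d.snd <;> simp [h, add_comm]
  exact this _

end SimpleGraph.Walk

theorem isCentral_of_involution {V : Type*} {G : SimpleGraph V} {a : V} (p : G.Walk a a)
    (μ : V → V) (hμ : ∀ u, G.Adj u (μ u)) (hμμ : ∀ u, μ (μ u) = u)
    (hp : ∀ u, u ∉ p.support → μ u ∉ p.support) : IsCentral G p := by
  refine ⟨⟨Set.univ, fun u w => μ u.val = w.val, ?_, fun _ => trivial, ⟨?_⟩⟩, ?_⟩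
  · intro u w h
    change G.Adj u.val w.val
    rw [← h]; exact hμ _
  · intro u w h
    rw [← h, hμμ]
  · rw [SimpleGraph.Subgraph.isPerfectMatching_iff]
    exact fun u => ⟨⟨μ u.val, hp _ u.2⟩, rfl, fun w h => Subtype.ext (Eq.symm h)⟩

/-- The bipartite graph `G` with the Hamiltonian cycle `H`, which visits the vertices `v 0`, `v 1`,
…, `v (n - 1)` in this order; `idx` is the inverse of `v`. -/
structure CycleEnum {V : Type*} (G H : SimpleGraph V) (n : ℕ) (v : ℕ → V) (idx : V → ℕ) :
    Prop where
  lt : ∀ u, idx u < n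
  v_idx : ∀ u, v (idx u) = u
  idx_v : ∀ i < n, idx (v i) = i
  four_le : 4 ≤ n
  even : n % 2 = 0
  parity : ∀ u w, G.Adj u w → idx u % 2 ≠ idx w % 2
  adj_iff : ∀ u w, H.Adj u w ↔ idx w = idx u + 1 ∨ idx u = idx w + 1 ∨
    (idx u = 0 ∧ idx w = n - 1) ∨ (idx w = 0 ∧ idx u = n - 1)
  le : H ≤ G

theorem exists_cycleEnum {V : Type*} [DecidableEq V] {G H : SimpleGraph V}
    (hG : G.IsBipartite) (hH : IsHamCycle G H) {s t : V} (hst : H.Adj s t) :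
    ∃ n v idx, CycleEnum G H n v idx ∧ idx s = 0 ∧ idx t = n - 1 := by
  obtain ⟨a, p₀, hp₀, hE₀⟩ := hH
  have main : ∀ q : G.Walk s s, q.IsHamiltonianCycle → (∀ e, e ∈ H.edgeSet ↔ e ∈ q.edges) →
      q.getVert (q.length - 1) = t →
      ∃ n v idx, CycleEnum G H n v idx ∧ idx s = 0 ∧ idx t = n - 1 := by
    intro q hq hE ht
    have h3 : 3 ≤ q.length := hq.three_le_length
    have hinj : ∀ i < q.length, ∀ j < q.length, q.getVert i = q.getVert j → i = j :=
      fun i hi j hj h => hq.isCycle.getVert_injOn' (by simp; omega) (by simp; omega) h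
    have hsurj : ∀ u, ∃ i < q.length, q.getVert i = u := by
      intro u
      obtain ⟨i, hi, hi'⟩ := SimpleGraph.Walk.mem_support_iff_exists_getVert.mp (hq.mem_support u)
      rcases hi'.lt_or_eq with h | h
      · exact ⟨i, h, hi⟩
      · subst h
        exact ⟨0, by omega, by rw [← hi]; simp⟩
    choose idx hlt hv using hsurj
    have hidx : ∀ i < q.length, idx (q.getVert i) = i := fun i hi =>
      hinj _ (hlt _) _ hi (hv _)
    obtain ⟨col⟩ := hG
    have hcol : ∀ i ≤ q.length, col (q.getVert i) = col s ↔ i % 2 = 0 := by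
      intro i
      induction i with
      | zero => simp
      | succ i ih =>
        intro hi
        have h1 := col.valid (q.adj_getVert_succ (i := i) (by omega))
        have h2 := ih (by omega)
        have : ∀ x y z : Fin 2, x ≠ y → (y = z ↔ ¬ x = z) := by decide
        rw [this _ _ _ h1, h2]; omega
    have heven : q.length % 2 = 0 := (hcol _ le_rfl).mp (by simp)
    have hwrap : q.getVert q.length = q.getVert 0 := by simp
    refine ⟨q.length, q.getVert, idx, ⟨hlt, hv, hidx, by omega, heven, ?_, ?_, ?_⟩, ?_, ?_⟩
    · intro u w h
      have h1 := col.valid h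
      have h2 := hcol _ (hlt u).le
      have h3 := hcol _ (hlt w).le
      rw [hv] at h2 h3
      have : ∀ x y z : Fin 2, x ≠ y → (y = z ↔ ¬ x = z) := by decide
      rw [this _ _ _ h1, h2] at h3
      omega
    · intro u w
      rw [← SimpleGraph.mem_edgeSet, hE, SimpleGraph.Walk.mk_mem_edges_iff_exists]
      have step : ∀ i < q.length, ∀ u w, q.getVert i = u → q.getVert (i + 1) = w →
          idx u = i ∧ (idx w = i + 1 ∨ idx w = 0 ∧ i = q.length - 1) := by
        rintro i hi u w rfl rfl
        refine ⟨hidx _ hi, ?_⟩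
        by_cases h : i + 1 < q.length
        · exact .inl (hidx _ h)
        · have : i + 1 = q.length := by omega
          rw [this, hwrap, hidx 0 (by omega)]
          omega
      constructor
      · rintro ⟨i, hi, h⟩
        rcases Sym2.eq_iff.mp h with ⟨h1, h2⟩ | ⟨h1, h2⟩
        · have := step i hi _ _ h1 h2; omega
        · have := step i hi _ _ h1 h2; omega
      · have hl : q.length - 1 + 1 = q.length := by omega
        rintro (h | h | ⟨h, h'⟩ | ⟨h, h'⟩)
        · exact ⟨idx u, hlt u, by rw [← h, hv, hv]⟩
        · exact ⟨idx w, hlt w, by rw [← h, hv, hv, Sym2.eq_swap]⟩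
        · exact ⟨q.length - 1, by omega, by rw [hl, hwrap, ← h, ← h', hv, hv, Sym2.eq_swap]⟩
        · exact ⟨q.length - 1, by omega, by rw [hl, hwrap, ← h, ← h', hv, hv]⟩
    · intro u w h
      exact q.adj_of_mem_edges ((hE _).mp h)
    · simpa using hidx 0 (by omega)
    · rw [← ht]; exact hidx _ (by omega)
  have hs : s ∈ p₀.support := hp₀.mem_support s
  set q := p₀.rotate s hs
  have hq : q.IsHamiltonianCycle := hp₀.rotate hs
  have hqE : ∀ e, e ∈ H.edgeSet ↔ e ∈ q.edges := fun e =>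
    (hE₀ e).trans (p₀.rotate_edges s hs).mem_iff.symm
  have hmem := (hqE s(s, t)).mp hst
  obtain ⟨i, hi, h⟩ := q.mk_mem_edges_iff_exists.mp hmem
  have h3 : 3 ≤ q.length := hq.three_le_length
  have hinj : ∀ i < q.length, ∀ j < q.length, q.getVert i = q.getVert j → i = j :=
    fun i hi j hj h => hq.isCycle.getVert_injOn' (by simp; omega) (by simp; omega) h
  rcases Sym2.eq_iff.mp h with ⟨h1, h2⟩ | ⟨h1, h2⟩
  · have : i = 0 := hinj _ hi _ (by omega) (by simpa using h1)
    subst this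
    refine main q.reverse ?_ (fun e => by rw [hqE]; simp) ?_
    · have hfin := hq.finite
      have := Fintype.ofFinite V
      rw [SimpleGraph.Walk.isHamiltonianCycle_iff_isCycle_and_length_eq] at hq ⊢
      exact ⟨hq.1.reverse, by simpa using hq.2⟩
    · rw [SimpleGraph.Walk.getVert_reverse, SimpleGraph.Walk.length_reverse, ← h2]
      congr 1; omega
  · have : i + 1 = q.length := by
      by_contra hne
      have := hinj (i + 1) (by omega) 0 (by omega) (by simpa using h2)
      omega
    exact main q hq hqE (by rw [← h1]; congr 1; omega)

namespace CycleEnum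

variable {V : Type*} {G H : SimpleGraph V} {n : ℕ} {v : ℕ → V} {idx : V → ℕ}

theorem adj_succ (E : CycleEnum G H n v idx) {i : ℕ} (hi : i + 1 < n) : H.Adj (v i) (v (i + 1)) := by
  rw [E.adj_iff, E.idx_v _ hi, E.idx_v i (by omega)]; simp

theorem ext_idx (E : CycleEnum G H n v idx) {u w : V} (h : idx u = idx w) : u = w := by
  rw [← E.v_idx u, h, E.v_idx]

theorem eq_v (E : CycleEnum G H n v idx) {u : V} {i : ℕ} (h : idx u = i) : u = v i := by
  rw [← h, E.v_idx]

/-- Match the vertices along every second edge of the Hamiltonian cycle. -/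
theorem exists_matching (E : CycleEnum G H n v idx) (r : ℕ) (hr : r < 2) :
    ∃ μ : V → V, (∀ u, G.Adj u (μ u)) ∧ (∀ u, μ (μ u) = u) ∧
      ∀ u, (idx u % 2 = r ∧ (idx (μ u) = idx u + 1 ∨ idx u = n - 1 ∧ idx (μ u) = 0)) ∨
        (idx u % 2 ≠ r ∧ (idx u = idx (μ u) + 1 ∨ idx u = 0 ∧ idx (μ u) = n - 1)) := by
  have h4 := E.four_le
  have he := E.even
  let m : ℕ → ℕ := fun i => if i % 2 = r then (if i = n - 1 then 0 else i + 1)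
    else (if i = 0 then n - 1 else i - 1)
  have hm : ∀ i < n, m i < n := by intro i hi; simp only [m]; split_ifs <;> omega
  have hmm : ∀ i < n, m (m i) = i := by
    intro i hi
    by_cases h : i % 2 = r
    · by_cases h' : i = n - 1
      · have e : m i = 0 := by simp only [m, if_pos h, if_pos h']
        have h0 : 0 % 2 ≠ r := by omega
        rw [e]; simp only [m, if_neg h0, if_true, h']
      · have e : m i = i + 1 := by simp only [m, if_pos h, if_neg h']
        have h0 : (i + 1) % 2 ≠ r := by omega
        rw [e]; simp [m, if_neg h0]
    · by_cases h' : i = 0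
      · have e : m i = n - 1 := by simp only [m, if_neg h, if_pos h']
        have h0 : (n - 1) % 2 = r := by omega
        rw [e]; simp only [m, if_pos h0, if_true, h']
      · have e : m i = i - 1 := by simp only [m, if_neg h, if_neg h']
        have h0 : (i - 1) % 2 = r := by omega
        have h1 : i - 1 ≠ n - 1 := by omega
        rw [e]; simp only [m, if_pos h0, if_neg h1]; omega
  have hidx : ∀ u, idx (v (m (idx u))) = m (idx u) := fun u => E.idx_v _ (hm _ (E.lt u))
  have key : ∀ u, (idx u % 2 = r ∧ (m (idx u) = idx u + 1 ∨ idx u = n - 1 ∧ m (idx u) = 0)) ∨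
        (idx u % 2 ≠ r ∧ (idx u = m (idx u) + 1 ∨ idx u = 0 ∧ m (idx u) = n - 1)) := by
    intro u; have := E.lt u
    simp only [m]; split_ifs <;> omega
  refine ⟨fun u => v (m (idx u)), fun u => E.le ?_, fun u => ?_, fun u => ?_⟩
  · rw [E.adj_iff, hidx]; have := key u; omega
  · simp only [hidx, hmm _ (E.lt u), E.v_idx]
  · simp only [hidx]; exact key u

/-- Parts of the Hamiltonian cycle as walks. -/
theorem exists_segment (E : CycleEnum G H n v idx) (f : V → V → ZMod 2) (h : ℕ → ZMod 2)
    (hh : ∀ i, h (i + 1) = h i + f (v i) (v (i + 1)) + 1) (i d : ℕ) (hd : i + d < n) :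
    ∃ p : G.Walk (v i) (v (i + d)), p.support = (List.range' i (d + 1)).map v ∧
      p.arcSum f = h i + h (i + d) + d ∧
      ∀ e ∈ p.edges, ∃ k, i ≤ k ∧ k < i + d ∧ e = s(v k, v (k + 1)) := by
  induction d with
  | zero => exact ⟨.nil, by simp, by simp [CharTwo.add_self_eq_zero], by simp⟩
  | succ d ih =>
    obtain ⟨p, h1, h2, h3⟩ := ih (by omega)
    refine ⟨p.concat (E.le (E.adj_succ (by omega))), ?_, ?_, ?_⟩
    · rw [SimpleGraph.Walk.support_concat, h1, List.range'_concat (n := d + 1)]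
      simp
    · rw [SimpleGraph.Walk.concat_eq_append, SimpleGraph.Walk.arcSum_append, h2,
        SimpleGraph.Walk.arcSum_cons, SimpleGraph.Walk.arcSum_nil, ← add_assoc i d 1, hh (i + d)]
      push_cast
      linear_combination -CharTwo.add_self_eq_zero (1 : ZMod 2)
    · intro e he
      rw [SimpleGraph.Walk.edges_concat, List.concat_eq_append, List.mem_append,
        List.mem_singleton] at he
      rcases he with he | rfl
      · obtain ⟨k, hk⟩ := h3 e he; exact ⟨k, by omega, by omega, hk.2.2⟩
      · exact ⟨i + d, by omega, by omega, rfl⟩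

/-- In a Pfaffian graph the orientation of all edges along the Hamiltonian path is Pfaffian. -/
theorem arcSum_forward (E : CycleEnum G H n v idx) (hP : IsPfaffian G) {a : V} (p : G.Walk a a)
    (hp : p.IsCycle) (hc : IsCentral G p) :
    p.arcSum (fun u w => if idx u < idx w then 1 else 0) = 1 := by
  classical
  obtain ⟨D, ⟨-, hxor⟩, hD⟩ := hP
  let f : V → V → ZMod 2 := fun u w => if D.Adj u w then 1 else 0
  have hf : ∀ u w, G.Adj u w → f u w + f w u = 1 := by
    intro u w huw
    rcases hxor u w huw with ⟨h, h'⟩ | ⟨h, h'⟩ <;> simp [f, h, h']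
  have hsum : ∀ (a : V) (p : G.Walk a a), p.IsCycle → IsCentral G p → p.arcSum f = 1 := by
    intro a p hp hc
    have := hD a p hp hc
    rw [show p.arcSum f = _ from SimpleGraph.Walk.arcSum_eq_arcsInCommon D p]
    exact (ZMod.natCast_eq_one_iff_odd).mpr this
  let h : ℕ → ZMod 2 := fun i => Nat.rec 0 (fun i x => x + f (v i) (v (i + 1)) + 1) i
  have hh : ∀ i, h (i + 1) = h i + f (v i) (v (i + 1)) + 1 := fun i => rfl
  have h4 := E.four_le
  have hn := E.even
  have chord : ∀ i d, i + d < n → G.Adj (v i) (v (i + d)) → d % 2 = 1 →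
      f (v i) (v (i + d)) + h i + h (i + d) = 1 := by
    intro i d hd hadj hodd
    by_cases hd1 : d = 1
    · subst hd1
      linear_combination hh i + CharTwo.add_self_eq_zero (f (v i) (v (i + 1))) +
        CharTwo.add_self_eq_zero (h i)
    obtain ⟨q, hq1, hq2, hq3⟩ := E.exists_segment f h hh i d hd
    have hmem : ∀ u, u ∈ q.support ↔ i ≤ idx u ∧ idx u ≤ i + d := by
      intro u
      rw [hq1, List.mem_map]
      constructor
      · rintro ⟨k, hk, rfl⟩
        rw [List.mem_range'_1] at hk
        rw [E.idx_v k (by omega)]; omega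
      · intro hu
        exact ⟨idx u, List.mem_range'_1.mpr (by omega), E.v_idx u⟩
    have hcyc : (SimpleGraph.Walk.cons hadj.symm q).IsCycle := by
      rw [SimpleGraph.Walk.cons_isCycle_iff]
      constructor
      · refine SimpleGraph.Walk.IsPath.mk' ?_
        rw [hq1]
        refine List.Nodup.map_on (fun j hj k hk hjk => ?_) (List.nodup_range')
        rw [List.mem_range'_1] at hj hk
        rw [← E.idx_v j (by omega), hjk, E.idx_v k (by omega)]
      · intro he
        obtain ⟨k, hk1, hk2, hk⟩ := hq3 _ he
        rcases Sym2.eq_iff.mp hk with ⟨e1, e2⟩ | ⟨e1, e2⟩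
        · have e1 := congrArg idx e1
          rw [E.idx_v _ hd, E.idx_v k (by omega)] at e1; omega
        · have e1 := congrArg idx e1
          have e2 := congrArg idx e2
          rw [E.idx_v _ hd, E.idx_v (k + 1) (by omega)] at e1
          rw [E.idx_v i (by omega), E.idx_v k (by omega)] at e2; omega
    have hcen : IsCentral G (SimpleGraph.Walk.cons hadj.symm q) := by
      obtain ⟨μ, hμ1, hμ2, hμ3⟩ := E.exists_matching (i % 2) (by omega)
      refine isCentral_of_involution _ μ hμ1 hμ2 fun u hu => ?_
      have hu' := mt (List.mem_cons_of_mem (v (i + d))) hu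
      have hend : idx (v (i + d)) = i + d := E.idx_v _ hd
      rw [hmem] at hu'
      rw [SimpleGraph.Walk.support_cons, List.mem_cons, hmem]
      have h1 := E.lt (μ u)
      have h2 := hμ3 u
      have h3 := E.lt u
      rintro (h4 | h4)
      · rw [h4] at h2; omega
      · omega
    have := hsum _ _ hcyc hcen
    rw [SimpleGraph.Walk.arcSum_cons, hq2] at this
    have hd' : (d : ZMod 2) = 1 := (ZMod.natCast_eq_one_iff_odd).mpr (Nat.odd_iff.mpr hodd)
    rw [hd'] at this
    linear_combination this + hf _ _ hadj - CharTwo.add_self_eq_zero (f (v (i + d)) (v i))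
  have key : ∀ u w, G.Adj u w → idx u < idx w → f u w + h (idx u) + h (idx w) = 1 := by
    intro u w huw hlt
    have hpar := E.parity u w huw
    have hw : idx w = idx u + (idx w - idx u) := by omega
    have := chord (idx u) (idx w - idx u) (by have := E.lt w; omega)
    rw [← hw, E.v_idx, E.v_idx] at this
    exact this huw (by omega)
  have := SimpleGraph.Walk.arcSum_switch (G := G) f (fun u w => if idx u < idx w then 1 else 0)
    (fun u => h (idx u)) (fun u w huw => ?_) p
  · rw [this, hsum a p hp hc]
    linear_combination CharTwo.add_self_eq_zero (h (idx a))
  · by_cases hlt : idx u < idx w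
    · simp only [hlt, if_true, key u w huw hlt]
    · have hlt' : idx w < idx u := by have := E.parity u w huw; omega
      have h1 := key w u huw.symm hlt'
      have h2 := hf u w huw
      simp only [hlt, if_false]
      linear_combination h1 - h2 + CharTwo.add_self_eq_zero (f u w) - CharTwo.add_self_eq_zero (f u w + h (idx u) + h (idx w))

/-! ### The second Hamiltonian cycle -/

/-- For a chord from `b` to `c b`: the neighbour of `c b` on the Hamiltonian path on the side of
`b`. -/
def _root_.chordStep {V : Type*} (v : ℕ → V) (idx : V → ℕ) (c : V → V) (b : V) : V :=
  if idx b < idx (c b) then v (idx (c b) - 1) else v (idx (c b) + 1)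

section

variable {c : V → V}

/-- Every second vertex of the Hamiltonian path has a chord. -/
def _root_.IsChordMap (G H : SimpleGraph V) (idx : V → ℕ) (c : V → V) : Prop :=
  ∀ b, idx b % 2 = 1 → G.Adj b (c b) ∧ ¬ H.Adj b (c b)

theorem chordStep_spec (E : CycleEnum G H n v idx) (hc : IsChordMap G H idx c) {b : V}
    (hb : idx b % 2 = 1) : idx (c b) % 2 = 0 ∧
    (idx b < idx (c b) ∧ idx b + 3 ≤ idx (c b) ∧ idx (chordStep v idx c b) + 1 = idx (c b) ∨
      idx (c b) < idx b ∧ idx (c b) + 3 ≤ idx b ∧ idx (chordStep v idx c b) = idx (c b) + 1) := by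
  obtain ⟨h1, h2⟩ := hc b hb
  have h3 := E.parity _ _ h1
  rw [E.adj_iff] at h2
  have h4 := E.lt (c b)
  have h5 := E.lt b
  have h6 := E.even
  refine ⟨by omega, ?_⟩
  unfold chordStep
  split_ifs with h
  · rw [E.idx_v _ (by omega)]; omega
  · rw [E.idx_v _ (by omega)]; omega

theorem chordStep_odd (E : CycleEnum G H n v idx) (hc : IsChordMap G H idx c) {b : V}
    (hb : idx b % 2 = 1) : idx (chordStep v idx c b) % 2 = 1 := by
  have := E.chordStep_spec hc hb; omega

/-- The periodic points of `chordStep`. -/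
def _root_.Switched (v : ℕ → V) (idx : V → ℕ) (c : V → V) (b : V) : Prop :=
  idx b % 2 = 1 ∧ b ∈ Function.periodicPts (chordStep v idx c)

theorem switched_chordStep (E : CycleEnum G H n v idx) (hc : IsChordMap G H idx c) {b : V}
    (hb : Switched v idx c b) : Switched v idx c (chordStep v idx c b) :=
  ⟨E.chordStep_odd hc hb.1, (Function.bijOn_periodicPts _).mapsTo hb.2⟩

theorem switched_injective {p q : V} (hp : Switched v idx c p) (hq : Switched v idx c q)
    (h : chordStep v idx c p = chordStep v idx c q) : p = q :=
  (Function.bijOn_periodicPts _).injOn hp.2 hq.2 h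

theorem iterate_chordStep_odd (E : CycleEnum G H n v idx) (hc : IsChordMap G H idx c) {b : V}
    (hb : idx b % 2 = 1) (m : ℕ) : idx ((chordStep v idx c)^[m] b) % 2 = 1 := by
  induction m with
  | zero => exact hb
  | succ m ih => rw [Function.iterate_succ_apply']; exact E.chordStep_odd hc ih

theorem switched_surjective (E : CycleEnum G H n v idx) (hc : IsChordMap G H idx c) {b : V}
    (hb : Switched v idx c b) : ∃ p, Switched v idx c p ∧ chordStep v idx c p = b := by
  obtain ⟨m, hm, h⟩ := hb.2
  refine ⟨(chordStep v idx c)^[m - 1] b, ⟨E.iterate_chordStep_odd hc hb.1 _, m, hm, ?_⟩, ?_⟩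
  · exact h.apply_iterate _
  · rw [← Function.iterate_succ_apply' (chordStep v idx c), Nat.succ_eq_add_one,
      Nat.sub_add_cancel hm]
    exact h

theorem exists_switched [Finite V] (E : CycleEnum G H n v idx) (hc : IsChordMap G H idx c) :
    ∃ b, Switched v idx c b := by
  have h4 := E.four_le
  have h1 : idx (v 1) % 2 = 1 := by rw [E.idx_v 1 (by omega)]
  obtain ⟨i, j, hij, h⟩ := Finite.exists_ne_map_eq_of_infinite
    fun m : ℕ => (chordStep v idx c)^[m] (v 1)
  wlog hlt : i < j generalizing i j
  · exact this j i hij.symm h.symm (by omega)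
  refine ⟨(chordStep v idx c)^[i] (v 1), E.iterate_chordStep_odd hc h1 _, j - i, by omega, ?_⟩
  change (chordStep v idx c)^[j - i] ((chordStep v idx c)^[i] (v 1)) = _
  rw [← Function.iterate_add_apply, Nat.sub_add_cancel hlt.le]
  exact h.symm

/-- The edge from `b` to `a` belongs to the new cycle. -/
def _root_.NewEdge (H : SimpleGraph V) (v : ℕ → V) (idx : V → ℕ) (c : V → V) (b a : V) : Prop :=
  idx b % 2 = 1 ∧ idx a % 2 = 0 ∧ (Switched v idx c b ∧ a = c b ∨
    H.Adj b a ∧ ∀ p, Switched v idx c p → chordStep v idx c p = b → c p ≠ a)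

/-- The graph of the new cycle. -/
def _root_.newCycle (H : SimpleGraph V) (v : ℕ → V) (idx : V → ℕ) (c : V → V) : SimpleGraph V where
  Adj u w := NewEdge H v idx c u w ∨ NewEdge H v idx c w u
  symm := ⟨fun _ _ h => h.symm⟩
  loopless := ⟨fun _ h => by rcases h with h | h <;> have := h.1 <;> have := h.2.1 <;> omega⟩

theorem newCycle_adj_of_odd {u w : V} (hu : idx u % 2 = 1) :
    (newCycle H v idx c).Adj u w ↔ NewEdge H v idx c u w :=
  ⟨fun h => h.resolve_right fun h => by have := h.2.1; omega, .inl⟩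

theorem newCycle_adj_of_even {u w : V} (hu : idx u % 2 = 0) :
    (newCycle H v idx c).Adj u w ↔ NewEdge H v idx c w u :=
  ⟨fun h => h.resolve_left fun h => by have := h.1; omega, .inr⟩

theorem newCycle_le (E : CycleEnum G H n v idx) (hc : IsChordMap G H idx c) :
    newCycle H v idx c ≤ G := by
  have key : ∀ b a, NewEdge H v idx c b a → G.Adj b a := by
    rintro b a ⟨hb, -, ⟨-, rfl⟩ | ⟨h, -⟩⟩
    · exact (hc b hb).1
    · exact E.le h
  rintro u w (h | h)
  · exact key _ _ h
  · exact (key _ _ h).symm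

theorem newEdge_of_not_switched (E : CycleEnum G H n v idx) (hc : IsChordMap G H idx c) {b a : V}
    (hb : idx b % 2 = 1) (hs : ¬ Switched v idx c b) : NewEdge H v idx c b a ↔ H.Adj b a := by
  constructor
  · rintro ⟨-, -, ⟨h, -⟩ | ⟨h, -⟩⟩
    · exact absurd h hs
    · exact h
  · intro h
    have := E.parity _ _ (E.le h)
    exact ⟨hb, by omega, .inr ⟨h, fun p hp hpb => absurd (hpb ▸ E.switched_chordStep hc hp) hs⟩⟩

theorem newEdge_of_switched (E : CycleEnum G H n v idx) (hc : IsChordMap G H idx c) {b a p : V}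
    (hb : Switched v idx c b) (hp : Switched v idx c p) (hpb : chordStep v idx c p = b) :
    NewEdge H v idx c b a ↔ a = c b ∨ (H.Adj b a ∧ a ≠ c p) := by
  constructor
  · rintro ⟨-, -, ⟨-, h⟩ | ⟨h, h'⟩⟩
    · exact .inl h
    · exact .inr ⟨h, (h' p hp hpb).symm⟩
  · rintro (rfl | ⟨h, h'⟩)
    · exact ⟨hb.1, (E.chordStep_spec hc hb.1).1, .inl ⟨hb, rfl⟩⟩
    · have := E.parity _ _ (E.le h)
      have := hb.1
      refine ⟨hb.1, by omega, .inr ⟨h, fun q hq hqb => ?_⟩⟩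
      rw [switched_injective hq hp (hqb.trans hpb.symm)]
      exact h'.symm

/-- The neighbour of `a` on the new cycle before `a` on the Hamiltonian path. -/
theorem exists_before (E : CycleEnum G H n v idx) (hc : IsChordMap G H idx c) {a : V}
    (ha : idx a % 2 = 0) : ∃ x, NewEdge H v idx c x a ∧
      (idx x < idx a ∨ idx a = 0 ∧ idx x = n - 1) ∧
      ∀ y, NewEdge H v idx c y a → (idx y < idx a ∨ idx a = 0 ∧ idx y = n - 1) → y = x := by
  have h4 := E.four_le
  have hn := E.even
  have hlt := E.lt a
  by_cases hex : ∃ p, Switched v idx c p ∧ c p = a ∧ idx p < idx a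
  · obtain ⟨p, hp, rfl, hlt⟩ := hex
    refine ⟨p, ⟨hp.1, ha, .inl ⟨hp, rfl⟩⟩, .inl hlt, fun y hy hya => ?_⟩
    have hps := E.chordStep_spec hc hp.1
    rcases hy with ⟨hy1, -, ⟨hy2, hy3⟩ | ⟨hy2, hy3⟩⟩
    · have hys := E.chordStep_spec hc hy1
      rw [← hy3] at hys
      exact switched_injective hy2 hp (E.ext_idx (by omega))
    · rw [E.adj_iff] at hy2
      exact absurd rfl (hy3 p hp (E.ext_idx (by omega)))
  · push Not at hex
    obtain ⟨x, hx⟩ : ∃ x, idx a = idx x + 1 ∨ idx a = 0 ∧ idx x = n - 1 := by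
      by_cases h0 : idx a = 0
      · exact ⟨v (n - 1), .inr ⟨h0, E.idx_v _ (by omega)⟩⟩
      · exact ⟨v (idx a - 1), .inl (by rw [E.idx_v _ (by omega)]; omega)⟩
    refine ⟨x, ⟨by omega, ha, .inr ⟨(E.adj_iff _ _).mpr (by omega), ?_⟩⟩, by omega,
      fun y hy hya => ?_⟩
    · rintro p hp hpx rfl
      have := hex p hp rfl
      have hps := E.chordStep_spec hc hp.1
      rw [hpx] at hps
      have := E.lt p
      omega
    · rcases hy with ⟨hy1, -, ⟨hy2, hy3⟩ | ⟨hy2, hy3⟩⟩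
      · have := hex y hy2 hy3.symm
        obtain ⟨q, hq, hqy⟩ := E.switched_surjective hc hy2
        have hqs := E.chordStep_spec hc hq.1
        rw [hqy] at hqs
        have := E.lt (c q)
        have := E.lt q
        omega
      · rw [E.adj_iff] at hy2
        exact E.ext_idx (by omega)

/-- The neighbour of `a` on the new cycle behind `a` on the Hamiltonian path. -/
theorem exists_behind (E : CycleEnum G H n v idx) (hc : IsChordMap G H idx c) {a : V}
    (ha : idx a % 2 = 0) : ∃ x, NewEdge H v idx c x a ∧
      ¬ (idx x < idx a ∨ idx a = 0 ∧ idx x = n - 1) ∧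
      ∀ y, NewEdge H v idx c y a → ¬ (idx y < idx a ∨ idx a = 0 ∧ idx y = n - 1) → y = x := by
  have h4 := E.four_le
  have hn := E.even
  have hlt := E.lt a
  by_cases hex : ∃ p, Switched v idx c p ∧ c p = a ∧ idx a < idx p
  · obtain ⟨p, hp, rfl, hlt⟩ := hex
    have hps := E.chordStep_spec hc hp.1
    have hpt : ¬ (idx (c p) = 0 ∧ idx p = n - 1) := by
      have := (hc p hp.1).2
      rw [E.adj_iff] at this; omega
    refine ⟨p, ⟨hp.1, ha, .inl ⟨hp, rfl⟩⟩, by omega, fun y hy hya => ?_⟩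
    rcases hy with ⟨hy1, -, ⟨hy2, hy3⟩ | ⟨hy2, hy3⟩⟩
    · have hys := E.chordStep_spec hc hy1
      rw [← hy3] at hys
      exact switched_injective hy2 hp (E.ext_idx (by omega))
    · rw [E.adj_iff] at hy2
      exact absurd rfl (hy3 p hp (E.ext_idx (by omega)))
  · push Not at hex
    obtain ⟨x, hx⟩ : ∃ x, idx x = idx a + 1 := ⟨v (idx a + 1), E.idx_v _ (by omega)⟩
    refine ⟨x, ⟨by omega, ha, .inr ⟨(E.adj_iff _ _).mpr (by omega), ?_⟩⟩, by omega,
      fun y hy hya => ?_⟩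
    · rintro p hp hpx rfl
      have := hex p hp rfl
      have hps := E.chordStep_spec hc hp.1
      rw [hpx] at hps
      omega
    · rcases hy with ⟨hy1, -, ⟨hy2, hy3⟩ | ⟨hy2, hy3⟩⟩
      · have := hex y hy2 hy3.symm
        omega
      · rw [E.adj_iff] at hy2
        exact E.ext_idx (by omega)

/-- The two neighbours of a vertex of the first colour class. -/
theorem newEdge_even (E : CycleEnum G H n v idx) (hc : IsChordMap G H idx c) {a : V}
    (ha : idx a % 2 = 0) : ∃ x y, x ≠ y ∧ ∀ z, NewEdge H v idx c z a ↔ z = x ∨ z = y := by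
  obtain ⟨x, hx1, hx2, hx3⟩ := E.exists_before hc ha
  obtain ⟨y, hy1, hy2, hy3⟩ := E.exists_behind hc ha
  refine ⟨x, y, fun h => hy2 (h ▸ hx2), fun z => ⟨fun hz => ?_, ?_⟩⟩
  · by_cases h : idx z < idx a ∨ idx a = 0 ∧ idx z = n - 1
    · exact .inl (hx3 z hz h)
    · exact .inr (hy3 z hz h)
  · rintro (rfl | rfl)
    exacts [hx1, hy1]

/-- The two neighbours of a vertex on the Hamiltonian cycle. -/
theorem exists_neighbors (E : CycleEnum G H n v idx) (b : V) :
    ∃ x y, x ≠ y ∧ ∀ z, H.Adj b z ↔ z = x ∨ z = y := by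
  have h4 := E.four_le
  have hlt := E.lt b
  refine ⟨v (if idx b = 0 then n - 1 else idx b - 1),
    v (if idx b = n - 1 then 0 else idx b + 1), fun h => ?_, fun z => ?_⟩
  · have := congrArg idx h
    rw [E.idx_v _ (by split_ifs <;> omega), E.idx_v _ (by split_ifs <;> omega)] at this
    split_ifs at this <;> omega
  · have e : ∀ i < n, z = v i ↔ idx z = i := fun i hi =>
      ⟨fun h => by rw [h, E.idx_v _ hi], E.eq_v⟩
    have := E.lt z
    rw [E.adj_iff, e _ (by split_ifs <;> omega), e _ (by split_ifs <;> omega)]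
    split_ifs <;> omega

/-- The other end of a removed edge. -/
theorem adj_chordStep (E : CycleEnum G H n v idx) (hc : IsChordMap G H idx c) {p : V}
    (hp : idx p % 2 = 1) : H.Adj (chordStep v idx c p) (c p) := by
  have := E.chordStep_spec hc hp
  rw [E.adj_iff]; omega

/-- The two neighbours of a vertex of the second colour class. -/
theorem newEdge_odd (E : CycleEnum G H n v idx) (hc : IsChordMap G H idx c) {b : V}
    (hb : idx b % 2 = 1) : ∃ x y, x ≠ y ∧ ∀ z, NewEdge H v idx c b z ↔ z = x ∨ z = y := by
  obtain ⟨x, y, hxy, hN⟩ := E.exists_neighbors b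
  by_cases hs : Switched v idx c b
  · obtain ⟨p, hp, hpb⟩ := E.switched_surjective hc hs
    have hcp := E.adj_chordStep hc hp.1
    have hcb := (hc b hb).2
    rw [hpb] at hcp
    rw [hN] at hcp hcb
    simp only [E.newEdge_of_switched hc hs hp hpb, hN]
    rcases hcp with rfl | rfl
    · exact ⟨c b, y, by tauto, by grind⟩
    · exact ⟨c b, x, by tauto, by grind⟩
  · exact ⟨x, y, hxy, fun z => by rw [E.newEdge_of_not_switched hc hb hs, hN]⟩

theorem newCycle_neighbors (E : CycleEnum G H n v idx) (hc : IsChordMap G H idx c) (u : V) :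
    ∃ x y, x ≠ y ∧ ∀ z, (newCycle H v idx c).Adj u z ↔ z = x ∨ z = y := by
  rcases Nat.mod_two_eq_zero_or_one (idx u) with hu | hu
  · simpa only [newCycle_adj_of_even hu] using E.newEdge_even hc hu
  · simpa only [newCycle_adj_of_odd hu] using E.newEdge_odd hc hu

theorem isCycles_newCycle (E : CycleEnum G H n v idx) (hc : IsChordMap G H idx c) :
    (newCycle H v idx c).IsCycles := by
  intro u _
  obtain ⟨x, y, hxy, h⟩ := E.newCycle_neighbors hc u
  have : (newCycle H v idx c).neighborSet u = {x, y} := by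
    ext z; simp [h]
  rw [this, Set.ncard_pair hxy]

/-- The new cycle contains a perfect matching. -/
theorem newCycle_matching [Finite V] (E : CycleEnum G H n v idx) (hc : IsChordMap G H idx c) :
    ∃ μ : V → V, (∀ u, (newCycle H v idx c).Adj u (μ u)) ∧ ∀ u, μ (μ u) = u := by
  classical
  have := Fintype.ofFinite V
  have h4 := E.four_le
  have hn := E.even
  let A := {a : V // idx a % 2 = 0}
  let B := {b : V // idx b % 2 = 1}
  let N : A → Finset B := fun a => {b | NewEdge H v idx c b.1 a.1}
  have hall : ∀ S : Finset A, S.card ≤ (S.biUnion N).card := by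
    intro S
    have := Finset.card_mul_le_card_mul (s := S) (t := S.biUnion N) (m := 2) (n := 2)
      (fun a b => NewEdge H v idx c b.1 a.1) (fun a ha => ?_) (fun b hb => ?_)
    · omega
    · obtain ⟨x, y, hxy, h⟩ := E.newEdge_even hc a.2
      have hx := (h x).mpr (.inl rfl)
      have hy := (h y).mpr (.inr rfl)
      refine (Finset.card_pair (a := (⟨x, hx.1⟩ : B)) (b := ⟨y, hy.1⟩)
        (by simpa using hxy)).symm.trans_le (Finset.card_le_card fun z hz => ?_)
      rw [Finset.mem_insert, Finset.mem_singleton] at hz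
      rw [Finset.mem_bipartiteAbove, Finset.mem_biUnion]
      rcases hz with rfl | rfl
      · exact ⟨⟨a, ha, by simpa [N] using hx⟩, hx⟩
      · exact ⟨⟨a, ha, by simpa [N] using hy⟩, hy⟩
    · obtain ⟨x, y, hxy, h⟩ := E.newEdge_odd hc b.2
      have hx := (h x).mpr (.inl rfl)
      have hy := (h y).mpr (.inr rfl)
      refine (Finset.card_le_card fun z hz => ?_).trans_eq
        (Finset.card_pair (a := (⟨x, hx.2.1⟩ : A)) (b := ⟨y, hy.2.1⟩) (by simpa using hxy))
      rw [Finset.mem_bipartiteBelow, h] at hz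
      rw [Finset.mem_insert, Finset.mem_singleton]
      exact hz.2.imp (fun h => Subtype.ext h) fun h => Subtype.ext h
  obtain ⟨g, hg1, hg2⟩ := (Finset.all_card_le_biUnion_card_iff_exists_injective N).mp hall
  have hcard : Fintype.card A = Fintype.card B := by
    refine Fintype.card_congr ⟨fun a => ⟨v (idx a.1 + 1), ?_⟩, fun b => ⟨v (idx b.1 - 1), ?_⟩,
      fun a => ?_, fun b => ?_⟩
    · have := a.2; have := E.lt a.1; rw [E.idx_v _ (by omega)]; omega
    · have := b.2; have := E.lt b.1; rw [E.idx_v _ (by omega)]; omega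
    · have := a.2; have := E.lt a.1
      exact Subtype.ext (by simp only [E.idx_v (idx a.1 + 1) (by omega), Nat.add_sub_cancel, E.v_idx])
    · have := b.2; have := E.lt b.1
      have e : idx b.1 - 1 + 1 = idx b.1 := by omega
      exact Subtype.ext (by simp only [E.idx_v (idx b.1 - 1) (by omega), e, E.v_idx])
  let e : A ≃ B := Equiv.ofBijective g ((Fintype.bijective_iff_injective_and_card g).mpr
    ⟨hg1, hcard⟩)
  have he : ∀ a, NewEdge H v idx c (e a).1 a.1 := fun a => by
    have := hg2 a; simp only [N, Finset.mem_filter_univ] at this; exact this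
  have hodd : ∀ u, ¬ idx u % 2 = 0 → idx u % 2 = 1 := fun u h => by omega
  refine ⟨fun u => if h : idx u % 2 = 0 then (e ⟨u, h⟩).1 else (e.symm ⟨u, hodd u h⟩).1,
    fun u => ?_, fun u => ?_⟩
  · by_cases h : idx u % 2 = 0
    · simp only [h, dif_pos]; exact .inr (he ⟨u, h⟩)
    · simp only [h, dif_neg, not_false_eq_true]
      have := he (e.symm ⟨u, hodd u h⟩)
      rw [Equiv.apply_symm_apply] at this
      exact .inl this
  · by_cases h : idx u % 2 = 0
    · have h' : ¬ idx (e ⟨u, h⟩).1 % 2 = 0 := by have := (e ⟨u, h⟩).2; omega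
      simp only [h, h', dif_pos, dif_neg, not_false_eq_true, Subtype.coe_eta,
        Equiv.symm_apply_apply]
    · have h' := (e.symm ⟨u, hodd u h⟩).2
      simp only [h, h', dif_pos, dif_neg, not_false_eq_true, Subtype.coe_eta,
        Equiv.apply_symm_apply]

/-- Walks of the new cycle that avoid `v 0` have an even number of forward arcs. -/
theorem arcSum_newCycle (E : CycleEnum G H n v idx) (hc : IsChordMap G H idx c) :
    ∀ (m : ℕ) {u w : V} (p : (newCycle H v idx c).Walk u w), p.length = m → p.IsTrail →
      idx u % 2 = 1 → idx w % 2 = 1 → (∀ z ∈ p.support, idx z ≠ 0) →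
      p.arcSum (fun u w => if idx u < idx w then 1 else 0) = 0 := by
  intro m
  induction m using Nat.strong_induction_on with
  | _ m ih =>
    intro u w p hm hp hu hw h0
    cases p with
    | nil => rfl
    | @cons _ a _ hua p =>
      have hua' := (newCycle_adj_of_odd hu).mp hua
      cases p with
      | nil => have := hua'.2.1; omega
      | @cons _ b _ hab q =>
        have hba := (newCycle_adj_of_even hua'.2.1).mp hab
        rw [SimpleGraph.Walk.isTrail_cons, SimpleGraph.Walk.isTrail_cons] at hp
        have hne : u ≠ b := by
          rintro rfl
          exact hp.2 (by rw [SimpleGraph.Walk.edges_cons, Sym2.eq_swap]; exact List.mem_cons_self)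
        have ha0 : idx a ≠ 0 := h0 a (by simp)
        obtain ⟨x, hx1, hx2, hx3⟩ := E.exists_before hc hua'.2.1
        obtain ⟨y, hy1, hy2, hy3⟩ := E.exists_behind hc hua'.2.1
        have hsides : ¬ (idx u < idx a ↔ idx b < idx a) := by
          intro hiff
          by_cases hlt : idx u < idx a
          · exact hne ((hx3 u hua' (.inl hlt)).trans (hx3 b hba (.inl (hiff.mp hlt))).symm)
          · exact hne ((hy3 u hua' (by omega)).trans (hy3 b hba (by omega)).symm)
        have hnb : idx b ≠ idx a := by have := hba.1; have := hba.2.1; omega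
        have hq := ih q.length (by simp at hm; omega) q rfl hp.1.1 hba.1 hw
          (fun z hz => h0 z (by simp [hz]))
        rw [SimpleGraph.Walk.arcSum_cons, SimpleGraph.Walk.arcSum_cons, hq, add_zero]
        by_cases hlt : idx u < idx a
        · rw [if_pos hlt, if_pos (by omega)]; rfl
        · rw [if_neg hlt, if_neg (by omega)]; rfl

theorem isHamCycle_newCycle [DecidableEq V] [Finite V] (E : CycleEnum G H n v idx)
    (hc : IsChordMap G H idx c) (hP : IsPfaffian G) : IsHamCycle G (newCycle H v idx c) := by
  classical
  have := Fintype.ofFinite V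
  set F := newCycle H v idx c with hF
  have hcyc := E.isCycles_newCycle hc
  have hle := E.newCycle_le hc
  have hnon : ∀ u, (F.neighborSet u).Nonempty := fun u => by
    obtain ⟨x, y, -, h⟩ := E.newCycle_neighbors hc u
    exact ⟨x, (h x).mpr (.inl rfl)⟩
  have hreach : ∀ u, F.Reachable (v 0) u := by
    intro u
    by_contra hnot
    have hodd : ∃ b, F.Reachable u b ∧ idx b % 2 = 1 := by
      rcases Nat.mod_two_eq_zero_or_one (idx u) with hu | hu
      · obtain ⟨b, hb⟩ := hnon u
        exact ⟨b, SimpleGraph.Adj.reachable hb, ((newCycle_adj_of_even hu).mp hb).1⟩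
      · exact ⟨u, .rfl, hu⟩
    obtain ⟨b, hub, hb⟩ := hodd
    obtain ⟨p, hp, hpv⟩ := hcyc.exists_cycle_toSubgraph_verts_eq_connectedComponentSupp
      (c := F.connectedComponentMk b) (v := b) rfl (hnon b)
    have hsupp : ∀ z, z ∈ p.support ↔ F.Reachable z b := fun z => by
      rw [← SimpleGraph.Walk.mem_verts_toSubgraph, hpv,
        SimpleGraph.ConnectedComponent.mem_supp_iff, SimpleGraph.ConnectedComponent.eq]
    have hz : ∀ z ∈ p.support, idx z ≠ 0 := by
      intro z hz h
      rw [hsupp, E.eq_v h] at hz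
      exact hnot (hz.trans hub.symm)
    have heven := E.arcSum_newCycle hc _ p rfl hp.isTrail hb hb hz
    obtain ⟨μ, hμ, hμμ⟩ := E.newCycle_matching hc
    have hodd := E.arcSum_forward hP (p.mapLe hle) (hp.mapLe hle)
      (isCentral_of_involution _ μ (fun u => hle (hμ u)) hμμ fun z hz => by
        rw [SimpleGraph.Walk.support_mapLe_eq_support, hsupp] at hz ⊢
        exact fun h => hz ((hμ z).reachable.trans h))
    have : (p.mapLe hle).arcSum (fun u w => if idx u < idx w then 1 else 0) =
        p.arcSum (fun u w => if idx u < idx w then 1 else 0) :=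
      SimpleGraph.Walk.arcSum_mapLe _ hle p
    rw [this, heven] at hodd
    exact absurd hodd (by decide)
  obtain ⟨p, hp, hpv⟩ := hcyc.exists_cycle_toSubgraph_verts_eq_connectedComponentSupp
    (c := F.connectedComponentMk (v 0)) (v := v 0) rfl (hnon _)
  have hall : ∀ u, u ∈ p.toSubgraph.verts := fun u => by
    rw [hpv, SimpleGraph.ConnectedComponent.mem_supp_iff, SimpleGraph.ConnectedComponent.eq]
    exact (hreach u).symm
  refine ⟨v 0, p.mapLe hle, ?_, fun e => ?_⟩
  · rw [SimpleGraph.Walk.isHamiltonianCycle_iff_isCycle_and_support_count_tail_eq_one]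
    refine ⟨hp.mapLe hle, fun u => ?_⟩
    rw [SimpleGraph.Walk.support_mapLe_eq_support]
    refine List.count_eq_one_of_mem hp.support_nodup ?_
    have := p.mem_verts_toSubgraph.mp (hall u)
    rcases (SimpleGraph.Walk.mem_support_iff p).mp this with rfl | h
    · exact SimpleGraph.Walk.end_mem_tail_support hp.not_nil
    · exact h
  · rw [SimpleGraph.Walk.edges_mapLe_eq_edges]
    induction e with
    | _ u w =>
      rw [SimpleGraph.mem_edgeSet, ← hp.adj_toSubgraph_iff_of_isCycles hcyc (hall u) w,
        SimpleGraph.Walk.adj_toSubgraph_iff_mem_edges]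

theorem newCycle_ne [Finite V] (E : CycleEnum G H n v idx) (hc : IsChordMap G H idx c) :
    newCycle H v idx c ≠ H := by
  intro h
  obtain ⟨b, hb⟩ := E.exists_switched hc
  refine (hc b hb.1).2 ?_
  rw [← h]
  exact .inl ⟨hb.1, (E.chordStep_spec hc hb.1).1, .inl ⟨hb, rfl⟩⟩

theorem newCycle_adj_anchor (E : CycleEnum G H n v idx) (hc : IsChordMap G H idx c) {s t : V}
    (hs : idx s = 0) (ht : idx t = n - 1) : (newCycle H v idx c).Adj s t := by
  have h4 := E.four_le
  have hn := E.even
  refine .inr ⟨by omega, by omega, .inr ⟨(E.adj_iff _ _).mpr (by omega), ?_⟩⟩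
  intro p hp hpt
  have := E.chordStep_spec hc hp.1
  rw [hpt] at this
  have := E.lt p
  have := E.lt (c p)
  omega

end

end CycleEnum

/-! ## The program for the second Hamiltonian cycle -/

/-- How the word `x` represents the graphs `G` and `H` and the vertices `s` and `t`. -/
structure Layout (x : List Letter) {V : Type*} (G H : SimpleGraph V) (s t : V) where
  name : V → ℕ
  rowG : V → ℕ
  rowH : V → ℕ
  nbsG : V → List V
  nbH₁ : V → V
  nbH₂ : V → V
  name_inj : Function.Injective name
  tokenG : ∀ u, TokenAt x 0 (rowG u) 0 (name u)
  tokenG_nb : ∀ u j w, (nbsG u)[j]? = some w → TokenAt x 0 (rowG u) (j + 1) (name w)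
  tokenH : ∀ u, TokenAt x 1 (rowH u) 0 (name u)
  tokenH₁ : ∀ u, TokenAt x 1 (rowH u) 1 (name (nbH₁ u))
  tokenH₂ : ∀ u, TokenAt x 1 (rowH u) 2 (name (nbH₂ u))
  tokenS : TokenAt x 2 0 0 (name s)
  tokenT : TokenAt x 2 0 1 (name t)
  beforeG : ∀ u, ∀ i < rowG u, ∃ w, w ≠ u ∧ TokenAt x 0 i 0 (name w)
  beforeH : ∀ u, ∀ i < rowH u, ∃ w, w ≠ u ∧ TokenAt x 1 i 0 (name w)
  rowH_inj : Function.Injective rowH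
  nbH_ne : ∀ u, nbH₁ u ≠ nbH₂ u
  adjG_iff : ∀ u w, G.Adj u w ↔ w ∈ nbsG u
  adjH_iff : ∀ u w, H.Adj u w ↔ w = nbH₁ u ∨ w = nbH₂ u

namespace Frag

/-- Do the counters `a` and `b` hold the same vertex? -/
def eqVertex (a b : Reg) : Frag 20 Bool := eqTok 18 a 17 18 b 17

/-- Put into `r` the neighbour of `c` on the Hamiltonian cycle that differs from `p`. -/
def next (p c r : Reg) : Frag 20 Unit :=
  (find 18 18 c 18 r).seq ((eqVertex r p).bind fun e => if e then find 18 18 c 19 r else ret ())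

/-- Move the vertices `p` and `c` by one step along the Hamiltonian cycle. -/
def walkStep (p c : Reg) : Frag 20 Unit :=
  (next p c 5).seq ((copy 0 c p).seq ((copy 0 5 c).seq (clear 5)))

/-- Is the number in column `4` of row `3` of the lists of `G` the vertex `b` or one of its
neighbours on the Hamiltonian cycle? -/
def inRowH (b : Reg) : Frag 20 Bool :=
  (eqTok 17 3 4 18 b 17).bind fun e₀ => if e₀ then ret true else
    (eqTok 17 3 4 18 b 18).bind fun e₁ => if e₁ then ret true else eqTok 17 3 4 18 b 19

/-- Put into `r` the end of the first chord at `b`. -/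
def chord (b r : Reg) : Frag 20 Unit :=
  (find 17 18 b 17 3).seq ((search (inRowH b) 4).seq ((find 18 17 3 4 r).seq
    ((clear 4).seq (clear 3))))

/-- Write the number of the vertex `r`. -/
def emitNumber (r : Reg) : Frag 20 Unit :=
  (seek 18 r 17).seq ((loop (scan.bind fun a => ret (decide (a ≠ some .endNumber)))
    ((scan.bind fun a => match a with | some a => emit a | none => ret ()).seq (go .right))).seq
    ((emit .endNumber).seq rewind))

/-- Write an edge. -/
def emitEdge (a b : Reg) : Frag 20 Unit :=
  (emitNumber a).seq ((emitNumber b).seq (emit .endList))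

end Frag

namespace Layout

open Frag

variable {x : List Letter} {L : ℕ} {V : Type*} {G H : SimpleGraph V} {s t : V}

theorem rowH_le (Λ : Layout x G H s t) (u : V) : Λ.rowH u ≤ x.length + 1 :=
  (Λ.tokenH u).row_le.trans (Nat.le_succ _)

open Classical in
/-- The neighbour of `c` on the Hamiltonian cycle that differs from `p`. -/
noncomputable def other (Λ : Layout x G H s t) (c p : V) : V :=
  if Λ.nbH₁ c = p then Λ.nbH₂ c else Λ.nbH₁ c

theorem adj_iff_other (Λ : Layout x G H s t) {c p : V} (h : H.Adj c p) (u : V) :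
    H.Adj c u ↔ u = p ∨ u = Λ.other c p := by
  rw [Λ.adjH_iff] at h ⊢
  unfold other
  split_ifs <;> grind

theorem other_ne (Λ : Layout x G H s t) {c p : V} : Λ.other c p ≠ p := by
  unfold other
  split_ifs with h
  · exact fun h' => Λ.nbH_ne c (h.trans h'.symm)
  · exact h

theorem runs_eqVertex (Λ : Layout x G H s t) (hL : x.length + 2 < 2 ^ L) {a b : Reg}
    (ha : 3 ≤ a.val) (hb : 3 ≤ b.val) {σ : Regs 20} (h : Ok x 3 σ) {u w : V}
    (hu : σ.reg a = Λ.rowH u) (hw : σ.reg b = Λ.rowH w) {e : Bool} (he : e = true ↔ u = w) :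
    Runs x L (eqVertex a b) σ e σ := by
  have := runs_eqTok (L := L) hL (g := 18) (i := a) (j := 17) (g' := 18) (i' := b) (j' := 17)
    (by simp) ha (by simp) (by simp) hb (by simp) h (m := Λ.name u) (m' := Λ.name w)
    (by rw [h.c1, h.c0, hu]; exact Λ.tokenH u) (by rw [h.c1, h.c0, hw]; exact Λ.tokenH w)
  have e' : decide (Λ.name u = Λ.name w) = e := by
    rw [Bool.eq_iff_iff, he, decide_eq_true_iff, Λ.name_inj.eq_iff]
  rwa [e'] at this

theorem runs_findH (Λ : Layout x G H s t) (hL : x.length + 2 < 2 ^ L) {g i j r : Reg}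
    (hg : 3 ≤ g.val) (hi : 3 ≤ i.val) (hj : 3 ≤ j.val) (hr : 3 ≤ r.val) (hr' : r.val < 17)
    (hgr : g ≠ r) (hir : i ≠ r) (hjr : j ≠ r) {σ : Regs 20} (h : Ok x 3 σ) {u : V}
    (hu : TokenAt x (σ.reg g) (σ.reg i) (σ.reg j) (Λ.name u)) :
    Runs x L (find 18 g i j r) σ () (σ.set r (Λ.rowH u)) := by
  refine runs_find hL (by simp) hg hi hj hr hr' (by rintro rfl; simp at hr') hgr hir hjr h hu
    (by rw [h.c1]; exact Λ.tokenH u) fun i' hi' => ?_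
  obtain ⟨w, hw, hw'⟩ := Λ.beforeH u i' hi'
  exact ⟨_, by rw [h.c1]; exact hw', Λ.name_inj.ne hw⟩

theorem runs_next (Λ : Layout x G H s t) (hL : x.length + 2 < 2 ^ L) {p c r : Reg}
    (hp : 3 ≤ p.val) (hc : 3 ≤ c.val) (hr : 3 ≤ r.val) (hr' : r.val < 17) (hpr : p ≠ r)
    (hcr : c ≠ r) {σ : Regs 20} (h : Ok x 3 σ) {u w : V} (hu : σ.reg p = Λ.rowH u)
    (hw : σ.reg c = Λ.rowH w) :
    Runs x L (next p c r) σ () (σ.set r (Λ.rowH (Λ.other w u))) := by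
  have h18 : (18 : Reg) ≠ r := by rintro rfl; simp at hr'
  have h19 : (19 : Reg) ≠ r := by rintro rfl; simp at hr'
  have hok := h.set hr hr' (Λ.rowH_le (Λ.nbH₁ w))
  refine (Λ.runs_findH hL (by simp) hc (by simp) hr hr' h18 hcr h18 h
    (by rw [h.c1, hw]; exact Λ.tokenH₁ w)).seq ?_
  refine (Λ.runs_eqVertex hL hr hp hok (u := Λ.nbH₁ w) (w := u) (by simp)
    (by rw [Regs.set_reg_of_ne _ hpr, hu]) (e := by classical exact decide (Λ.nbH₁ w = u))
    (by simp)).bind ?_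
  by_cases he : Λ.nbH₁ w = u
  · have := Λ.runs_findH (L := L) hL (g := 18) (i := c) (j := 19) (by simp) hc (by simp) hr hr' h18
      hcr h19 hok (u := Λ.nbH₂ w)
      (by simp only [Regs.set_reg_of_ne _ h18, Regs.set_reg_of_ne _ h19, Regs.set_reg_of_ne _ hcr,
            h.c1, h.c2, hw]; exact Λ.tokenH₂ w)
    simpa [he, other] using this
  · simpa [he, other] using runs_ret (x := x) (L := L) () _

theorem runs_walkStep (Λ : Layout x G H s t) (hL : x.length + 2 < 2 ^ L) {p c : Reg}
    (hp : 6 ≤ p.val) (hc : 6 ≤ c.val) (hpc : p ≠ c) {σ : Regs 20}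
    (h : Ok x 6 σ) {u w : V} (hu : σ.reg p = Λ.rowH u) (hw : σ.reg c = Λ.rowH w) :
    Runs x L (walkStep p c) σ () ((σ.set p (Λ.rowH w)).set c (Λ.rowH (Λ.other w u))) := by
  have hb : ∀ u, Λ.rowH u < 2 ^ L := fun u => by have := Λ.rowH_le u; omega
  have h0 : σ.reg 0 = 0 := h.scratch 0 (by simp)
  have h5 : σ.reg 5 = 0 := h.scratch 5 (by simp)
  have hne : ∀ r : Reg, 6 ≤ r.val → r ≠ 5 ∧ r ≠ 0 := by
    intro r hr
    constructor <;> rintro rfl <;> simp at hr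
  have hp' := hne p hp
  have hc' := hne c hc
  refine (Λ.runs_next hL (by omega) (by omega) (by simp) (by simp) hp'.1 hc'.1
    (h.mono (by omega)) hu hw).seq ?_
  refine (runs_copy hc'.2.symm hp'.2.symm hpc.symm (by simp [Regs.set_reg, h0])
    (by rw [Regs.set_reg_of_ne _ hc'.1, hw]; exact hb w)).seq ?_
  refine (runs_copy (by decide) hc'.2.symm hc'.1.symm (by simp [Regs.set_reg, h0, hp'.2.symm])
    (by simp [Regs.set_reg, hp'.1.symm, hb])).seq ?_
  convert runs_clear 5 _ using 1
  refine Regs.ext_reg rfl (fun j => ?_) rfl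
  simp only [Regs.set_reg]
  grind

/-- `w` is the end of the first chord in the list of `u`. -/
def IsFirstChord (Λ : Layout x G H s t) (u w : V) : Prop :=
  ∃ k : ℕ, (u :: Λ.nbsG u)[k]? = some w ∧ ¬ (w = u ∨ H.Adj u w) ∧
    ∀ j < k, ∃ w', (u :: Λ.nbsG u)[j]? = some w' ∧ (w' = u ∨ H.Adj u w')

theorem IsFirstChord.adj {Λ : Layout x G H s t} {u w : V} (h : Λ.IsFirstChord u w) :
    G.Adj u w ∧ ¬ H.Adj u w := by
  obtain ⟨k, h1, h2, -⟩ := h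
  have := List.mem_of_getElem? h1
  rw [Λ.adjG_iff]
  grind

theorem exists_isFirstChord (Λ : Layout x G H s t) {u w : V} (h : G.Adj u w ∧ ¬ H.Adj u w) :
    ∃ w, Λ.IsFirstChord u w := by
  classical
  have hex : ∃ k : ℕ, ∃ w, (u :: Λ.nbsG u)[k]? = some w ∧ ¬ (w = u ∨ H.Adj u w) := by
    have hw := List.mem_cons_of_mem u ((Λ.adjG_iff u w).mp h.1)
    obtain ⟨k, hk⟩ := List.mem_iff_getElem?.mp hw
    exact ⟨k, w, hk, not_or.mpr ⟨h.1.ne', h.2⟩⟩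
  obtain ⟨w, h1, h2⟩ := Nat.find_spec hex
  refine ⟨w, Nat.find hex, h1, h2, fun j hj => ?_⟩
  have hlt : j < (u :: Λ.nbsG u).length := hj.trans (List.getElem?_eq_some_iff.mp h1).1
  have := Nat.find_min hex hj
  push Not at this
  exact ⟨_, List.getElem?_eq_getElem hlt, this _ (List.getElem?_eq_getElem hlt)⟩

theorem tokenG_cons (Λ : Layout x G H s t) (u : V) (j : ℕ) (w : V)
    (h : (u :: Λ.nbsG u)[j]? = some w) : TokenAt x 0 (Λ.rowG u) j (Λ.name w) := by
  cases j with
  | zero => simp only [List.getElem?_cons_zero, Option.some.injEq] at h; subst h; exact Λ.tokenG u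
  | succ j => exact Λ.tokenG_nb u j w (by simpa using h)

theorem runs_inRowH (Λ : Layout x G H s t) (hL : x.length + 2 < 2 ^ L) {b : Reg}
    (hb : 5 ≤ b.val) {σ : Regs 20} (h : Ok x 3 σ) {u w : V} (hu : σ.reg b = Λ.rowH u)
    (h3 : σ.reg 3 = Λ.rowG u) (h4 : (u :: Λ.nbsG u)[σ.reg 4]? = some w) {e : Bool}
    (he : e = true ↔ w = u ∨ H.Adj u w) :
    Runs x L (inRowH b) σ e σ := by
  have ht := Λ.tokenG_cons u _ w h4
  have key : ∀ (j : Reg) (z : V), 3 ≤ j.val → TokenAt x 1 (Λ.rowH u) (σ.reg j) (Λ.name z) →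
      ∀ e : Bool, (e = true ↔ w = z) → Runs x L (eqTok 17 3 4 18 b j) σ e σ := by
    intro j z hj hz e he
    have := runs_eqTok (L := L) hL (g := 17) (i := 3) (j := 4) (g' := 18) (i' := b) (j' := j)
      (by simp) (by simp) (by simp) (by simp) (by omega) hj h (m := Λ.name w) (m' := Λ.name z)
      (by rw [h.c0, h3]; exact ht) (by rw [h.c1, hu]; exact hz)
    have e' : decide (Λ.name w = Λ.name z) = e := by
      rw [Bool.eq_iff_iff, he, decide_eq_true_iff, Λ.name_inj.eq_iff]
    rwa [e'] at this
  have k0 := key 17 u (by simp) (by rw [h.c0]; exact Λ.tokenH u)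
  have k1 := key 18 _ (by simp) (by rw [h.c1]; exact Λ.tokenH₁ u)
  have k2 := key 19 _ (by simp) (by rw [h.c2]; exact Λ.tokenH₂ u)
  rw [Λ.adjH_iff] at he
  have hr := runs_ret (x := x) (L := L) true σ
  by_cases e0 : w = u
  · rw [show e = true from he.mpr (.inl e0)]
    exact (k0 true (by simpa)).bind hr
  refine (k0 false (by simpa)).bind ?_
  by_cases e1 : w = Λ.nbH₁ u
  · rw [show e = true from he.mpr (.inr (.inl e1))]
    exact (k1 true (by simpa)).bind hr
  exact (k1 false (by simpa)).bind (k2 e (by rw [he]; simp [e0, e1]))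

theorem runs_chord (Λ : Layout x G H s t) (hL : x.length + 2 < 2 ^ L) {b r : Reg}
    (hb : 5 ≤ b.val) (hb' : b.val < 17) (hr : 5 ≤ r.val) (hr' : r.val < 17)
    {σ : Regs 20} (h : Ok x 5 σ) {u w : V} (hu : σ.reg b = Λ.rowH u) (hw : Λ.IsFirstChord u w) :
    Runs x L (chord b r) σ () (σ.set r (Λ.rowH w)) := by
  obtain ⟨k, h1, h2, h3⟩ := hw
  have hne : ∀ r : Reg, 5 ≤ r.val → r ≠ 3 ∧ r ≠ 4 := by
    intro r hr
    constructor <;> rintro rfl <;> simp at hr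
  have n3 := h.scratch 3 (by simp)
  have n4 := h.scratch 4 (by simp)
  have hk : k ≤ x.length := (Λ.tokenG_cons u k w h1).col_le
  have hok3 : Ok x 3 (σ.set 3 (Λ.rowG u)) :=
    (h.mono (by omega)).set (by simp) (by simp) ((Λ.tokenG u).row_le.trans (Nat.le_succ _))
  have hok4 : ∀ j ≤ k, Ok x 3 ((σ.set 3 (Λ.rowG u)).set 4 j) := fun j hj =>
    hok3.set (by simp) (by simp) (by omega)
  have hrow : ∀ j ≤ k, ∀ w', (u :: Λ.nbsG u)[j]? = some w' → ∀ e : Bool,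
      (e = true ↔ w' = u ∨ H.Adj u w') →
      Runs x L (inRowH b) ((σ.set 3 (Λ.rowG u)).set 4 j) e ((σ.set 3 (Λ.rowG u)).set 4 j) :=
    fun j hj w' hw' e he => Λ.runs_inRowH hL hb (hok4 j hj) (u := u) (w := w')
      (by simp [Regs.set_reg, hne b hb, hu]) (by simp [Regs.set_reg]) (by simpa using hw') he
  refine (runs_find hL (by simp) (by simp) (by omega) (by simp) (by simp) (by simp) (by decide)
    (by decide) (hne b hb).1 (by decide) (h.mono (by omega)) (m := Λ.name u) (n := Λ.rowG u)
    (by rw [h.c1, h.c0, hu]; exact Λ.tokenH u) (by rw [h.c0]; exact Λ.tokenG u)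
    fun i hi => ?_).seq ?_
  · obtain ⟨w', hw', hw''⟩ := Λ.beforeG u i hi
    exact ⟨_, by rw [h.c0]; exact hw'', Λ.name_inj.ne hw'⟩
  refine (runs_search hL (by omega) (n := k) (fun j hj => ?_) ?_).seq ?_
  · obtain ⟨w', hw', hw''⟩ := h3 j hj
    exact hrow j hj.le w' hw' true (by simpa using hw'')
  · exact hrow k le_rfl w h1 false (by simpa using h2)
  refine (Λ.runs_findH hL (by simp) (by simp) (by simp) (by omega) hr'
    (by rintro rfl; simp at hr') (hne r hr).1.symm (hne r hr).2.symm (hok4 k le_rfl) (u := w)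
    (by simpa [Regs.set_reg, h.c0] using Λ.tokenG_cons u k w h1)).seq ?_
  refine (runs_clear _ _).seq ?_
  convert runs_clear 3 _ using 1
  have := hne r hr
  refine Regs.ext_reg rfl (fun j => ?_) rfl
  simp only [Regs.set_reg]
  grind

theorem runs_emitNumber (Λ : Layout x G H s t) (hL : x.length + 2 < 2 ^ L) {r : Reg}
    (hr : 2 ≤ r.val) {σ : Regs 20} (h : Ok x 2 σ) {u : V} (hu : σ.reg r = Λ.rowH u) :
    Runs x L (emitNumber r) σ () (σ.write (encodeNumber (Λ.name u))) := by
  obtain ⟨gs, rows, nums, suf, h1, h2, h3, hx⟩ := Λ.tokenH u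
  set pre := gs.flatMap (fun T => T.flatMap encodeNumbers ++ [.endGraph]) ++
    rows.flatMap encodeNumbers ++ nums.flatMap encodeNumber with hpre
  set w := (Computability.encodeNat (Λ.name u)).map Letter.bit with hw
  have hxw : x = pre ++ (w ++ (.endNumber :: suf)) := by rw [hx, encodeNumber]; simp [w]
  have hlen : x.length = pre.length + w.length + 1 + suf.length := by
    conv_lhs => rw [hxw]
    simp; omega
  have hget : ∀ i < w.length, x[pre.length + i]? = w[i]? := by
    intro i hi
    rw [hxw, List.getElem?_append_right (by omega), List.getElem?_append_left (by omega)]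
    simp
  have hget' : x[pre.length + w.length]? = some .endNumber := by
    rw [hxw, List.getElem?_append_right (by omega), List.getElem?_append_right (by omega)]
    simp
  refine (runs_seek (by omega) (by simp) hr (by simp) h (by rw [h.c1, h1]) (by rw [h2, hu])
    (by rw [h3, h.c0]) hpre hx).seq ?_
  have r1 := Runs.loop_seq (x := x) (L := L)
    (T := scan.bind fun a => ret (decide (a ≠ some .endNumber)))
    (F := (scan.bind fun a => match a with | some a => emit a | none => ret ()).seq (go .right))
    (fun i => ((σ.setHead (pre.length + i + 1)).write (w.take i) : Regs 20)) w.length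
    (fun i hi => by
      refine (runs_scan (i := pre.length + i) rfl).bind (runs_ret_of_eq ?_ rfl)
      rw [hget i hi]
      have : w[i]? ≠ some .endNumber := fun h =>
        notMem_bits .endNumber (by simp) _ (List.mem_of_getElem? h)
      simp [this])
    (fun i hi => by
      refine Runs.seq (σ' := (σ.setHead (pre.length + i + 1)).write (w.take (i + 1))) ?_ ?_
      · refine (runs_scan (i := pre.length + i) rfl).bind ?_
        rw [hget i hi, List.getElem?_eq_getElem hi]
        convert runs_emit (x := x) (L := L) w[i] _ using 1
        rw [Regs.write_write, List.take_add_one, List.getElem?_eq_getElem hi]; rfl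
      · exact runs_go_right_of_eq (by simp; omega) rfl)
    ((runs_scan (i := pre.length + w.length) rfl).bind (runs_ret_of_eq (by simp [hget']) rfl))
  refine Runs.seq (σ' := (σ.setHead (pre.length + w.length + 1)).write w) ?_ ?_
  · convert r1 using 1
    · simp
    · simp
  · refine (runs_emit _ _).seq ?_
    convert runs_rewind _ using 1
    simp [Regs.write, Regs.setHead, encodeNumber, w, h.head]

theorem runs_emitEdge (Λ : Layout x G H s t) (hL : x.length + 2 < 2 ^ L) {a b : Reg}
    (ha : 2 ≤ a.val) (hb : 2 ≤ b.val) {σ : Regs 20} (h : Ok x 2 σ) {u w : V}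
    (hu : σ.reg a = Λ.rowH u) (hw : σ.reg b = Λ.rowH w) :
    Runs x L (emitEdge a b) σ () (σ.write (encodeNumbers [Λ.name u, Λ.name w])) := by
  refine (Λ.runs_emitNumber hL ha h hu).seq ((Λ.runs_emitNumber hL hb (h.write _) hw).seq ?_)
  convert runs_emit _ _ using 1
  simp [encodeNumbers]

end Layout

namespace Frag

variable {k : ℕ} {x : List Letter} {L : ℕ}

/-- A loop whose test changes the state from `s i` to `s' i`. -/
theorem Runs.loop_seq₂ {T : Frag k Bool} {F : Frag k Unit} (s s' : ℕ → Regs k) (n : ℕ)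
    (hT : ∀ i < n, Runs x L T (s i) true (s' i)) (hF : ∀ i < n, Runs x L F (s' i) () (s (i + 1)))
    (hn : Runs x L T (s n) false (s' n)) : Runs x L (T.loop F) (s 0) () (s' n) := by
  have : ∀ d ≤ n, Runs x L (T.loop F) (s (n - d)) () (s' n) := by
    intro d
    induction d with
    | zero => exact fun _ => hn.loop_false
    | succ d ih =>
      intro hd
      have e : n - (d + 1) + 1 = n - d := by omega
      exact .loop_true (hT _ (by omega)) (hF _ (by omega)) (e ▸ ih (by omega))
  simpa using this n le_rfl

/-- Begin the walk along the Hamiltonian cycle: put `t` into `p` and `s` into `c`. -/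
def startWalk (p c : Reg) : Frag 20 Unit :=
  (find 18 19 17 17 c).seq (find 18 19 17 18 p)

/-- Put the image of the vertex `12` under `chordStep` into `11`. -/
def pathStep : Frag 20 Unit :=
  (chord 12 6).seq ((startWalk 7 8).seq
    ((loop ((eqVertex 8 6).bind fun e => if e then ret false else negate (eqVertex 8 12))
      (walkStep 7 8)).seq
    (((eqVertex 8 6).bind fun e => if e then next 7 8 11 else
      (loop (negate (eqVertex 8 6)) (walkStep 7 8)).seq (copy 0 7 11)).seq
    ((clear 6).seq ((clear 7).seq (clear 8))))))

/-- Add the length of the input to the counter `r`. -/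
def inputLength (r : Reg) : Frag 20 Unit :=
  (go .right).seq ((loop (scan.bind fun a => ret a.isSome) ((go .right).seq (inc r))).seq rewind)

/-- Iterate `chordStep` on the vertex `10` until it comes back, or for too long. -/
def findPeriod : Frag 20 Unit :=
  (copy 0 10 12).seq (pathStep.seq ((inputLength 13).seq
    (loop ((pos 13).bind fun e => if e then negate (eqVertex 11 10) else ret false)
      ((copy 0 11 12).seq (pathStep.seq (dec 13))))))

/-- Write the two edges of the new cycle at the vertex `10`, which follows the vertex `9` on the
Hamiltonian cycle. -/
def emitVertex : Frag 20 Unit :=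
  findPeriod.seq (((eqVertex 11 10).bind fun e =>
    if e then (chord 12 14).seq ((next 14 10 11).seq ((chord 10 14).seq
      ((emitEdge 10 14).seq (emitEdge 10 11))))
    else (emitEdge 10 9).seq ((next 9 10 11).seq (emitEdge 10 11))).seq
  ((clear 11).seq ((clear 12).seq ((clear 13).seq (clear 14)))))

/-- Walk along the Hamiltonian cycle and write the new edges at every second vertex. -/
def emitCycle : Frag 20 Unit :=
  (inc 18).seq ((inc 19).seq ((inc 19).seq ((startWalk 9 10).seq
    (loop ((walkStep 9 10).seq (emitVertex.seq (negate (eqTok 18 10 17 19 17 18))))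
      (walkStep 9 10)))))

theorem runs_inputLength (hL : x.length + 2 < 2 ^ L) {r : Reg} {σ : Regs 20} (hh : σ.head = 0)
    (hr : σ.reg r = 0) : Runs x L (inputLength r) σ () (σ.set r x.length) := by
  have r1 := Runs.loop_seq (x := x) (L := L) (T := scan.bind fun a => ret a.isSome)
    (F := (go .right).seq (inc r)) (fun i => ((σ.setHead (i + 1)).set r i : Regs 20)) x.length
    (fun i hi => (runs_scan (i := i) rfl).bind (runs_ret_of_eq (by simp [hi]) rfl))
    (fun i hi => (runs_go_right_of_eq (by simp; omega) rfl).seq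
      (runs_inc_of_eq (by simp; omega) (by simp [Regs.set, Regs.setHead])))
    ((runs_scan (i := x.length) rfl).bind (runs_ret_of_eq (by simp) rfl))
  refine (runs_go_right_of_eq (by omega) rfl).seq (Runs.seq
    (σ' := (σ.setHead (x.length + 1)).set r x.length) ?_ ?_)
  · convert r1 using 1
    rw [Regs.set_eq_self (by simp [hr]), hh]
  · convert runs_rewind _ using 1
    simp [Regs.set, Regs.setHead, hh]

end Frag

namespace Layout

open Frag

variable {x : List Letter} {L : ℕ} {V : Type*} {G H : SimpleGraph V} {s t : V}
  {n : ℕ} {v : ℕ → V} {idx : V → ℕ} {c : V → V}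

/-- The vertex before `v i` on the Hamiltonian cycle. -/
def before (t : V) (v : ℕ → V) (i : ℕ) : V := if i = 0 then t else v (i - 1)

theorem adj_before (E : CycleEnum G H n v idx) (ht : idx t = n - 1) {i : ℕ} (hi : i < n) :
    H.Adj (v i) (before t v i) := by
  have h4 := E.four_le
  unfold before
  split_ifs with h
  · rw [E.adj_iff, E.idx_v i hi]; omega
  · rw [E.adj_iff, E.idx_v i hi, E.idx_v _ (by omega)]; omega

theorem other_before (Λ : Layout x G H s t) (E : CycleEnum G H n v idx) (ht : idx t = n - 1)
    {i : ℕ} (hi : i + 1 < n) : Λ.other (v i) (before t v i) = v (i + 1) := by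
  have h4 := E.four_le
  have h1 := (Λ.adj_iff_other (adj_before E ht (i := i) (by omega)) _).mp (E.adj_succ hi)
  refine (h1.resolve_left fun h => ?_).symm
  have h := congrArg idx h
  rw [E.idx_v _ hi] at h
  unfold before at h
  split_ifs at h
  · omega
  · rw [E.idx_v _ (by omega)] at h; omega

/-- The state of a walk after `i` steps. -/
def walkState (Λ : Layout x G H s t) (v : ℕ → V) (p c : Reg) (σ : Regs 20) (i : ℕ) : Regs 20 :=
  (σ.set p (Λ.rowH (before t v i))).set c (Λ.rowH (v i))

theorem ok_walkState (Λ : Layout x G H s t) {p c : Reg} {l : ℕ} (hp : l ≤ p.val) (hc : l ≤ c.val)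
    (hp' : p.val < 17) (hc' : c.val < 17) {σ : Regs 20} (h : Ok x l σ) (i : ℕ) :
    Ok x l (Λ.walkState v p c σ i) :=
  (h.set hp hp' (Λ.rowH_le _)).set hc hc' (Λ.rowH_le _)

theorem runs_startWalk (Λ : Layout x G H s t) (E : CycleEnum G H n v idx) (hs : idx s = 0)
    (hL : x.length + 2 < 2 ^ L) {p c : Reg} (hp : 3 ≤ p.val) (hc : 3 ≤ c.val) (hp' : p.val < 17)
    (hc' : c.val < 17) (hpc : p ≠ c) {σ : Regs 20} (h : Ok x 3 σ) :
    Runs x L (startWalk p c) σ () (Λ.walkState v p c σ 0) := by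
  have hne : ∀ r : Reg, r.val < 17 → 17 ≠ r ∧ 18 ≠ r ∧ 19 ≠ r := by
    intro r hr
    refine ⟨?_, ?_, ?_⟩ <;> rintro rfl <;> simp at hr
  refine (Λ.runs_findH hL (by simp) (by simp) (by simp) hc hc' (hne c hc').2.2 (hne c hc').1
    (hne c hc').1 h (u := s) (by rw [h.c0, h.c2]; exact Λ.tokenS)).seq ?_
  have hok := h.set hc hc' (Λ.rowH_le s)
  convert Λ.runs_findH hL (by simp) (by simp) (by simp) hp hp' (hne p hp').2.2 (hne p hp').1
    (hne p hp').2.1 hok (u := t) (by rw [hok.c0, hok.c1, hok.c2]; exact Λ.tokenT) using 1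
  rw [walkState, Regs.set_comm _ hpc, ← E.eq_v hs]
  rfl

theorem runs_walkStep_walkState (Λ : Layout x G H s t) (E : CycleEnum G H n v idx)
    (ht : idx t = n - 1) (hL : x.length + 2 < 2 ^ L) {p c : Reg} (hp : 6 ≤ p.val) (hc : 6 ≤ c.val)
    (hp' : p.val < 17) (hc' : c.val < 17) (hpc : p ≠ c) {σ : Regs 20} (h : Ok x 6 σ) {i : ℕ}
    (hi : i + 1 < n) :
    Runs x L (walkStep p c) (Λ.walkState v p c σ i) () (Λ.walkState v p c σ (i + 1)) := by
  convert Λ.runs_walkStep hL hp hc hpc (Λ.ok_walkState (v := v) hp hc hp' hc' h i) (u := before t v i)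
    (w := v i) (by simp [walkState, Regs.set_reg, hpc]) (by simp [walkState]) using 1
  rw [Λ.other_before E ht hi]
  refine Regs.ext_reg rfl (fun j => ?_) rfl
  simp only [walkState, Regs.set_reg, before]
  grind

theorem runs_pathStep (Λ : Layout x G H s t) (E : CycleEnum G H n v idx) (hs : idx s = 0)
    (ht : idx t = n - 1) (hc : ∀ u, Λ.IsFirstChord u (c u)) (hL : x.length + 2 < 2 ^ L)
    {σ : Regs 20} (h : Ok x 9 σ) {u : V} (hu : σ.reg 12 = Λ.rowH u) (hodd : idx u % 2 = 1) :
    Runs x L pathStep σ () (σ.set 11 (Λ.rowH (chordStep v idx c u))) := by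
  have hcm : IsChordMap G H idx c := fun b _ => (hc b).adj
  have hspec := E.chordStep_spec hcm hodd
  have hlt := E.lt u
  have hltc := E.lt (c u)
  set σ₁ := σ.set 6 (Λ.rowH (c u)) with hσ₁
  have hok₁ : Ok x 6 σ₁ := (h.mono (by omega)).set (by simp) (by simp) (Λ.rowH_le _)
  have hok : ∀ i, Ok x 6 (Λ.walkState v 7 8 σ₁ i) := fun i =>
    Λ.ok_walkState (by simp) (by simp) (by simp) (by simp) hok₁ i
  have hok3 : ∀ i, Ok x 3 (Λ.walkState v 7 8 σ₁ i) := fun i => (hok i).mono (by omega)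
  have r6 : ∀ i, (Λ.walkState v 7 8 σ₁ i).reg 6 = Λ.rowH (c u) := fun i => by
    simp [walkState, Regs.set_reg, hσ₁]
  have r7 : ∀ i, (Λ.walkState v 7 8 σ₁ i).reg 7 = Λ.rowH (before t v i) := fun i => by
    simp [walkState, Regs.set_reg]
  have r8 : ∀ i, (Λ.walkState v 7 8 σ₁ i).reg 8 = Λ.rowH (v i) := fun i => by
    simp [walkState]
  have r12 : ∀ i, (Λ.walkState v 7 8 σ₁ i).reg 12 = Λ.rowH u := fun i => by
    simp [walkState, Regs.set_reg, hσ₁, hu]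
  have heq : ∀ i < n, ∀ w, v i = w ↔ i = idx w := fun i hi w =>
    ⟨fun h => by rw [← h, E.idx_v i hi], fun h => by rw [h, E.v_idx]⟩
  have eq6 : ∀ i < n, ∀ e : Bool, (e = true ↔ i = idx (c u)) →
      Runs x L (eqVertex 8 6) (Λ.walkState v 7 8 σ₁ i) e (Λ.walkState v 7 8 σ₁ i) :=
    fun i hi e he => Λ.runs_eqVertex hL (by simp) (by simp) (hok3 i) (r8 i) (r6 i)
      (he.trans (heq i hi _).symm)
  have eq12 : ∀ i < n, ∀ e : Bool, (e = true ↔ i = idx u) →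
      Runs x L (eqVertex 8 12) (Λ.walkState v 7 8 σ₁ i) e (Λ.walkState v 7 8 σ₁ i) :=
    fun i hi e he => Λ.runs_eqVertex hL (by simp) (by simp) (hok3 i) (r8 i) (r12 i)
      (he.trans (heq i hi _).symm)
  have hstep : ∀ i, i + 1 < n → Runs x L (walkStep 7 8) (Λ.walkState v 7 8 σ₁ i) ()
      (Λ.walkState v 7 8 σ₁ (i + 1)) := fun i hi =>
    Λ.runs_walkStep_walkState E ht hL (by simp) (by simp) (by simp) (by simp) (by decide) hok₁ hi
  have hfin : ∀ i w, Runs x L ((clear 6).seq ((clear 7).seq (clear 8)))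
      ((Λ.walkState v 7 8 σ₁ i).set 11 w) () (σ.set 11 w) := by
    intro i w
    refine (runs_clear _ _).seq ((runs_clear _ _).seq ?_)
    convert runs_clear _ _ using 1
    have h6 := h.scratch 6 (by simp)
    have h7 := h.scratch 7 (by simp)
    have h8 := h.scratch 8 (by simp)
    refine Regs.ext_reg rfl (fun j => ?_) rfl
    simp only [walkState, Regs.set_reg, hσ₁]
    grind
  refine (Λ.runs_chord hL (by simp) (by simp) (by simp) (by simp) (h.mono (by omega)) hu
    (hc u)).seq ?_
  refine (Λ.runs_startWalk E hs hL (by simp) (by simp) (by simp) (by simp) (by decide)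
    (hok₁.mono (by omega))).seq ?_
  have loop₁ : ∀ m, m < n → (∀ i < m, i ≠ idx (c u) ∧ i ≠ idx u) → (m = idx (c u) ∨ m = idx u) →
      Runs x L (loop ((eqVertex 8 6).bind fun e =>
        if e then ret false else negate (eqVertex 8 12)) (walkStep 7 8))
        (Λ.walkState v 7 8 σ₁ 0) () (Λ.walkState v 7 8 σ₁ m) := by
    intro m hm hbefore hat
    refine Runs.loop_seq (fun i => Λ.walkState v 7 8 σ₁ i) m (fun i hi => ?_)
      (fun i hi => hstep i (by omega)) ?_
    · exact (eq6 i (by omega) false (by simpa using (hbefore i hi).1)).bind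
        (eq12 i (by omega) false (by simpa using (hbefore i hi).2)).negate
    · by_cases he : m = idx (c u)
      · exact (eq6 m hm true (by simpa)).bind (runs_ret _ _)
      · exact (eq6 m hm false (by simpa)).bind
          (eq12 m hm true (by simpa using hat.resolve_left he)).negate
  rcases hspec.2 with ⟨h1, h2, h3⟩ | ⟨h1, h2, h3⟩
  · refine (loop₁ (idx u) hlt (by omega) (by omega)).seq ?_
    refine Runs.seq ?_ (hfin (idx (c u)) _)
    refine (eq6 (idx u) hlt false (by simp; omega)).bind ?_
    have loop₂ := Runs.loop_seq (x := x) (L := L) (T := negate (eqVertex 8 6))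
      (F := walkStep 7 8) (fun i => Λ.walkState v 7 8 σ₁ (idx u + i)) (idx (c u) - idx u)
      (fun i hi => (eq6 _ (by omega) false (by simp; omega)).negate)
      (fun i hi => hstep (idx u + i) (by omega))
      (eq6 _ (by omega) true (by simp; omega)).negate
    simp only [add_zero, show idx u + (idx (c u) - idx u) = idx (c u) by omega] at loop₂
    refine loop₂.seq ?_
    convert runs_copy (x := x) (L := L) (t := 0) (a := 7) (b := 11) (by decide) (by decide)
      (by decide) ((hok (idx (c u))).scratch 0 (by simp))
      (by rw [r7]; have := Λ.rowH_le (before t v (idx (c u))); omega) using 1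
    rw [r7, before, if_neg (by omega), chordStep, if_pos h1]
  · refine (loop₁ (idx (c u)) hltc (by omega) (by omega)).seq ?_
    refine Runs.seq ?_ (hfin (idx (c u)) _)
    refine (eq6 (idx (c u)) hltc true (by simp)).bind ?_
    have := Λ.runs_next hL (p := 7) (c := 8) (r := 11) (by simp) (by simp) (by simp) (by simp)
      (by decide) (by decide) (hok3 (idx (c u))) (r7 _) (r8 _)
    rw [Λ.other_before E ht (by omega)] at this
    have e : chordStep v idx c u = v (idx (c u) + 1) := by rw [chordStep, if_neg (by omega)]
    rw [e]
    exact this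

end Layout

namespace Layout

open Frag

variable {x : List Letter} {L : ℕ} {V : Type*} {G H : SimpleGraph V} {s t : V}
  {n : ℕ} {v : ℕ → V} {idx : V → ℕ} {c : V → V}

/-- The periods are not longer than the input. -/
theorem exists_period (Λ : Layout x G H s t) (f : V → V) (u : V) :
    ∃ j ≤ x.length, (∀ i < j, f^[i + 1] u ≠ u) ∧
      (j < x.length → f^[j + 1] u = u) ∧ (u ∈ Function.periodicPts f ↔ f^[j + 1] u = u) := by
  classical
  have hex : ∃ j, f^[j + 1] u = u ∨ j = x.length := ⟨_, .inr rfl⟩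
  have hle : Nat.find hex ≤ x.length := Nat.find_min' hex (.inr rfl)
  refine ⟨Nat.find hex, hle, fun i hi h => Nat.find_min hex hi (.inl h),
    fun h => (Nat.find_spec hex).resolve_right h.ne, fun h => ?_, fun h => ⟨_, Nat.succ_pos _, h⟩⟩
  have hpos := Function.minimalPeriod_pos_of_mem_periodicPts h
  set p := Function.minimalPeriod f u with hp
  have hper : f^[p] u = u := Function.iterate_minimalPeriod
  have hcard : p ≤ x.length + 1 := by
    have := Finset.card_le_card_of_injOn (s := Finset.range p) (t := Finset.range (x.length + 1))
      (fun i => Λ.rowH (f^[i] u))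
      (fun i _ => by simpa [Nat.lt_succ_iff] using (Λ.tokenH (f^[i] u)).row_le)
      (fun i hi j hj hij => Function.iterate_injOn_Iio_minimalPeriod (by simpa using hi)
        (by simpa using hj) (Λ.rowH_inj hij))
    simpa using this
  have h1 : Nat.find hex ≤ p - 1 := Nat.find_min' hex (.inl (by rwa [Nat.sub_add_cancel hpos]))
  rcases Nat.find_spec hex with h2 | h2
  · exact h2
  · rw [show Nat.find hex + 1 = p by omega, hper]

theorem runs_findPeriod (Λ : Layout x G H s t) (E : CycleEnum G H n v idx) (hs : idx s = 0)
    (ht : idx t = n - 1) (hc : ∀ u, Λ.IsFirstChord u (c u)) (hL : x.length + 2 < 2 ^ L) {u : V}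
    (hodd : idx u % 2 = 1) {j : ℕ} (hj : j ≤ x.length)
    (hlt : ∀ i < j, (chordStep v idx c)^[i + 1] u ≠ u)
    (hend : j < x.length → (chordStep v idx c)^[j + 1] u = u) {σ : Regs 20} (h : Ok x 9 σ)
    (hu : σ.reg 10 = Λ.rowH u) (h13 : σ.reg 13 = 0) :
    Runs x L findPeriod σ ()
      (((σ.set 12 (Λ.rowH ((chordStep v idx c)^[j] u))).set 11
        (Λ.rowH ((chordStep v idx c)^[j + 1] u))).set 13 (x.length - j)) := by
  set f := chordStep v idx c with hf
  have hcm : IsChordMap G H idx c := fun b _ => (hc b).adj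
  have hrow : ∀ w, Λ.rowH w < 2 ^ L := fun w => by have := Λ.rowH_le w; omega
  have h0 := h.scratch 0 (by simp)
  set S : ℕ → Regs 20 := fun i => ((σ.set 12 (Λ.rowH (f^[i] u))).set 11
    (Λ.rowH (f^[i + 1] u))).set 13 (x.length - i) with hS
  have hok : ∀ i, Ok x 9 (S i) := fun i =>
    ((h.set (by simp) (by simp) (Λ.rowH_le _)).set (by simp) (by simp) (Λ.rowH_le _)).set
      (by simp) (by simp) (by omega)
  have heq : ∀ i, ∀ e : Bool, (e = true ↔ f^[i + 1] u = u) →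
      Runs x L (eqVertex 11 10) (S i) e (S i) := fun i e he =>
    Λ.runs_eqVertex hL (by simp) (by simp) ((hok i).mono (by omega)) (by simp [hS, Regs.set_reg])
      (by simp [hS, Regs.set_reg, hu]) he
  have hpos : ∀ i (e : Bool), decide (x.length - i ≠ 0) = e → Runs x L (pos 13) (S i) e (S i) :=
    fun i e he => runs_pos_of_eq (by simpa [hS] using he)
  refine (runs_copy (by decide) (by decide) (by decide) h0 (hu ▸ hrow u)).seq ?_
  refine (Λ.runs_pathStep E hs ht hc hL
    (h.set (j := 12) (by simp) (by simp) (hu ▸ Λ.rowH_le u)) (u := u) (by simp [hu]) hodd).seq ?_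
  refine (runs_inputLength (r := 13) hL (by exact h.head) (by simp [Regs.set_reg, h13])).seq ?_
  have r := Runs.loop_seq (x := x) (L := L)
    (T := (pos 13).bind fun e => if e then negate (eqVertex 11 10) else ret false)
    (F := (copy 0 11 12).seq (pathStep.seq (dec 13))) S j
    (fun i hi => (hpos i true (by simp; omega)).bind
      (heq i false (by simpa using hlt i hi)).negate)
    (fun i hi => by
      refine (runs_copy (by decide) (by decide) (by decide)
        ((hok i).scratch 0 (by simp)) (by simp [hS, Regs.set_reg, hrow])).seq ?_
      refine (Λ.runs_pathStep E hs ht hc hL ((hok i).set (j := 12) (by simp) (by simp)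
        ((hok i).le 11)) (u := f^[i + 1] u) (by simp [hS, Regs.set_reg])
        (E.iterate_chordStep_odd hcm hodd _)).seq ?_
      refine runs_dec_of_eq (by simp [hS, Regs.set_reg]; omega) ?_
      rw [← hf, ← Function.iterate_succ_apply' f]
      refine Regs.ext_reg rfl (fun l => ?_) rfl
      simp only [hS, Regs.set_reg]
      grind)
    (by
      by_cases hj' : j < x.length
      · exact (hpos j true (by simp; omega)).bind (heq j true (by simpa using hend hj')).negate
      · exact (hpos j false (by simp; omega)).bind (runs_ret _ _))
  convert r using 1
  simp [hS, hu, hf]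

/-- The program writes the two edges of the new cycle at `u`. -/
theorem runs_emitVertex (Λ : Layout x G H s t) (E : CycleEnum G H n v idx) (hs : idx s = 0)
    (ht : idx t = n - 1) (hc : ∀ u, Λ.IsFirstChord u (c u)) (hL : x.length + 2 < 2 ^ L) {u w : V}
    (hodd : idx u % 2 = 1) (huw : H.Adj u w) :
    ∃ e₁ e₂, e₁ ≠ e₂ ∧ (∀ z, NewEdge H v idx c u z ↔ z = e₁ ∨ z = e₂) ∧
      ∀ σ : Regs 20, Ok x 9 σ → σ.reg 9 = Λ.rowH w → σ.reg 10 = Λ.rowH u →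
        (∀ r : Reg, 11 ≤ r.val → r.val < 15 → σ.reg r = 0) →
        Runs x L emitVertex σ () (σ.write (encodeNumbers [Λ.name u, Λ.name e₁] ++
          encodeNumbers [Λ.name u, Λ.name e₂])) := by
  obtain ⟨j, hj, hlt, hend, hper⟩ := Λ.exists_period (chordStep v idx c) u
  have hcm : IsChordMap G H idx c := fun b _ => (hc b).adj
  set f := chordStep v idx c with hf
  set S : Regs 20 → Regs 20 := fun σ => ((σ.set 12 (Λ.rowH (f^[j] u))).set 11
    (Λ.rowH (f^[j + 1] u))).set 13 (x.length - j) with hS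
  have hok : ∀ σ : Regs 20, Ok x 9 σ → Ok x 9 (S σ) := fun σ h =>
    ((h.set (by simp) (by simp) (Λ.rowH_le _)).set (by simp) (by simp) (Λ.rowH_le _)).set
      (by simp) (by simp) (by omega)
  have hfin : ∀ (σ : Regs 20), (∀ r : Reg, 11 ≤ r.val → r.val < 15 → σ.reg r = 0) →
      ∀ σ' : Regs 20, σ'.head = σ.head → (∀ r : Reg, ¬ (11 ≤ r.val ∧ r.val < 15) →
        σ'.reg r = σ.reg r) → Runs x L ((clear 11).seq ((clear 12).seq ((clear 13).seq (clear 14))))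
        σ' () ⟨σ.head, σ.reg, σ'.out⟩ := by
    intro σ h0 σ' h1 h2
    refine (runs_clear _ _).seq ((runs_clear _ _).seq ((runs_clear _ _).seq ?_))
    convert runs_clear _ _ using 1
    refine Regs.ext_reg h1.symm (fun l => ?_) rfl
    have := h0 l
    have := h2 l
    simp only [Regs.set_reg]
    grind
  by_cases hsw : f^[j + 1] u = u
  · have hsu : Switched v idx c u := ⟨hodd, hper.mpr hsw⟩
    have hsp : Switched v idx c (f^[j] u) :=
      ⟨E.iterate_chordStep_odd hcm hodd j, j + 1, by omega, by
        change f^[j + 1] (f^[j] u) = f^[j] u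
        rw [← Function.iterate_add_apply, add_comm, Function.iterate_add_apply, hsw]⟩
    have hpu : f (f^[j] u) = u := by rw [← Function.iterate_succ_apply' f, hsw]
    set p := f^[j] u with hp
    have hcp : H.Adj u (c p) := by
      have := E.adj_chordStep hcm hsp.1
      rwa [← hf, hpu] at this
    refine ⟨c u, Λ.other u (c p), fun h => (hcm u hodd).2 ?_, fun z => ?_, fun σ h h9 h10 h0 => ?_⟩
    · rw [h, Λ.adj_iff_other hcp]; exact .inr rfl
    · rw [E.newEdge_of_switched hcm hsu hsp hpu, Λ.adj_iff_other hcp]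
      have := Λ.other_ne (c := u) (p := c p)
      grind
    · refine (Λ.runs_findPeriod E hs ht hc hL hodd hj hlt hend h h10 (h0 13 (by simp)
        (by simp))).seq ?_
      have hok := hok σ h
      change Runs x L _ (S σ) _ _
      set σ₂ := ((S σ).set 14 (Λ.rowH (c p))).set 11 (Λ.rowH (Λ.other u (c p))) with hσ₂
      have hok₁ : Ok x 9 ((S σ).set 14 (Λ.rowH (c p))) :=
        hok.set (by simp) (by simp) (Λ.rowH_le _)
      have hok₂ : Ok x 9 σ₂ := hok₁.set (by simp) (by simp) (Λ.rowH_le _)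
      have hok₃ : Ok x 9 (σ₂.set 14 (Λ.rowH (c u))) :=
        hok₂.set (by simp) (by simp) (Λ.rowH_le _)
      refine Runs.seq (σ' := (σ₂.set 14 (Λ.rowH (c u))).write
        (encodeNumbers [Λ.name u, Λ.name (c u)] ++
          encodeNumbers [Λ.name u, Λ.name (Λ.other u (c p))])) ?_
        (hfin σ h0 _ rfl fun r hr => ?_)
      · refine (Λ.runs_eqVertex hL (by simp) (by simp) (hok.mono (by omega)) (u := u) (w := u)
          (by simp [hS, Regs.set_reg, hsw]) (by simp [hS, Regs.set_reg, h10]) (e := true)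
          (by simp)).bind ?_
        refine (Λ.runs_chord hL (by simp) (by simp) (by simp) (by simp) (hok.mono (by omega))
          (u := p) (by simp [hS, Regs.set_reg, hp]) (hc p)).seq ?_
        refine (Λ.runs_next hL (by simp) (by simp) (by simp) (by simp) (by decide) (by decide)
          (hok₁.mono (by omega)) (u := c p) (w := u) (by simp)
          (by simp [hS, Regs.set_reg, h10])).seq ?_
        refine (Λ.runs_chord hL (by simp) (by simp) (by simp) (by simp) (hok₂.mono (by omega))
          (u := u) (by simp [hσ₂, hS, Regs.set_reg, h10]) (hc u)).seq ?_
        refine (Λ.runs_emitEdge hL (by simp) (by simp) (hok₃.mono (by omega)) (u := u) (w := c u)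
          (by simp [hσ₂, hS, Regs.set_reg, h10]) (by simp)).seq ?_
        convert Λ.runs_emitEdge hL (a := 10) (b := 11) (by simp) (by simp) ((hok₃.write _).mono (by omega)) (u := u)
          (w := Λ.other u (c p)) (by simp [hσ₂, hS, Regs.set_reg, h10])
          (by simp [hσ₂, Regs.set_reg]) using 1
        rw [Regs.write_write]
      · simp only [hσ₂, hS, Regs.write_reg, Regs.set_reg]
        grind
  · have hsu : ¬ Switched v idx c u := fun h => hsw (hper.mp h.2)
    refine ⟨w, Λ.other u w, Λ.other_ne.symm, fun z => ?_, fun σ h h9 h10 h0 => ?_⟩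
    · rw [E.newEdge_of_not_switched hcm hodd hsu, Λ.adj_iff_other huw]
    · refine (Λ.runs_findPeriod E hs ht hc hL hodd hj hlt hend h h10 (h0 13 (by simp)
        (by simp))).seq ?_
      have hok := hok σ h
      change Runs x L _ (S σ) _ _
      refine Runs.seq (σ' := ((S σ).set 11 (Λ.rowH (Λ.other u w))).write
        (encodeNumbers [Λ.name u, Λ.name w] ++
          encodeNumbers [Λ.name u, Λ.name (Λ.other u w)])) ?_
        (hfin σ h0 _ rfl fun r hr => ?_)
      · refine (Λ.runs_eqVertex hL (by simp) (by simp) (hok.mono (by omega)) (u := f^[j + 1] u)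
          (w := u) (by simp [hS, Regs.set_reg]) (by simp [hS, Regs.set_reg, h10]) (e := false)
          (by simpa using hsw)).bind ?_
        refine (Λ.runs_emitEdge hL (by simp) (by simp) (hok.mono (by omega)) (u := u) (w := w)
          (by simp [hS, Regs.set_reg, h10]) (by simp [hS, Regs.set_reg, h9])).seq ?_
        have hok₁ := hok.write (encodeNumbers [Λ.name u, Λ.name w])
        refine (Λ.runs_next hL (by simp) (by simp) (by simp) (by simp) (by decide) (by decide)
          (hok₁.mono (by omega)) (u := w) (w := u) (by simp [hS, Regs.set_reg, h9])
          (by simp [hS, Regs.set_reg, h10])).seq ?_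
        have hok₂ := hok₁.set (j := 11) (by simp) (by simp) (Λ.rowH_le (Λ.other u w))
        convert Λ.runs_emitEdge hL (a := 10) (b := 11) (by simp) (by simp) (hok₂.mono (by omega)) (u := u)
          (w := Λ.other u w) (by simp [hS, Regs.set_reg, h10]) (by simp) using 1
        rw [Regs.write_set, Regs.write_write]
      · simp only [hS, Regs.write_reg, Regs.set_reg]
        grind

end Layout

namespace Layout

open Frag

variable {x : List Letter} {L : ℕ} {V : Type*} {G H : SimpleGraph V} {s t : V}
  {n : ℕ} {v : ℕ → V} {idx : V → ℕ} {c : V → V}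

theorem runs_emitCycle (Λ : Layout x G H s t) (E : CycleEnum G H n v idx) (hs : idx s = 0)
    (ht : idx t = n - 1) (hc : ∀ u, Λ.IsFirstChord u (c u)) (hL : x.length + 2 < 2 ^ L)
    (hx : 1 ≤ x.length) :
    ∃ e₁ e₂ : V → V, (∀ u, idx u % 2 = 1 → e₁ u ≠ e₂ u ∧
        ∀ z, NewEdge H v idx c u z ↔ z = e₁ u ∨ z = e₂ u) ∧
      ∃ σ', Runs x L emitCycle ⟨0, fun _ => 0, []⟩ () σ' ∧
        σ'.out = (List.range (n / 2)).flatMap fun j =>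
          encodeNumbers [Λ.name (v (2 * j + 1)), Λ.name (e₁ (v (2 * j + 1)))] ++
          encodeNumbers [Λ.name (v (2 * j + 1)), Λ.name (e₂ (v (2 * j + 1)))] := by
  have h4 := E.four_le
  have heven := E.even
  have hex : ∀ u, ∃ e₁ e₂, idx u % 2 = 1 →
      (e₁ ≠ e₂ ∧ ∀ z, NewEdge H v idx c u z ↔ z = e₁ ∨ z = e₂) ∧
      ∀ σ : Regs 20, Ok x 9 σ → σ.reg 9 = Λ.rowH (before t v (idx u)) → σ.reg 10 = Λ.rowH u →
        (∀ r : Reg, 11 ≤ r.val → r.val < 15 → σ.reg r = 0) →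
        Runs x L emitVertex σ () (σ.write (encodeNumbers [Λ.name u, Λ.name e₁] ++
          encodeNumbers [Λ.name u, Λ.name e₂])) := by
    intro u
    by_cases hu : idx u % 2 = 1
    · have hadj := adj_before E ht (E.lt u)
      rw [E.v_idx] at hadj
      obtain ⟨e₁, e₂, h1, h2, h3⟩ := Λ.runs_emitVertex E hs ht hc hL hu hadj
      exact ⟨e₁, e₂, fun _ => ⟨⟨h1, h2⟩, h3⟩⟩
    · exact ⟨u, u, fun h => absurd h hu⟩
  choose e₁ e₂ he using hex
  refine ⟨e₁, e₂, fun u hu => (he u hu).1, ?_⟩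
  set σ₁ : Regs 20 := (((⟨0, fun _ => 0, []⟩ : Regs 20).set 18 1).set 19 1).set 19 2 with hσ₁
  have hzero : ∀ r : Reg, r.val < 18 → σ₁.reg r = 0 := fun r hr => by
    simp only [hσ₁, Regs.set_reg]; grind
  have hok₁ : Ok x 9 σ₁ :=
    ⟨rfl, fun r hr => hzero r (by omega), hzero _ (by simp), by simp [hσ₁, Regs.set_reg],
      by simp [hσ₁], fun r => by simp only [hσ₁, Regs.set_reg]; split_ifs <;> omega⟩
  set out : ℕ → List Letter := fun i => (List.range i).flatMap fun j =>
    encodeNumbers [Λ.name (v (2 * j + 1)), Λ.name (e₁ (v (2 * j + 1)))] ++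
    encodeNumbers [Λ.name (v (2 * j + 1)), Λ.name (e₂ (v (2 * j + 1)))] with hout
  have hok : ∀ w i, Ok x 9 (Λ.walkState v 9 10 (σ₁.write w) i) := fun w i =>
    Λ.ok_walkState (by simp) (by simp) (by simp) (by simp) (hok₁.write w) i
  have hwalk : ∀ w i, i + 1 < n → Runs x L (walkStep 9 10) (Λ.walkState v 9 10 (σ₁.write w) i) ()
      (Λ.walkState v 9 10 (σ₁.write w) (i + 1)) := fun w i hi =>
    Λ.runs_walkStep_walkState E ht hL (by simp) (by simp) (by simp) (by simp) (by decide)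
      ((hok₁.write w).mono (by omega)) hi
  have htest : ∀ i, 2 * i + 1 < n → ∀ e : Bool, (e = true ↔ 2 * i + 1 ≠ n - 1) →
      Runs x L ((walkStep 9 10).seq (emitVertex.seq (negate (eqTok 18 10 17 19 17 18))))
        (Λ.walkState v 9 10 (σ₁.write (out i)) (2 * i)) e
        (Λ.walkState v 9 10 (σ₁.write (out (i + 1))) (2 * i + 1)) := by
    intro i hi e hei
    have hidx : idx (v (2 * i + 1)) = 2 * i + 1 := E.idx_v _ hi
    refine (hwalk _ _ hi).seq (Runs.seq (σ' := Λ.walkState v 9 10 (σ₁.write (out (i + 1)))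
      (2 * i + 1)) ?_ ?_)
    · convert (he (v (2 * i + 1)) (by omega)).2 _ (hok (out i) (2 * i + 1))
        (by simp [walkState, Regs.set_reg, hidx]) (by simp [walkState])
        (fun r hr hr' => ?_) using 1
      · simp [hout, List.range_succ, walkState, Regs.write, Regs.set]
      · rw [← hzero r (by omega)]
        simp only [walkState, Regs.set_reg, Regs.write_reg]
        grind
    · have hok' := hok (out (i + 1)) (2 * i + 1)
      have := (runs_eqTok (L := L) hL (g := 18) (i := 10) (j := 17) (g' := 19) (i' := 17)
        (j' := 18) (by simp) (by simp) (by simp) (by simp) (by simp) (by simp)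
        (hok'.mono (by omega)) (m := Λ.name (v (2 * i + 1))) (m' := Λ.name t)
        (by rw [hok'.c1, hok'.c0]; simpa [walkState] using Λ.tokenH (v (2 * i + 1)))
        (by rw [hok'.c2, hok'.c0, hok'.c1]; exact Λ.tokenT)).negate
      have e' : (!decide (Λ.name (v (2 * i + 1)) = Λ.name t)) = e := by
        rw [Bool.eq_iff_iff, hei, Bool.not_eq_true', decide_eq_false_iff_not, Λ.name_inj.eq_iff,
          not_iff_not]
        exact ⟨fun h => by rw [← hidx, h, ht], fun h => E.ext_idx (by omega)⟩
      rwa [e'] at this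
  have hr := Runs.loop_seq₂ (fun i => Λ.walkState v 9 10 (σ₁.write (out i)) (2 * i))
    (fun i => Λ.walkState v 9 10 (σ₁.write (out (i + 1))) (2 * i + 1)) (n / 2 - 1)
    (fun i hi => htest i (by omega) true (by simp; omega))
    (fun i hi => hwalk _ (2 * i + 1) (by omega))
    (htest _ (by omega) false (by simp; omega))
  have hs₀ := Λ.runs_startWalk E hs hL (p := 9) (c := 10) (by simp) (by simp) (by simp) (by simp)
    (by decide) (hok₁.mono (l' := 3) (by omega))
  refine ⟨Λ.walkState v 9 10 (σ₁.write (out (n / 2 - 1 + 1))) (2 * (n / 2 - 1) + 1), ?_, ?_⟩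
  · refine (runs_inc_of_eq (by change 0 + 1 < _; omega) rfl).seq ((runs_inc_of_eq ?_ rfl).seq
      ((runs_inc_of_eq ?_ ?_).seq (hs₀.seq ?_)))
    · change 0 + 1 < _; omega
    · change 0 + 1 + 1 < _; omega
    · simp [hσ₁, Regs.set_reg]
    · convert hr using 1
      simp [hout]
  · change [] ++ out (n / 2 - 1 + 1) = _
    rw [List.nil_append, Nat.sub_add_cancel (by omega)]

end Layout

/-- The tokens of a word that consists of tables. -/
theorem tokenAt_of_getElem? {x suf : List Letter} {gs : List (List (List ℕ))}
    {rows : List (List ℕ)} {l : List ℕ} {i j m : ℕ}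
    (hx : x = gs.flatMap (fun T => T.flatMap encodeNumbers ++ [.endGraph]) ++
      rows.flatMap encodeNumbers ++ suf)
    (hi : rows[i]? = some l) (hj : l[j]? = some m) : TokenAt x gs.length i j m := by
  obtain ⟨hi', rfl⟩ := List.getElem?_eq_some_iff.mp hi
  obtain ⟨hj', rfl⟩ := List.getElem?_eq_some_iff.mp hj
  refine ⟨gs, rows.take i, rows[i].take j, (rows[i].drop (j + 1)).flatMap encodeNumber ++
    [.endList] ++ (rows.drop (i + 1)).flatMap encodeNumbers ++ suf, rfl,
    List.length_take_of_le hi'.le, List.length_take_of_le hj'.le, ?_⟩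
  have e₁ : rows = rows.take i ++ rows[i] :: rows.drop (i + 1) := by simp
  have e₂ : rows[i] = rows[i].take j ++ rows[i][j] :: rows[i].drop (j + 1) := by simp
  have e₃ : rows.flatMap encodeNumbers = (rows.take i).flatMap encodeNumbers ++
      ((rows[i].take j).flatMap encodeNumber ++ (encodeNumber rows[i][j] ++
        ((rows[i].drop (j + 1)).flatMap encodeNumber ++
          ([.endList] ++ (rows.drop (i + 1)).flatMap encodeNumbers)))) := by
    conv_lhs => rw [e₁, List.flatMap_append, List.flatMap_cons, encodeNumbers, e₂,
      List.flatMap_append, List.flatMap_cons]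
    simp only [List.append_assoc]
  rw [hx, e₃]
  simp only [List.append_assoc]

section Words

variable {V : Finset ℕ} {G H : SimpleGraph V}

theorem IsAdjacencyLists.exists_row {rows : List (V × List V)} (h : IsAdjacencyLists G rows) :
    ∃ (row : V → ℕ) (nbs : V → List V), ∀ u, rows[row u]? = some (u, nbs u) ∧ (nbs u).Nodup ∧
      (∀ w, w ∈ nbs u ↔ G.Adj u w) ∧ ∀ i < row u, ∃ r, rows[i]? = some r ∧ r.1 ≠ u := by
  obtain ⟨h1, h2, h3⟩ := h
  have : ∀ u, ∃ (i : ℕ) (l : List V), rows[i]? = some (u, l) ∧ l.Nodup ∧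
      (∀ w, w ∈ l ↔ G.Adj u w) ∧ ∀ j < i, ∃ r, rows[j]? = some r ∧ r.1 ≠ u := by
    intro u
    obtain ⟨⟨u, l⟩, hr, rfl⟩ := List.mem_map.mp (h2 u)
    obtain ⟨i, hi⟩ := List.mem_iff_getElem?.mp hr
    refine ⟨i, l, hi, (h3 _ hr).1, (h3 _ hr).2, fun j hj => ?_⟩
    have hi' := (List.getElem?_eq_some_iff.mp hi).1
    refine ⟨rows[j], List.getElem?_eq_getElem (hj.trans hi'), fun e => hj.ne ?_⟩
    refine (h1.getElem_inj_iff (hi := by simpa using hj.trans hi') (hj := by simpa using hi')).mp ?_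
    simp only [List.getElem_map]
    rw [e, (List.getElem?_eq_some_iff.mp hi).2]
  choose row nbs h using this
  exact ⟨row, nbs, h⟩

/-- The numbers in adjacency lists. -/
def numberRows (rows : List (V × List V)) : List (List ℕ) :=
  rows.map fun r => (r.1 :: r.2).map Subtype.val

theorem encodeGraph_eq (rows : List (V × List V)) :
    encodeGraph rows = (numberRows rows).flatMap encodeNumbers ++ [.endGraph] := by
  rw [encodeGraph, numberRows, List.flatMap_map]

theorem exists_layout {n : ℕ} {v : ℕ → V} {idx : V → ℕ} (E : CycleEnum G H n v idx) (s t : V)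
    {rowsG rowsH : List (V × List V)} (hG : IsAdjacencyLists G rowsG)
    (hH : IsAdjacencyLists H rowsH) :
    ∃ Λ : Layout (encodeInstance rowsG rowsH s t) G H s t, Λ.name = Subtype.val := by
  obtain ⟨rowG, nbsG, hG⟩ := hG.exists_row
  obtain ⟨rowH, nbsH, hH⟩ := hH.exists_row
  have hpair : ∀ u, ∃ a b, nbsH u = [a, b] := by
    intro u
    obtain ⟨y, z, hyz, h⟩ := E.exists_neighbors u
    rw [← List.length_eq_two, ← List.toFinset_card_of_nodup (hH u).2.1, ← Finset.card_pair hyz]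
    congr 1
    ext w
    simp [(hH u).2.2.1, h]
  choose nb₁ nb₂ hnb using hpair
  have hx₀ : encodeInstance rowsG rowsH s t =
      ([] : List (List (List ℕ))).flatMap (fun T => T.flatMap encodeNumbers ++ [.endGraph]) ++
        (numberRows rowsG).flatMap encodeNumbers ++
        (.endGraph :: (encodeGraph rowsH ++ encodeNumbers [s.val, t.val])) := by
    simp [encodeInstance, encodeGraph_eq]
  have hx₁ : encodeInstance rowsG rowsH s t =
      [numberRows rowsG].flatMap (fun T => T.flatMap encodeNumbers ++ [.endGraph]) ++
        (numberRows rowsH).flatMap encodeNumbers ++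
        (.endGraph :: encodeNumbers [s.val, t.val]) := by
    simp [encodeInstance, encodeGraph_eq]
  have hx₂ : encodeInstance rowsG rowsH s t =
      [numberRows rowsG, numberRows rowsH].flatMap
        (fun T => T.flatMap encodeNumbers ++ [.endGraph]) ++
        [[s.val, t.val]].flatMap encodeNumbers ++ [] := by
    simp [encodeInstance, encodeGraph_eq]
  have hget : ∀ (rows : List (V × List V)) (i : ℕ) (r : V × List V), rows[i]? = some r →
      (numberRows rows)[i]? = some ((r.1 :: r.2).map Subtype.val) := by
    intro rows i r h
    rw [numberRows, List.getElem?_map, h]; rfl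
  have hgetH : ∀ u, (numberRows rowsH)[rowH u]? = some [u.val, (nb₁ u).val, (nb₂ u).val] :=
    fun u => by rw [hget _ _ _ (hH u).1, hnb]; rfl
  refine ⟨⟨Subtype.val, rowG, rowH, nbsG, nb₁, nb₂, Subtype.val_injective, fun u => ?_,
    fun u j w hw => ?_, fun u => ?_, fun u => ?_, fun u => ?_, ?_, ?_, fun u i hi => ?_,
    fun u i hi => ?_, fun u w h => ?_, fun u => ?_, fun u w => ((hG u).2.2.1 w).symm,
    fun u w => ?_⟩, rfl⟩
  · exact tokenAt_of_getElem? hx₀ (hget _ _ _ (hG u).1) rfl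
  · exact tokenAt_of_getElem? hx₀ (hget _ _ _ (hG u).1) (by simp [hw])
  · exact tokenAt_of_getElem? hx₁ (hgetH u) rfl
  · exact tokenAt_of_getElem? hx₁ (hgetH u) rfl
  · exact tokenAt_of_getElem? hx₁ (hgetH u) rfl
  · exact tokenAt_of_getElem? hx₂ (i := 0) rfl rfl
  · exact tokenAt_of_getElem? hx₂ (i := 0) rfl rfl
  · obtain ⟨r, hr, hru⟩ := (hG u).2.2.2 i hi
    exact ⟨r.1, hru, tokenAt_of_getElem? hx₀ (hget _ _ _ hr) rfl⟩
  · obtain ⟨r, hr, hru⟩ := (hH u).2.2.2 i hi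
    exact ⟨r.1, hru, tokenAt_of_getElem? hx₁ (hget _ _ _ hr) rfl⟩
  · have h₁ := (hH u).1
    rw [h, (hH w).1] at h₁
    exact (congrArg Prod.fst (Option.some.inj h₁)).symm
  · have := (hH u).2.1
    rw [hnb] at this
    simpa using this
  · rw [← (hH u).2.2.1, hnb]; simp

/-- The edges of the new cycle, listed at every second vertex. -/
theorem isEdgeList_newCycle {n : ℕ} {v : ℕ → V} {idx : V → ℕ} {c e₁ e₂ : V → V}
    (E : CycleEnum G H n v idx) (he : ∀ u, idx u % 2 = 1 → e₁ u ≠ e₂ u ∧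
      ∀ z, NewEdge H v idx c u z ↔ z = e₁ u ∨ z = e₂ u) :
    IsEdgeList (newCycle H v idx c) ((List.range (n / 2)).flatMap fun j =>
      [(v (2 * j + 1), e₁ (v (2 * j + 1))), (v (2 * j + 1), e₂ (v (2 * j + 1)))]) := by
  have hidx : ∀ j < n / 2, idx (v (2 * j + 1)) = 2 * j + 1 := fun j hj => E.idx_v _ (by omega)
  have hnew : ∀ j < n / 2, ∀ z, NewEdge H v idx c (v (2 * j + 1)) z ↔
      z = e₁ (v (2 * j + 1)) ∨ z = e₂ (v (2 * j + 1)) := fun j hj =>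
    (he _ (by rw [hidx j hj]; omega)).2
  have hmem : ∀ j < n / 2, ∀ e : Sym2 V, e ∈ [s(v (2 * j + 1), e₁ (v (2 * j + 1))),
      s(v (2 * j + 1), e₂ (v (2 * j + 1)))] →
      ∃ z, NewEdge H v idx c (v (2 * j + 1)) z ∧ e = s(v (2 * j + 1), z) := by
    intro j hj e h
    simp only [List.mem_cons, List.not_mem_nil, or_false] at h
    rcases h with rfl | rfl
    · exact ⟨_, (hnew j hj _).mpr (.inl rfl), rfl⟩
    · exact ⟨_, (hnew j hj _).mpr (.inr rfl), rfl⟩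
  simp only [IsEdgeList, List.map_flatMap, List.map_cons, List.map_nil]
  refine ⟨List.nodup_flatMap.mpr ⟨fun j hj => ?_, ?_⟩, fun e => ⟨fun h => ?_, fun h => ?_⟩⟩
  · have hj := List.mem_range.mp hj
    simpa only [List.nodup_cons, List.mem_singleton, List.not_mem_nil, not_false_eq_true,
      List.nodup_nil, and_true, Sym2.congr_right] using
      (he (v (2 * j + 1)) (by rw [hidx j hj]; omega)).1
  · refine List.nodup_range.imp_of_mem fun {i j} hi hj hij e h h' => hij ?_
    have hi := List.mem_range.mp hi
    have hj := List.mem_range.mp hj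
    obtain ⟨y, hy, rfl⟩ := hmem i hi e h
    obtain ⟨z, hz, hyz⟩ := hmem j hj _ h'
    have h1 := hidx i hi
    have h2 := hidx j hj
    have h3 := hy.2.1
    have h4 := hz.2.1
    rcases Sym2.eq_iff.mp hyz with ⟨h, -⟩ | ⟨h, -⟩
    · rw [h] at h1; omega
    · rw [h] at h1; omega
  · obtain ⟨j, hj, h⟩ := List.mem_flatMap.mp h
    obtain ⟨z, hz, rfl⟩ := hmem j (List.mem_range.mp hj) e h
    exact .inl hz
  · have key : ∀ u w, NewEdge H v idx c u w → s(u, w) ∈ (List.range (n / 2)).flatMap fun j =>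
        [s(v (2 * j + 1), e₁ (v (2 * j + 1))), s(v (2 * j + 1), e₂ (v (2 * j + 1)))] := by
      intro u w h
      have h1 := h.1
      have h2 := E.lt u
      have h3 := E.even
      have hu : u = v (2 * (idx u / 2) + 1) := E.eq_v (by omega)
      refine List.mem_flatMap.mpr ⟨idx u / 2, List.mem_range.mpr (by omega), ?_⟩
      rw [← hu]
      rcases ((he u h1).2 w).mp h with rfl | rfl <;> simp
    induction e with
    | h u w =>
      rcases h with h | h
      · exact key _ _ h
      · rw [Sym2.eq_swap]; exact key _ _ h

end Words

theorem TuringTransducer.OutputsInSpace.mono {α β : Type} {M : TuringTransducer α β} {x : List α}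
    {y : List β} {S S' : ℕ} (h : M.OutputsInSpace x y S) (hS : S ≤ S') : M.OutputsInSpace x y S' :=
  ⟨h.1, fun c hc j => (h.2 c hc j).trans_le hS⟩

theorem Frag.Runs.outputsInSpace {k : ℕ} {x : List Letter} {L : ℕ} {F : Frag k Unit} {σ : Regs k}
    (h : Runs x L F ⟨0, fun _ => 0, []⟩ () σ) :
    (markTapes.seq F).toMachine.OutputsInSpace x σ.out (L + 2) := by
  obtain ⟨r, hr, hp⟩ := path_markTapes (k := k) (L := L) (x := x)
  obtain ⟨r', hr', hp'⟩ := h r hr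
  rw [← hr'.2.1]
  exact Frag.outputsInSpace (hp.bind hp') fun j => by rw [(hr'.2.2 j).1]; omega

theorem theorem2 :
    ∃ (M : TuringTransducer Letter Letter) (C : ℕ),
      ∀ (V : Finset ℕ) (G H : SimpleGraph V) [DecidableRel G.Adj] (s t : V)
        (rowsG rowsH : List (V × List V)),
        G.IsBipartite → IsPfaffian G → (∀ v, 3 ≤ G.degree v) →
        IsHamCycle G H → H.Adj s t →
        IsAdjacencyLists G rowsG → IsAdjacencyLists H rowsH →
        ∃ (H' : SimpleGraph V) (es : List (V × V)),
          IsHamCycle G H' ∧ H' ≠ H ∧ H'.Adj s t ∧ IsEdgeList H' es ∧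
          M.OutputsInSpace (encodeInstance rowsG rowsH s t) (encodeEdges es)
            (C * (Nat.log 2 (encodeInstance rowsG rowsH s t).length + 1)) := by
  refine ⟨(Frag.markTapes.seq Frag.emitCycle).toMachine, 4, ?_⟩
  intro V G H _ s t rowsG rowsH hbip hpf hdeg hham hst hrG hrH
  obtain ⟨n, v, idx, E, hs, ht⟩ := exists_cycleEnum hbip hham hst
  set x := encodeInstance rowsG rowsH s t with hx
  obtain ⟨Λ, hname⟩ : ∃ Λ : Layout x G H s t, Λ.name = Subtype.val :=
    exists_layout E s t hrG hrH
  have hchord : ∀ u, ∃ w, Λ.IsFirstChord u w := by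
    intro u
    obtain ⟨y, z, -, hyz⟩ := E.exists_neighbors u
    by_contra hno
    have hsub : G.neighborFinset u ⊆ {y, z} := by
      intro w hw
      rw [SimpleGraph.mem_neighborFinset] at hw
      by_contra hw'
      exact hno (Λ.exists_isFirstChord ⟨hw, fun h => hw' (by simpa using (hyz w).mp h)⟩)
    have := (Finset.card_le_card hsub).trans Finset.card_le_two
    rw [SimpleGraph.card_neighborFinset_eq_degree] at this
    have := hdeg u
    omega
  choose c hc using hchord
  have hcm : IsChordMap G H idx c := fun b _ => (hc b).adj
  have hx1 : 1 ≤ x.length := by simp [hx, encodeInstance, encodeGraph]; omega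
  have hL : x.length + 2 < 2 ^ (Nat.log 2 x.length + 2) := by
    have h1 := Nat.lt_pow_succ_log_self (b := 2) (by norm_num) x.length
    have h2 : 1 ≤ 2 ^ Nat.log 2 x.length := Nat.one_le_two_pow
    rw [Nat.succ_eq_add_one, pow_succ] at h1
    rw [pow_add]
    omega
  obtain ⟨e₁, e₂, he, σ, hσ, hout⟩ := Λ.runs_emitCycle E hs ht hc hL hx1
  refine ⟨newCycle H v idx c, _, E.isHamCycle_newCycle hcm hpf, E.newCycle_ne hcm,
    E.newCycle_adj_anchor hcm hs ht, isEdgeList_newCycle E he, ?_⟩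
  convert hσ.outputsInSpace.mono (S' := 4 * (Nat.log 2 x.length + 1)) (by omega) using 1
  rw [hout, hname, encodeEdges, List.flatMap_assoc]
  simp
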